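/- **Setting.** Let $K\cong(\mathbb C^\times)^r$ be a torus with cocharacter lattice $\mathbb L$ and character lattice $\mathbb L^\vee=\mathrm{Hom}(\mathbb L,\mathbb Z)$, and let $D_1,\dots,D_m\in\mathbb L^\vee$. For $I\subseteq\{1,\dots,m\}$ put $\angle_I=\{\sum_{i\in I}a_iD_i: a_i\in\mathbb R_{>0}\}\subset\mathbb L^\vee\otimes\mathbb R$ (so $\angle_\emptyset=\{0\}$). For $\omega\in\mathbb L^\vee\otimes\mathbb R$ let $\mathcal A_\omega=\{I:\omega\in\angle_I\}$ be the set of anticones, $U_\omega=\bigcup_{I\in\mathcal A_\omega}\{z\in\mathbb C^m: z_i\ne0\ \text{for}\ i\in I\}$ and $X_\omega=[U_\omega/K]$, where $K$ acts on the $i$-th coordinate through $D_i$. The same notation is used for a group $\mathrm{Hom}(A,\mathbb C^\times)$ with character group $A$. Call $\omega$ stable if (A1) $\{1,\dots,m\}\in\mathcal A_\omega$ and (A2) $\{D_i:i\in I\}$ spans $\mathbb L^\vee\otimes\mathbb R$ for every $I\in\mathcal A_\omega$. Chambers are the connected components of the complement of the union of the closures of the $\angle_I$ with $|I|=r-1$.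 Let $\omega_\pm$ be stable, lying in chambers $C_\pm$ separated by a hyperplane $W=e^\perp$ with $e\in\mathbb L$ primitive, positive on $C_+$ and negative on $C_-$; assume that $W\cap\overline{C_+}=W\cap\overline{C_-}$ is a facet of both closures and that $\sum_iD_i\in W$. Put $X_+=X_{\omega_+}$, $U_+=U_{\omega_+}$, $M_+=\{i:D_i\cdot e>0\}$, $M_0=\{i:D_i\cdot e=0\}$ and $\mathbf a=(D_i\cdot e)_{i\in M_+}$, and let $\mathbb P(\mathbf a)=[(\mathbb C^{M_+}\setminus\{0\})/\mathbb C^\times]$ be the weighted projective stack. Let $\omega_0\in\mathbb L^\vee$ be a lattice point in the relative interior of $W\cap\overline{C_+}$, let $\overline X_0=\mathbb C^m/\!/_{\omega_0}K=\mathrm{Proj}\bigoplus_{n\ge0}\mathbb C[z_1,\dots,z_m]_{n\omega_0}$, and let $g_+:X_+\to\overline X_0$ be the morphism induced by the quotient map from the semistable locus of $\omega_0$ to $\overline X_0$. Assume that the $D_i$ with $i\in M_0$ generate the lattice $W\cap\mathbb L^\vee$. **Proposition.** Let $\mathbb L^\vee_{\mathrm{ex}}=\mathbb L^\vee/\langle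 D_i:i\in M_0\rangle$, with projection $p$, and let $\omega^+_{\mathrm{ex}}=p(\omega_+)$. 1. The assignment $p(\chi)\mapsto\chi\cdot e$ is a well-defined isomorphism $\mathbb L^\vee_{\mathrm{ex}}\cong\mathbb Z$. For the characters $p(D_1),\dots,p(D_m)$ and the stability condition $\omega^+_{\mathrm{ex}}$, a set $I$ is an anticone if and only if it meets $M_+$. The GIT data on $\mathbb L^\vee_{\mathrm{ex}}$ given by the characters $p(D_i)$, $i\in M_+$, and $\omega^+_{\mathrm{ex}}$ satisfy (A1) and (A2), and the corresponding toric DM stack $X_{\omega^+_{\mathrm{ex}}}$ is isomorphic to $\mathbb P(\mathbf a)$. (If all the characters $p(D_1),\dots,p(D_m)$ are kept, $\mathbb P(\mathbf a)$ is isomorphic to the closed substack of the resulting toric stack on which $z_i=0$ for all $i\notin M_+$.) 2. The morphism $g_+$ is well defined on $X_+$, and it contracts $\mathbb P(\mathbf a)$. Precisely, $M_0\in\mathcal A_{\omega_0}$. Let $z_0\in\mathbb C^m$ be a point such that $I=\{i:z_{0,i}\neq0\}$ is contained in $M_0$, belongs to $\mathcal A_{\omega_0}$, and $\{D_i:i\in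 I\}$ generates $W\cap\mathbb L^\vee$ (for example any $z_0$ with $I=M_0$). Let $x_0\in\overline X_0$ be the image of $z_0$. Then the homomorphism $e:\mathbb C^\times\to K$ and the map $\mathbb C^{M_+}\setminus\{0\}\to U_+$, $w\mapsto(w,z_0)$ (coordinates $w_i$ for $i\in M_+$ and $z_{0,i}$ for $i\notin M_+$), induce a closed immersion $\mathbb P(\mathbf a)\hookrightarrow X_+$, the composite $\mathbb P(\mathbf a)\to X_+\to\overline X_0$ is constant with value $x_0$, and every $\mathbb C$-point of $X_+$ that $g_+$ maps to $x_0$ lies in $\mathbb P(\mathbf a)$. -/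

import Mathlib

open CategoryTheory AlgebraicGeometry Opposite TensorProduct

noncomputable section

namespace ToricWall

/-! ## Schemes over `ℂ` -/

/-- The category of schemes over `ℂ`. -/
abbrev SchC := Over (Spec (CommRingCat.of ℂ))

/-- The big étale topology on schemes over `ℂ`. -/
abbrev etaleC : GrothendieckTopology SchC :=
  Scheme.etaleTopology.over (Spec (CommRingCat.of ℂ))

/-- The ring of global functions on a scheme over `ℂ`. -/
abbrev Fn (T : SchC) : Type := Γ(T.left, ⊤)

/-- Pullback of functions along a morphism of schemes over `ℂ`. -/
def pull {T' T : SchC} (u : T' ⟶ T) : Fn T →+* Fn T' := u.left.appTop.hom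

/-- The constant functions on a scheme over `ℂ`. -/
def const (T : SchC) : ℂ →+* Fn T :=
  ((Scheme.ΓSpecIso (CommRingCat.of ℂ)).inv ≫ T.hom.appTop).hom

@[simp] theorem pull_id (T : SchC) (x : Fn T) : pull (𝟙 T) x = x := by
  simp [pull]

@[simp] theorem pull_comp {T'' T' T : SchC} (v : T'' ⟶ T') (u : T' ⟶ T) (x : Fn T) :
    pull (v ≫ u) x = pull v (pull u x) := by
  simp only [pull, Over.comp_left, Scheme.Hom.comp_appTop]
  rfl

theorem mem_basicOpen_pull {T' T : SchC} (u : T' ⟶ T) (x : Fn T) (t : T'.left) :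
    t ∈ T'.left.basicOpen (pull u x) ↔ u.left t ∈ T.left.basicOpen x := by
  have h := Scheme.preimage_basicOpen_top u.left x
  change t ∈ T'.left.basicOpen (u.left.appTop x) ↔ _
  rw [← h]
  rfl

/-! ## Quotient stacks -/

/-- A presheaf of sets on schemes over `ℂ` with an action of a presheaf of groups `G`. -/
structure GSpace (G : SchCᵒᵖ ⥤ GrpCat.{0}) where
  /-- the underlying presheaf -/
  X : SchCᵒᵖ ⥤ Type
  /-- the action -/
  act : ∀ {T : SchC}, G.obj (op T) → X.obj (op T) → X.obj (op T)
  one_act : ∀ {T : SchC} (x : X.obj (op T)), act 1 x = x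
  mul_act : ∀ {T : SchC} (g h : G.obj (op T)) (x : X.obj (op T)),
    act (g * h) x = act g (act h x)
  map_act : ∀ {T' T : SchC} (u : T' ⟶ T) (g : G.obj (op T)) (x : X.obj (op T)),
    X.map u.op (act g x) = act (G.map u.op g) (X.map u.op x)

variable {G H : SchCᵒᵖ ⥤ GrpCat.{0}}

/-- An object of the quotient stack `[U/G]`: a scheme `base` over `ℂ`, an étale `G`-torsor
`π : P ⟶ base`, and a `G`-equivariant morphism `f : P ⟶ U`. -/
structure QuotStack (U : GSpace G) where
  base : SchC
  P : GSpace G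
  isSheaf : Presieve.IsSheaf etaleC P.X
  π : P.X ⟶ yoneda.obj base
  π_act : ∀ {T : SchC} (g : G.obj (op T)) (p : P.X.obj (op T)),
    π.app (op T) (P.act g p) = π.app (op T) p
  simply_transitive : ∀ {T : SchC} (p q : P.X.obj (op T)),
    π.app (op T) p = π.app (op T) q → ∃! g : G.obj (op T), P.act g p = q
  locally_trivial : ∃ R ∈ etaleC base, ∀ (T : SchC) (h : T ⟶ base), R h →
    ∃ p : P.X.obj (op T), π.app (op T) p = h
  f : P.X ⟶ U.X
  f_act : ∀ {T : SchC} (g : G.obj (op T)) (p : P.X.obj (op T)),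
    f.app (op T) (P.act g p) = U.act g (f.app (op T) p)

namespace QuotStack

variable {U : GSpace G} {V : GSpace H}

/-- A morphism of `[U/G]`: a morphism of base schemes with an equivariant morphism of torsors
above it that is compatible with the maps to `U`. -/
@[ext]
structure Hom (ξ η : QuotStack U) where
  base : ξ.base ⟶ η.base
  tot : ξ.P.X ⟶ η.P.X
  tot_act : ∀ {T : SchC} (g : G.obj (op T)) (p : ξ.P.X.obj (op T)),
    tot.app (op T) (ξ.P.act g p) = η.P.act g (tot.app (op T) p)
  tot_π : tot ≫ η.π = ξ.π ≫ yoneda.map base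
  tot_f : tot ≫ η.f = ξ.f

instance : Category (QuotStack U) where
  Hom := Hom
  id ξ :=
    { base := 𝟙 _
      tot := 𝟙 _
      tot_act := fun _ _ => rfl
      tot_π := by simp
      tot_f := by simp }
  comp a b :=
    { base := a.base ≫ b.base
      tot := a.tot ≫ b.tot
      tot_act := fun g p => by simp [a.tot_act, b.tot_act]
      tot_π := by simp [b.tot_π, reassoc_of% a.tot_π]
      tot_f := by simp [b.tot_f, a.tot_f] }
  id_comp _ := by apply Hom.ext <;> simp
  comp_id _ := by apply Hom.ext <;> simp
  assoc _ _ _ := by apply Hom.ext <;> simp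

/-- The quotient stack as a category over the category of schemes over `ℂ`. -/
def proj (U : GSpace G) : QuotStack U ⥤ SchC where
  obj ξ := ξ.base
  map a := Hom.base a
  map_id _ := rfl
  map_comp _ _ := rfl

/-- The map to `U` on `T`-points of the torsor. -/
def toU (ξ : QuotStack U) {T : SchC} (p : ξ.P.X.obj (op T)) : U.X.obj (op T) :=
  ξ.f.app (op T) p

/-- The map to the base on `T`-points of the torsor. -/
def toBase (ξ : QuotStack U) {T : SchC} (p : ξ.P.X.obj (op T)) : T ⟶ ξ.base :=
  ξ.π.app (op T) p

end QuotStack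

/-- A morphism of stacks over `ℂ` between quotient stacks. -/
structure StackHom (U : GSpace G) (V : GSpace H) where
  functor : QuotStack U ⥤ QuotStack V
  overIso : functor ⋙ QuotStack.proj V ≅ QuotStack.proj U

variable {U : GSpace G} {V : GSpace H}

/-- A morphism of stacks over `ℂ` is an isomorphism of stacks if it is an equivalence of
categories fibred over schemes. -/
def StackHom.IsIsomorphism (j : StackHom U V) : Prop := j.functor.IsEquivalence

/-- `Y` is a `G`-stable closed subspace of `U`: pulled back along any `T`-point of `U`, it is
represented by a closed subscheme of `T`. -/
structure IsStableClosed (U : GSpace G) (Y : ∀ T : SchC, Set (U.X.obj (op T))) : Prop where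
  stable : ∀ (T : SchC) (g : G.obj (op T)) (z : U.X.obj (op T)), z ∈ Y T → U.act g z ∈ Y T
  closed : ∀ (T : SchC) (z : U.X.obj (op T)), ∃ (Z : Scheme.{0}) (i : Z ⟶ T.left),
    IsClosedImmersion i ∧ ∀ (T' : SchC) (u : T' ⟶ T),
      U.X.map u.op z ∈ Y T' ↔ ∃ h : T'.left ⟶ Z, h ≫ i = u.left

/-- `j` is a closed immersion with image the closed substack `[Y/G]` of `[U/G]`, where `Y` is a
stable closed subspace of `U`: `j` is fully faithful and its essential image consists of the
torsors whose map to `U` factors through `Y`. -/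
structure StackHom.IsClosedImmersionOnto (j : StackHom V U)
    (Y : ∀ T : SchC, Set (U.X.obj (op T))) : Prop where
  stableClosed : IsStableClosed U Y
  full : j.functor.Full
  faithful : j.functor.Faithful
  essImage : ∀ ξ : QuotStack U, j.functor.essImage ξ ↔
    ∀ (T : SchC) (p : ξ.P.X.obj (op T)), ξ.toU p ∈ Y T

/-! ## Linear actions through characters -/

/-- The multiplicative group. -/
def Gm : SchCᵒᵖ ⥤ GrpCat.{0} where
  obj T := GrpCat.of (Fn T.unop)ˣ
  map u := GrpCat.ofHom (Units.map (pull u.unop).toMonoidHom)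
  map_id T := by
    apply GrpCat.hom_ext
    apply MonoidHom.ext
    intro x
    apply Units.ext
    exact pull_id T.unop (Units.val x)
  map_comp u v := by
    apply GrpCat.hom_ext
    apply MonoidHom.ext
    intro x
    apply Units.ext
    exact pull_comp v.unop u.unop (Units.val x)

/-- The diagonalizable group `Hom(A, 𝔾ₘ)` with character group `A`. -/
def torus (A : Type) [AddCommGroup A] : SchCᵒᵖ ⥤ GrpCat.{0} where
  obj T := GrpCat.of (Multiplicative A →* (Fn T.unop)ˣ)
  map u := GrpCat.ofHom
    { toFun := fun k => (Units.map (pull u.unop).toMonoidHom).comp k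
      map_one' := by ext; simp
      map_mul' := fun a b => by ext; simp }
  map_id T := by
    apply GrpCat.hom_ext
    apply MonoidHom.ext
    intro (k : Multiplicative A →* (Fn T.unop)ˣ)
    apply MonoidHom.ext
    intro x
    apply Units.ext
    exact pull_id T.unop (k x).1
  map_comp {T _ _} u v := by
    apply GrpCat.hom_ext
    apply MonoidHom.ext
    intro (k : Multiplicative A →* (Fn T.unop)ˣ)
    apply MonoidHom.ext
    intro x
    apply Units.ext
    exact pull_comp v.unop u.unop (k x).1

/-- The character of `Hom(A, 𝔾ₘ)` given by an element of `A`. -/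
def torusChar {A : Type} [AddCommGroup A] (χ : A) : torus A ⟶ Gm where
  app T := GrpCat.ofHom
    (Y := (Fn T.unop)ˣ) (X := (Multiplicative A →* (Fn T.unop)ˣ))
    { toFun := fun k => k (Multiplicative.ofAdd χ)
      map_one' := rfl
      map_mul' := fun _ _ => rfl }
  naturality _ _ _ := rfl

/-- The character `λ ↦ λ ^ n` of the multiplicative group. -/
def gmChar (n : ℕ) : Gm ⟶ Gm where
  app T := GrpCat.ofHom (X := (Fn T.unop)ˣ) (Y := (Fn T.unop)ˣ) (powMonoidHom n)
  naturality _ _ u := by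
    ext x
    exact (map_pow (Units.map (pull u.unop).toMonoidHom) x n).symm

/-- The value of a character `c` of `G` at a `T`-point, as an invertible function on `T`. -/
def charVal (c : G ⟶ Gm) {T : SchC} (g : G.obj (op T)) : (Fn T)ˣ := (c.app (op T)).hom g

/-- Given characters `c i` of `G` and a family `𝒜` of subsets of `ι`, the open subspace
`⋃_{I ∈ 𝒜} (ℂˣ)^I × ℂ^(ι \ I)` of `ℂ^ι`, on which `G` acts with weights `c`. A `T`-point is a
tuple `z` of functions such that every point of `T` has an `I ∈ 𝒜` for which all `z i`, `i ∈ I`,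
do not vanish there. -/
def linSpace {ι : Type} (c : ι → (G ⟶ Gm)) (𝒜 : Set (Finset ι)) : GSpace G where
  X :=
    { obj := fun T => {z : ι → Fn T.unop //
        ∀ t : T.unop.left, ∃ I ∈ 𝒜, ∀ i ∈ I, t ∈ T.unop.left.basicOpen (z i)}
      map := fun u => TypeCat.ofHom fun z => ⟨fun i => pull u.unop (z.1 i), fun t => by
        obtain ⟨I, hI, h⟩ := z.2 (u.unop.left t)
        exact ⟨I, hI, fun i hi => (mem_basicOpen_pull u.unop (z.1 i) t).2 (h i hi)⟩⟩
      map_id := fun T => by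
        apply ConcreteCategory.hom_ext
        intro z
        apply Subtype.ext
        funext i
        exact pull_id T.unop (z.1 i)
      map_comp := fun u v => by
        apply ConcreteCategory.hom_ext
        intro z
        apply Subtype.ext
        funext i
        exact pull_comp v.unop u.unop (z.1 i) }
  act g z := ⟨fun i => charVal (c i) g * z.1 i, fun t => by
    obtain ⟨I, hI, h⟩ := z.2 t
    refine ⟨I, hI, fun i hi => ?_⟩
    rw [Scheme.basicOpen_mul, Scheme.basicOpen_of_isUnit _ (charVal (c i) g).isUnit]
    exact ⟨trivial, h i hi⟩⟩
  one_act z := by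
    apply Subtype.ext
    funext i
    change (((c i).app _).hom 1 : (Fn _)ˣ).1 * z.1 i = z.1 i
    rw [map_one]
    exact one_mul (z.1 i)
  mul_act g h z := by
    apply Subtype.ext
    funext i
    change (((c i).app _).hom (g * h) : (Fn _)ˣ).1 * z.1 i = _
    rw [map_mul]
    exact mul_assoc (charVal (c i) g).1 (charVal (c i) h).1 (z.1 i)
  map_act {T' T} u g z := by
    apply Subtype.ext
    funext i
    have h : (c i).app (op T') (G.map u.op g) = Gm.map u.op ((c i).app (op T) g) :=
      congr($((c i).naturality u.op) g)
    change pull u (charVal (c i) g * z.1 i) = charVal (c i) (G.map u.op g) * pull u (z.1 i)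
    rw [map_mul]
    congr 1
    exact (congrArg Units.val h).symm

/-- The weighted projective stack `ℙ(a) = [(ℂ^κ \ {0}) / ℂˣ]`, the multiplicative group acting on
the coordinate `i` with weight `a i`. This is the space `ℂ^κ \ {0}` with its action;
`QuotStack (weighted a)` is the stack. -/
def weighted {κ : Type} (a : κ → ℕ) : GSpace Gm :=
  linSpace (fun i => gmChar (a i)) {I | I.Nonempty}

/-! ## Toric GIT data -/

/-- Toric GIT data for the group with character group `A`: characters `D i`, `i : ι`, and a
stability condition `ω`. -/
structure GITData (A : Type) [AddCommGroup A] (ι : Type) where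
  D : ι → A
  ω : ℝ ⊗[ℤ] A

/-- The open cone `∠_I` of positive combinations of the characters `D i`, `i ∈ I`. -/
def openCone {A : Type} [AddCommGroup A] {ι : Type} (D : ι → A) (I : Finset ι) :
    Set (ℝ ⊗[ℤ] A) :=
  {θ | ∃ a : ι → ℝ, (∀ i ∈ I, 0 < a i) ∧ θ = ∑ i ∈ I, a i • ((1 : ℝ) ⊗ₜ[ℤ] D i)}

namespace GITData

variable {A : Type} [AddCommGroup A] {ι : Type} (d : GITData A ι)

/-- The collection `𝒜_ω` of anticones. -/
def anticones : Set (Finset ι) := {I | d.ω ∈ openCone d.D I}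

/-- The standing assumptions on GIT data: (A1) the set of all indices is an anticone, and (A2) the
characters in an anticone span the real vector space of characters. -/
structure IsStable [Fintype ι] : Prop where
  univ_mem : Finset.univ ∈ d.anticones
  span_eq : ∀ I ∈ d.anticones,
    Submodule.span ℝ ((fun i => (1 : ℝ) ⊗ₜ[ℤ] d.D i) '' (I : Set ι)) = ⊤

/-- The space `U_ω` with its action of the torus; the toric stack `X_ω = [U_ω / K]` is
`QuotStack d.space`. -/
def space : GSpace (torus A) := linSpace (fun i => torusChar (d.D i)) d.anticones

end GITData

/-! ## Wall crossing -/

section Wall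

variable {L : Type} [AddCommGroup L] {ι : Type}

/-- The canonical topology on the real vector space of stability conditions. -/
instance : TopologicalSpace (ℝ ⊗[ℤ] Module.Dual ℤ L) := moduleTopology ℝ _

/-- The pairing `θ ↦ θ · e` of stability conditions with a cocharacter `e`. -/
def pairing (e : L) : ℝ ⊗[ℤ] Module.Dual ℤ L →ₗ[ℝ] ℝ :=
  Module.Dual.baseChange ℝ (Module.Dual.eval ℤ L e)

/-- The union of the closures of the cones `∠_I` with `|I| = r - 1`, `r` the rank of `L`. -/
def walls (D : ι → Module.Dual ℤ L) : Set (ℝ ⊗[ℤ] Module.Dual ℤ L) :=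
  ⋃ I ∈ {I : Finset ι | I.card + 1 = Module.finrank ℤ L}, closure (openCone D I)

/-- The chamber that contains the stability condition `ω`. -/
def chamber (D : ι → Module.Dual ℤ L) (ω : ℝ ⊗[ℤ] Module.Dual ℤ L) :
    Set (ℝ ⊗[ℤ] Module.Dual ℤ L) :=
  connectedComponentIn (walls D)ᶜ ω

/-- The hyperplane `W = e^⊥`. -/
def wall (e : L) : Submodule ℝ (ℝ ⊗[ℤ] Module.Dual ℤ L) := LinearMap.ker (pairing e)

/-- A crepant toric wall crossing: `ωp` and `ωm` are stability conditions in chambers `C₊`, `C₋`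
separated by the wall `W = e^⊥`, which meets the closures of both chambers in the same facet;
`e` is primitive, positive on `C₊` and negative on `C₋`; and the sum of all `D i` lies on `W`. -/
structure IsWallCrossing [Fintype ι] (D : ι → Module.Dual ℤ L) (e : L)
    (ωp ωm : ℝ ⊗[ℤ] Module.Dual ℤ L) : Prop where
  stable_p : (GITData.mk D ωp).IsStable
  stable_m : (GITData.mk D ωm).IsStable
  primitive : ∀ (n : ℤ) (x : L), e = n • x → IsUnit n
  pos : ∀ θ ∈ chamber D ωp, 0 < pairing e θ
  neg : ∀ θ ∈ chamber D ωm, pairing e θ < 0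
  common_face : (wall e : Set _) ∩ closure (chamber D ωp) =
    (wall e : Set _) ∩ closure (chamber D ωm)
  facet : Submodule.span ℝ ((wall e : Set _) ∩ closure (chamber D ωp)) = wall e
  crepant : ∑ i, (1 : ℝ) ⊗ₜ[ℤ] D i ∈ wall e

/-- The quotient `L_ex^∨ = L^∨ / ⟨D i : i ∈ M₀⟩`, where `M₀ = {i : D i · e = 0}`. -/
abbrev DualEx (D : ι → Module.Dual ℤ L) (e : L) : Type :=
  Module.Dual ℤ L ⧸ Submodule.span ℤ (D '' {i | D i e = 0})

/-- The projection `p : L^∨ → L_ex^∨`. -/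
def projEx (D : ι → Module.Dual ℤ L) (e : L) : Module.Dual ℤ L →ₗ[ℤ] DualEx D e :=
  Submodule.mkQ _

/-- The index set `M₊ = {i : D i · e > 0}`. -/
abbrev MPlus (D : ι → Module.Dual ℤ L) (e : L) : Type := {i : ι // 0 < D i e}

/-- The projected data with all characters `p (D i)`, `i : ι`, and the stability condition
`p (ωp)`. -/
def dataExAll (D : ι → Module.Dual ℤ L) (e : L) (ωp : ℝ ⊗[ℤ] Module.Dual ℤ L) :
    GITData (DualEx D e) ι where
  D i := projEx D e (D i)
  ω := (projEx D e).baseChange ℝ ωp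

/-- The projected data with the characters `p (D i)`, `i ∈ M₊`, and the stability condition
`p (ωp)`. -/
def dataEx (D : ι → Module.Dual ℤ L) (e : L) (ωp : ℝ ⊗[ℤ] Module.Dual ℤ L) :
    GITData (DualEx D e) (MPlus D e) where
  D i := projEx D e (D i)
  ω := (projEx D e).baseChange ℝ ωp

/-- The weights `a i = D i · e > 0`, `i ∈ M₊`. -/
def weights (D : ι → Module.Dual ℤ L) (e : L) (i : MPlus D e) : ℕ := (D i e).toNat

/-- The one-parameter subgroup `ℂˣ → K` given by the cocharacter `e`. -/
def oneParam (e : L) {T : SchC} (g : Gm.obj (op T)) : (torus (Module.Dual ℤ L)).obj (op T) :=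
  let g' : (Fn T)ˣ := g
  ({ toFun := fun χ => g' ^ (χ.toAdd e)
     map_one' := by simp
     map_mul' := fun a b => by simp [zpow_add] } : Multiplicative (Module.Dual ℤ L) →* (Fn T)ˣ)

/-- The tuple with coordinates `w i` for `i ∈ M₊` and `z₀ i` for all other `i`. -/
def extend (D : ι → Module.Dual ℤ L) (e : L) (z₀ : ι → ℂ) {T : SchC} (w : MPlus D e → Fn T) :
    ι → Fn T :=
  fun i => if h : 0 < D i e then w ⟨i, h⟩ else const T (z₀ i)

/-- The morphism `j : ℙ(a) → [U_ω/K]` is induced by the homomorphism `e : ℂˣ → K` and the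
equivariant map `w ↦ (w, z₀)`: there are maps `u` from the torsor of `ξ` to the torsor of `j(ξ)`,
natural in `ξ`, compatible with the maps to the base, equivariant along `e`, and lying over
`w ↦ (w, z₀)`. -/
def IsInducedBy {D : ι → Module.Dual ℤ L} {e : L} {ω : ℝ ⊗[ℤ] Module.Dual ℤ L}
    (j : StackHom (weighted (weights D e)) (GITData.mk D ω).space) (z₀ : ι → ℂ) : Prop :=
  ∃ u : ∀ ξ : QuotStack (weighted (weights D e)), ξ.P.X ⟶ (j.functor.obj ξ).P.X,
    (∀ (ξ η : QuotStack (weighted (weights D e))) (m : ξ ⟶ η),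
      u ξ ≫ (j.functor.map m).tot = m.tot ≫ u η) ∧
    ∀ (ξ : QuotStack (weighted (weights D e))) (T : SchC) (p : ξ.P.X.obj (op T)),
      (j.functor.obj ξ).toBase ((u ξ).app (op T) p) ≫ j.overIso.hom.app ξ = ξ.toBase p ∧
      (∀ g : Gm.obj (op T), (u ξ).app (op T) (ξ.P.act g p) =
        (j.functor.obj ξ).P.act (oneParam e g) ((u ξ).app (op T) p)) ∧
      ((j.functor.obj ξ).toU ((u ξ).app (op T) p)).1 = extend D e z₀ (ξ.toU p).1

end Wall

/-! ## The GIT quotient `ℂ^ι //_χ K` -/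

section ToProj

variable {σ : Type*} {A : Type} [CommRing A] [SetLike σ A] [AddSubgroupClass σ A]

theorem glue_compat (𝒜 : ℕ → σ) [GradedRing 𝒜] {X : Scheme.{0}} (f : A →+* Γ(X, ⊤))
    (x y : Σ' (n : ℕ) (r : A), 0 < n ∧ r ∈ 𝒜 n) :
    Limits.pullback.fst (X.basicOpen (f x.2.1)).ι (X.basicOpen (f y.2.1)).ι ≫
      Proj.toBasicOpenOfGlobalSections 𝒜 f rfl x.2.2.1 x.2.2.2 ≫ Scheme.Opens.ι _ =
    Limits.pullback.snd (X.basicOpen (f x.2.1)).ι (X.basicOpen (f y.2.1)).ι ≫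
      Proj.toBasicOpenOfGlobalSections 𝒜 f rfl y.2.2.1 y.2.2.2 ≫ Scheme.Opens.ι _ := by
  let e : Limits.pullback (X.basicOpen (f x.2.1)).ι (X.basicOpen (f y.2.1)).ι ≅
        (X.basicOpen (f (x.2.1 * y.2.1))).toScheme :=
    (isPullback_opens_inf _ _).isoPullback.symm ≪≫ X.isoOfEq (by simp)
  rw [← cancel_epi e.inv]
  have h1 : e.inv ≫ Limits.pullback.fst _ _ = X.homOfLE (by simp) := by
    simp [e, Scheme.isoOfEq_inv]
  have h2 : e.inv ≫ Limits.pullback.snd _ _ = X.homOfLE (by simp) := by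
    simp [e, Scheme.isoOfEq_inv]
  rw [reassoc_of% h1, reassoc_of% h2]
  rw [Proj.homOfLE_toBasicOpenOfGlobalSections_ι 𝒜 f (t' := x.2.1 * y.2.1) (H' := rfl)
      (h0d' := Nat.add_pos_left x.2.2.1 y.1)
      (hd' := SetLike.mul_mem_graded x.2.2.2 y.2.2.2) rfl rfl y.2.2.2,
    Proj.homOfLE_toBasicOpenOfGlobalSections_ι 𝒜 f (t' := x.2.1 * y.2.1) (H' := rfl)
      (h0d' := Nat.add_pos_left x.2.2.1 y.1)
      (hd' := SetLike.mul_mem_graded x.2.2.2 y.2.2.2) (mul_comm _ _) (add_comm _ _) x.2.2.2]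

/-- The morphism to `Proj 𝒜` given by a ring homomorphism `f : A → Γ(X, ⊤)` for which the open sets
`D(f(s))`, `s` homogeneous of positive degree, cover `X`: it is glued from the morphisms
`D(f(s)) ⟶ D₊(s) = Spec (A_s)₀` that `f` induces. -/
def mapProj (𝒜 : ℕ → σ) [GradedRing 𝒜] {X : Scheme.{0}} (f : A →+* Γ(X, ⊤))
    (hf : TopologicalSpace.IsOpenCover (fun s : Σ' (n : ℕ) (r : A), 0 < n ∧ r ∈ 𝒜 n =>
      X.basicOpen (f s.2.1))) : X ⟶ Proj 𝒜 :=
  (X.openCoverOfIsOpenCover _ hf).glueMorphisms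
    (fun s => Proj.toBasicOpenOfGlobalSections 𝒜 f rfl s.2.2.1 s.2.2.2 ≫ Scheme.Opens.ι _)
    (glue_compat 𝒜 f)

end ToProj

section Quotient

variable {L : Type} [AddCommGroup L] {ι : Type} [Fintype ι]

/-- Exponents of semi-invariant monomials: pairs `(n, v)` such that the monomial `z ^ v` has
weight `n χ`. -/
def semiInv (D : ι → Module.Dual ℤ L) (χ : Module.Dual ℤ L) : AddSubmonoid (ℕ × (ι → ℕ)) where
  carrier := {x | ∑ i, x.2 i • D i = x.1 • χ}
  zero_mem' := by simp
  add_mem' {x y} hx hy := by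
    simp only [Set.mem_ofPred_eq, Prod.snd_add, Pi.add_apply, add_smul, Finset.sum_add_distrib,
      Prod.fst_add] at hx hy ⊢
    rw [hx, hy]

/-- The graded ring `⊕ₙ ℂ[z]_{nχ}` of semi-invariants, as the algebra of the monoid of
semi-invariant monomials. -/
abbrev SemiInvRing (D : ι → Module.Dual ℤ L) (χ : Module.Dual ℤ L) : Type :=
  AddMonoidAlgebra ℂ (semiInv D χ)

/-- The degree of a semi-invariant monomial. -/
def semiInvDeg (D : ι → Module.Dual ℤ L) (χ : Module.Dual ℤ L) : semiInv D χ →+ ℕ :=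
  (AddMonoidHom.fst ℕ (ι → ℕ)).comp (semiInv D χ).subtype

/-- The grading of the ring of semi-invariants. -/
abbrev semiInvGrading (D : ι → Module.Dual ℤ L) (χ : Module.Dual ℤ L) :
    ℕ → Submodule ℂ (SemiInvRing D χ) :=
  AddMonoidAlgebra.gradeBy ℂ (semiInvDeg D χ)

/-- The GIT quotient `ℂ^ι //_χ K = Proj ⊕ₙ ℂ[z]_{nχ}`. -/
def gitQuotient (D : ι → Module.Dual ℤ L) (χ : Module.Dual ℤ L) : Scheme.{0} :=
  Proj (semiInvGrading D χ)

/-- Evaluation of semi-invariants at a tuple of functions on `T`. -/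
def evalSemiInv (D : ι → Module.Dual ℤ L) (χ : Module.Dual ℤ L) {T : SchC} (z : ι → Fn T) :
    SemiInvRing D χ →+* Fn T :=
  AddMonoidAlgebra.liftNCRingHom (const T)
    { toFun := fun x => ∏ i, z i ^ (x.toAdd.1.2 i)
      map_one' := by simp
      map_mul' := fun x y => by simp [pow_add, Finset.prod_mul_distrib] }
    (fun _ _ => Commute.all _ _)

/-- A tuple of functions on `T` is semistable for `χ` if at every point of `T` some semi-invariant
of weight `n χ`, `n > 0`, does not vanish. -/
def IsSemistable (D : ι → Module.Dual ℤ L) (χ : Module.Dual ℤ L) {T : SchC} (z : ι → Fn T) :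
    Prop :=
  TopologicalSpace.IsOpenCover (fun s : Σ' (n : ℕ) (r : SemiInvRing D χ),
    0 < n ∧ r ∈ semiInvGrading D χ n => T.left.basicOpen (evalSemiInv D χ z s.2.1))

/-- The quotient map from the semistable locus to `ℂ^ι //_χ K`, on `T`-points. -/
def gitMap (D : ι → Module.Dual ℤ L) (χ : Module.Dual ℤ L) {T : SchC} (z : ι → Fn T)
    (hz : IsSemistable D χ z) : T.left ⟶ gitQuotient D χ :=
  mapProj (semiInvGrading D χ) (evalSemiInv D χ z) hz

/-- The value of the blow-down map `[U_ω/K] → ℂ^ι //_χ K` at an object `ξ` over a scheme `S` is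
the morphism `s` from `S` that is induced by the invariant map from the torsor of `ξ` to `U_ω`,
followed by the quotient map. -/
def IsBlowDownValue {D : ι → Module.Dual ℤ L} {ω : ℝ ⊗[ℤ] Module.Dual ℤ L}
    (χ : Module.Dual ℤ L) (ξ : QuotStack (GITData.mk D ω).space)
    (s : ξ.base.left ⟶ gitQuotient D χ) : Prop :=
  ∀ (T : SchC) (p : ξ.P.X.obj (op T)), ∃ h : IsSemistable D χ (ξ.toU p).1,
    (ξ.toBase p).left ≫ s = gitMap D χ (ξ.toU p).1 h

end Quotient

end ToricWall

end

/-!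
Primitivity of `e` gives a character `χ₁` with `χ₁ · e = 1`, and such a character splits the torus
`K` as a product of the one-parameter subgroup `e : ℂˣ → K` and the group `H` whose character group
is the kernel `W ∩ L^∨` of evaluation at `e` (`torusSplitting`). All statements about stacks follow
from one construction for a split group `K = G × H`. Let `V → U` be a map that is equivariant along
the inclusion of `G`, such that `(v, h) ↦ h • v` is a monomorphism `V × H → U`; this is called a
slice. Sending a `G`-torsor `P` to `P × H` defines a fully faithful functor `[V/G] → [U/K]`, whose
essential image consists of the torsors that map to the image of `V × H`
(`Splitting.Slice.essImage_iff`). The essential image is reached because the part of a `K`-torsor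
that lies over `V` is a `G`-torsor.

For a linear action and the map `w ↦ (w, z₀)` from `ℂ^κ \ {0}`, the slice condition says that the
characters of the non-zero coordinates of `z₀` generate the characters of `H`. The image of `V × H`
is then the closed subspace cut out by the vanishing of the remaining coordinates and by the binomial
equations of `z₀` (`LinSlice.exists_sweep_eq_iff`): since the non-zero coordinates of `z₀` do not
vanish on the part of this subspace in `U_ω`, the binomial equations say exactly that their ratios
with those of `z₀` extend to a homomorphism on the group of characters of `H`. With `z₀ = 0` this
gives both statements on the projected data, whose character group has rank one; in the first of
them the slice is the whole space. With `z₀` on the wall it gives the closed immersion into `X₊`.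

The required facts on anticones are statements about cones. A chamber that meets a full-dimensional
open cone `∠_K` is contained in it, because the boundary of the cone lies on walls
(`chamber_subset_posCone`). Hence `ω₀`, a point in the closure of the chamber of `ω₊`, is a
non-negative combination of the characters in each anticone of `ω₊`. As cones spanned by integral
vectors have enough rational points (`exists_nat_combination`), a multiple of `ω₀` is a combination
with natural coefficients, so `U₊` is semistable for `ω₀`. Near a point of the relative interior of
the facet, the wall is covered by the walls that lie in it, so that all nearby points of the wall are
in the cone of `M₀`, and `ω₀` is in the open cone (`mem_posCone_of_mem_intrinsicInterior`).

A morphism to `Proj` that is given by a ring homomorphism depends only on the ratios of functions of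
the same degree, and determines them (`comp_mapProj_eq`, `mul_pow_eq_of_mapProj_eq`). The first fact
makes the quotient map invariant under the torus, so that it descends along torsors by étale descent
(`existsUnique_isBlowDownValue`), and shows that it is constant on the slice (`gitMap_sweep`). By the
second fact, a point of `U₊` over `ℂ` with the same image as `z₀` satisfies the binomial equations of
`z₀`, and its coordinates outside the slice and the support of `z₀` vanish, since each of them occurs
in a monomial whose weight lies on the wall (`isOnOrbit_of_gitMap_eq`).
-/

noncomputable section

namespace ToricWall

/-! ### Finitely generated cones -/

section Cones

variable {V : Type*} [AddCommGroup V] [Module ℝ V] {ι : Type*}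

/-- The cone of non-negative combinations of the vectors `d i`, `i ∈ K`. -/
def nonnegCone (d : ι → V) (K : Finset ι) : Set V :=
  {θ | ∃ a : ι → ℝ, (∀ i ∈ K, 0 ≤ a i) ∧ θ = ∑ i ∈ K, a i • d i}

/-- The cone of positive combinations of the vectors `d i`, `i ∈ K`. -/
def posCone (d : ι → V) (K : Finset ι) : Set V :=
  {θ | ∃ a : ι → ℝ, (∀ i ∈ K, 0 < a i) ∧ θ = ∑ i ∈ K, a i • d i}

theorem posCone_subset_nonnegCone (d : ι → V) (K : Finset ι) :
    posCone d K ⊆ nonnegCone d K := by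
  rintro θ ⟨a, ha, rfl⟩
  exact ⟨a, fun i hi => (ha i hi).le, rfl⟩

theorem nonnegCone_mono (d : ι → V) {J K : Finset ι} (h : J ⊆ K) :
    nonnegCone d J ⊆ nonnegCone d K := by
  classical
  rintro θ ⟨a, ha, rfl⟩
  refine ⟨fun i => if i ∈ J then a i else 0, fun i _ => ?_, ?_⟩
  · dsimp only
    split_ifs with hi
    exacts [ha i hi, le_rfl]
  · simp only [ite_smul, zero_smul]
    rw [Finset.sum_ite_mem, Finset.inter_eq_right.2 h]

/-- Carathéodory's theorem for cones: a point of a finitely generated cone is a positive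
combination of linearly independent generators. -/
theorem exists_linearIndepOn_of_mem_nonnegCone (d : ι → V) (K : Finset ι) {θ : V}
    (hθ : θ ∈ nonnegCone d K) :
    ∃ J ⊆ K, LinearIndepOn ℝ d (J : Set ι) ∧ θ ∈ posCone d J := by
  classical
  induction K using Finset.strongInduction with
  | H K ih =>
    obtain ⟨a, ha, rfl⟩ := hθ
    by_cases hpos : ∀ i ∈ K, 0 < a i
    swap
    · push Not at hpos
      obtain ⟨i, hi, hai⟩ := hpos
      obtain ⟨J, hJ, h⟩ := ih (K.erase i) (Finset.erase_ssubset hi)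
        ⟨a, fun j hj => ha j (Finset.mem_of_mem_erase hj), by
          rw [← Finset.add_sum_erase K _ hi, le_antisymm hai (ha i hi)]; simp⟩
      exact ⟨J, hJ.trans (Finset.erase_subset _ _), h⟩
    by_cases hli : LinearIndepOn ℝ d (K : Set ι)
    · exact ⟨K, subset_rfl, hli, a, hpos, rfl⟩
    -- move along a linear relation until the first coefficient vanishes
    rw [linearIndepOn_finset_iff] at hli
    push Not at hli
    obtain ⟨g, hg, i₁, hi₁, hgi₁⟩ := hli
    obtain ⟨g, hg, i₁, hi₁, hgi₁⟩ : ∃ g : ι → ℝ, ∑ i ∈ K, g i • d i = 0 ∧ ∃ i ∈ K, 0 < g i := by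
      rcases lt_or_gt_of_ne hgi₁ with h | h
      · exact ⟨-g, by simp [hg], i₁, hi₁, by simpa using h⟩
      · exact ⟨g, hg, i₁, hi₁, h⟩
    obtain ⟨i₀, hi₀, hmin⟩ := Finset.exists_min_image (K.filter fun i => 0 < g i)
      (fun i => a i / g i) ⟨i₁, by simp [hi₁, hgi₁]⟩
    simp only [Finset.mem_filter] at hi₀ hmin
    set t := a i₀ / g i₀
    have ht : 0 < t := div_pos (hpos _ hi₀.1) hi₀.2
    obtain ⟨J, hJ, h⟩ := ih (K.erase i₀) (Finset.erase_ssubset hi₀.1)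
      ⟨fun i => a i - t * g i, fun i hi => by
        have hiK := Finset.mem_of_mem_erase hi
        rcases lt_or_ge 0 (g i) with h | h
        · have := hmin i ⟨hiK, h⟩
          rw [le_div_iff₀ h] at this
          simpa using this
        · nlinarith [hpos i hiK], by
        have h0 : a i₀ - t * g i₀ = 0 := by
          simp only [t]; field_simp [hi₀.2.ne']; ring
        have : ∑ i ∈ K, (a i - t * g i) • d i = ∑ i ∈ K, a i • d i := by
          simp only [sub_smul, Finset.sum_sub_distrib, mul_smul, ← Finset.smul_sum, hg, smul_zero,
            sub_zero]
        rw [← this, ← Finset.add_sum_erase K _ hi₀.1, h0, zero_smul, zero_add]⟩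
    exact ⟨J, hJ.trans (Finset.erase_subset _ _), h⟩

/-- If a point of the cone on `K` is a positive combination of generators that span the space,
then it is a positive combination of all generators. -/
theorem mem_posCone_of_subset (d : ι → V) {J K : Finset ι} (hJK : J ⊆ K)
    (hJ : ∀ i ∈ K, d i ∈ Submodule.span ℝ (d '' (J : Set ι))) {θ : V} (hθ : θ ∈ posCone d J) :
    θ ∈ posCone d K := by
  classical
  obtain ⟨b, hb, rfl⟩ := hθ
  have hs : -∑ i ∈ K \ J, d i ∈ Submodule.span ℝ (d '' (J : Set ι)) :=
    neg_mem (Submodule.sum_mem _ fun i hi => hJ i (Finset.mem_sdiff.1 hi).1)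
  obtain ⟨c, hc⟩ := (Submodule.mem_span_image_finset_iff_exists_fun' _).1 hs
  obtain ⟨ε, hε, hεb⟩ : ∃ ε : ℝ, 0 < ε ∧ ∀ i ∈ J, 0 < b i + ε * c i := by
    have : ∀ᶠ ε in nhdsWithin (0 : ℝ) (Set.Ioi 0), ∀ i ∈ J, 0 < b i + ε * c i := by
      rw [Filter.eventually_all_finset]
      intro i hi
      have h : Filter.Tendsto (fun ε : ℝ => b i + ε * c i) (nhds 0) (nhds (b i)) := by
        have : Continuous fun ε : ℝ => b i + ε * c i := by fun_prop
        simpa using this.tendsto 0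
      exact nhdsWithin_le_nhds (h.eventually (lt_mem_nhds (hb i hi)))
    obtain ⟨ε, h1, h2⟩ := (this.and self_mem_nhdsWithin).exists
    exact ⟨ε, h2, h1⟩
  refine ⟨fun i => if i ∈ J then b i + ε * c i else ε, fun i hi => ?_, ?_⟩
  · dsimp only
    split_ifs with h
    exacts [hεb i h, hε]
  · rw [← Finset.sum_sdiff hJK]
    have h1 : ∑ i ∈ K \ J, (if i ∈ J then b i + ε * c i else ε) • d i = ε • ∑ i ∈ K \ J, d i := by
      rw [Finset.smul_sum]
      exact Finset.sum_congr rfl fun i hi => by rw [if_neg (Finset.mem_sdiff.1 hi).2]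
    have h2 : ∑ i ∈ J, (if i ∈ J then b i + ε * c i else ε) • d i =
        ∑ i ∈ J, b i • d i + ε • ∑ i ∈ J, c i • d i := by
      rw [Finset.smul_sum, ← Finset.sum_add_distrib]
      exact Finset.sum_congr rfl fun i hi => by rw [if_pos hi, add_smul, mul_smul]
    rw [h1, h2, hc, smul_neg]
    abel

variable [TopologicalSpace V] [IsTopologicalAddGroup V] [ContinuousSMul ℝ V] [T2Space V]

theorem isClosed_nonnegCone (d : ι → V) (K : Finset ι) : IsClosed (nonnegCone d K) := by
  classical
  have key : nonnegCone d K = ⋃ J ∈ K.powerset.filter (fun J : Finset ι => LinearIndepOn ℝ d (J : Set ι)),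
      nonnegCone d J := by
    ext θ
    simp only [Set.mem_iUnion, Finset.mem_filter, Finset.mem_powerset, exists_prop]
    constructor
    · intro h
      obtain ⟨J, hJ, hli, h⟩ := exists_linearIndepOn_of_mem_nonnegCone d K h
      exact ⟨J, ⟨hJ, hli⟩, posCone_subset_nonnegCone d J h⟩
    · rintro ⟨J, ⟨hJ, -⟩, h⟩
      exact nonnegCone_mono d hJ h
  rw [key]
  refine isClosed_biUnion_finset fun J hJ => ?_
  have hli := (Finset.mem_filter.1 hJ).2
  let f : (J → ℝ) →ₗ[ℝ] V := Fintype.linearCombination ℝ (fun i : J => d i)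
  have hf : Function.Injective f :=
    (linearIndependent_iff_injective_fintypeLinearCombination (R := ℝ) (v := fun i : J => d i)).1 hli
  have h := (LinearMap.isClosedEmbedding_of_injective (f := f)
    (LinearMap.ker_eq_bot.2 hf)).isClosedMap (Set.Ici 0) isClosed_Ici
  convert h using 1
  ext θ
  constructor
  · rintro ⟨a, ha, rfl⟩
    refine ⟨fun i => a i, fun i => ha i i.2, ?_⟩
    simp only [f, Fintype.linearCombination_apply]
    exact Finset.sum_coe_sort J (fun i => a i • d i)
  · rintro ⟨a, ha, rfl⟩
    refine ⟨fun i => if h : i ∈ J then a ⟨i, h⟩ else 0, fun i hi => ?_, ?_⟩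
    · simpa [hi] using ha ⟨i, hi⟩
    · simp only [f, Fintype.linearCombination_apply]
      rw [← Finset.sum_coe_sort J]
      simp

theorem closure_posCone (d : ι → V) (K : Finset ι) : closure (posCone d K) = nonnegCone d K := by
  refine (closure_minimal (posCone_subset_nonnegCone d K) (isClosed_nonnegCone d K)).antisymm ?_
  rintro θ ⟨a, ha, rfl⟩
  have hc : Continuous fun t : ℝ => ∑ i ∈ K, (a i + t) • d i := by fun_prop
  have : ∑ i ∈ K, a i • d i = (fun t : ℝ => ∑ i ∈ K, (a i + t) • d i) 0 := by simp
  rw [this]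
  refine mem_closure_of_tendsto (b := nhdsWithin 0 (Set.Ioi 0))
    (hc.continuousAt.tendsto.mono_left nhdsWithin_le_nhds) ?_
  filter_upwards [self_mem_nhdsWithin] with t ht
  exact ⟨fun i => a i + t, fun i hi => add_pos_of_nonneg_of_pos (ha i hi) ht, rfl⟩

theorem isOpen_posCone [FiniteDimensional ℝ V] (d : ι → V) (K : Finset ι)
    (hK : Submodule.span ℝ (d '' (K : Set ι)) = ⊤) : IsOpen (posCone d K) := by
  let f : (K → ℝ) →ₗ[ℝ] V := Fintype.linearCombination ℝ (fun i : K => d i)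
  have hf : Function.Surjective f := by
    rw [← LinearMap.range_eq_top, Fintype.range_linearCombination, ← hK]
    congr 1
    ext; simp
  have h := LinearMap.isOpenMap_of_finiteDimensional f hf
    (Set.univ.pi fun _ => Set.Ioi 0) (isOpen_set_pi Set.finite_univ fun _ _ => isOpen_Ioi)
  convert h using 1
  ext θ
  constructor
  · rintro ⟨a, ha, rfl⟩
    refine ⟨fun i => a i, fun i _ => ha i i.2, ?_⟩
    simp only [f, Fintype.linearCombination_apply]
    exact Finset.sum_coe_sort K (fun i => a i • d i)
  · classical
    rintro ⟨a, ha, rfl⟩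
    refine ⟨fun i => if h : i ∈ K then a ⟨i, h⟩ else 0, fun i hi => ?_, ?_⟩
    · simpa [hi] using ha ⟨i, hi⟩
    · simp only [f, Fintype.linearCombination_apply]
      rw [← Finset.sum_coe_sort K]
      simp

end Cones

/-! ### Chambers and the wall -/

section Chambers

variable {L : Type} [AddCommGroup L]

instance : IsModuleTopology ℝ (ℝ ⊗[ℤ] Module.Dual ℤ L) := ⟨rfl⟩

instance : ContinuousSMul ℝ (ℝ ⊗[ℤ] Module.Dual ℤ L) := IsModuleTopology.toContinuousSMul ℝ _

instance : IsTopologicalAddGroup (ℝ ⊗[ℤ] Module.Dual ℤ L) :=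
  IsModuleTopology.topologicalAddGroup ℝ _

theorem pairing_tmul (e : L) (c : ℝ) (χ : Module.Dual ℤ L) :
    pairing e (c ⊗ₜ χ) = c * (χ e : ℝ) := by
  simp [pairing, mul_comm]

/-- The real vectors given by a family of characters. -/
abbrev realChar {κ : Type} (D : κ → Module.Dual ℤ L) (i : κ) : ℝ ⊗[ℤ] Module.Dual ℤ L :=
  (1 : ℝ) ⊗ₜ[ℤ] D i

theorem openCone_eq {ι : Type} (D : ι → Module.Dual ℤ L) (I : Finset ι) :
    openCone D I = posCone (realChar D) I := rfl

variable {ι : Type} (D : ι → Module.Dual ℤ L)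

theorem mem_chamber_self {ω : ℝ ⊗[ℤ] Module.Dual ℤ L} (h : (closure (chamber D ω)).Nonempty) :
    ω ∈ chamber D ω := by
  rw [closure_nonempty_iff] at h
  exact mem_connectedComponentIn (by rwa [chamber, connectedComponentIn_nonempty_iff] at h)

/-- A point in the closure of a chamber that is not in the chamber lies on a wall. -/
theorem mem_walls_of_mem_closure {ω θ : ℝ ⊗[ℤ] Module.Dual ℤ L}
    (hθ : θ ∈ closure (chamber D ω)) (h : θ ∉ chamber D ω) : θ ∈ walls D := by
  by_contra hw
  have hω := mem_chamber_self D ⟨θ, hθ⟩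
  have hpre : _root_.IsPreconnected (insert θ (chamber D ω)) :=
    isPreconnected_connectedComponentIn.subset_closure (Set.subset_insert _ _)
      (Set.insert_subset hθ subset_closure)
  refine h (hpre.subset_connectedComponentIn (Set.mem_insert_of_mem _ hω) ?_
    (Set.mem_insert _ _))
  exact Set.insert_subset hw (connectedComponentIn_subset _ _)

variable [Module.Free ℤ L] [Module.Finite ℤ L]

instance : T2Space (ℝ ⊗[ℤ] Module.Dual ℤ L) := by
  let b := Module.finBasis ℝ (ℝ ⊗[ℤ] Module.Dual ℤ L)
  have hc : Continuous b.equivFun := IsModuleTopology.continuous_of_linearMap b.equivFun.toLinearMap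
  exact T2Space.of_injective_continuous b.equivFun.injective hc

theorem finrank_stability : Module.finrank ℝ (ℝ ⊗[ℤ] Module.Dual ℤ L) = Module.finrank ℤ L := by
  rw [Module.finrank_baseChange]
  let b := Module.finBasis ℤ L
  rw [Module.finrank_eq_card_basis b.dualBasis, Fintype.card_fin]

/-- A primitive vector takes the value `1` at some character. -/
theorem exists_apply_eq_one {e : L} (he : ∀ (n : ℤ) (x : L), e = n • x → IsUnit n) :
    ∃ χ : Module.Dual ℤ L, χ e = 1 := by
  let b := Module.finBasis ℤ L
  let φ : Module.Dual ℤ L →ₗ[ℤ] ℤ := Module.Dual.eval ℤ L e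
  obtain ⟨n, hn⟩ := (IsPrincipalIdealRing.principal (LinearMap.range φ : Ideal ℤ)).principal
  have hdvd : ∀ i, n ∣ b.repr e i := fun i => by
    have : b.coord i e ∈ LinearMap.range φ := ⟨b.coord i, rfl⟩
    rw [hn] at this
    exact Ideal.mem_span_singleton.1 this
  choose c hc using hdvd
  have hunit : IsUnit n := he n (∑ i, c i • b i) (by
    conv_lhs => rw [← b.sum_repr e]
    rw [Finset.smul_sum]
    exact Finset.sum_congr rfl fun i _ => by rw [hc, mul_smul])
  have : (1 : ℤ) ∈ LinearMap.range φ := by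
    rw [hn]
    exact Ideal.mem_span_singleton.2 hunit.dvd
  exact this

theorem mem_walls_iff {θ : ℝ ⊗[ℤ] Module.Dual ℤ L} :
    θ ∈ walls D ↔ ∃ I : Finset ι, I.card + 1 = Module.finrank ℤ L ∧
      θ ∈ nonnegCone (realChar D) I := by
  simp only [walls, Set.mem_iUnion, openCone_eq, closure_posCone, Set.mem_ofPred_eq, exists_prop]

/-- The boundary of a full-dimensional cone lies on the walls. -/
theorem closure_posCone_inter_subset {K : Finset ι}
    (hK : Submodule.span ℝ (realChar D '' (K : Set ι)) = ⊤) :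
    closure (posCone (realChar D) K) ∩ (walls D)ᶜ ⊆ posCone (realChar D) K := by
  classical
  rintro θ ⟨hθ, hw⟩
  rw [closure_posCone] at hθ
  obtain ⟨J, hJK, hli, hθJ⟩ := exists_linearIndepOn_of_mem_nonnegCone _ K hθ
  have hcard : J.card ≤ Module.finrank ℤ L := by
    rw [← finrank_stability (L := L)]
    simpa using hli.linearIndependent.fintype_card_le_finrank
  rcases hcard.lt_or_eq with h | h
  · have hK' : Module.finrank ℤ L ≤ K.card := by
      rw [← finrank_stability (L := L), ← finrank_top, ← hK, ← Finset.coe_image]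
      exact (finrank_span_finset_le_card _).trans Finset.card_image_le
    obtain ⟨I, hJI, hIK, hI⟩ := Finset.exists_subsuperset_card_eq hJK
      (show J.card ≤ Module.finrank ℤ L - 1 by omega) (by omega)
    exact absurd ((mem_walls_iff D).2 ⟨I, by omega,
      nonnegCone_mono _ hJI (posCone_subset_nonnegCone _ _ hθJ)⟩) hw
  · have hspan : Submodule.span ℝ (realChar D '' (J : Set ι)) = ⊤ := by
      have := hli.linearIndependent.span_eq_top_of_card_eq_finrank' (by
        rw [finrank_stability]; simpa using h)
      rw [← this]
      congr 1
      ext; simp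
    exact mem_posCone_of_subset _ hJK (fun i _ => by rw [hspan]; trivial) hθJ

/-- A chamber that meets a full-dimensional open cone is contained in it. -/
theorem chamber_subset_posCone {K : Finset ι} (ω : ℝ ⊗[ℤ] Module.Dual ℤ L)
    (hK : Submodule.span ℝ (realChar D '' (K : Set ι)) = ⊤)
    (h : (chamber D ω ∩ posCone (realChar D) K).Nonempty) :
    chamber D ω ⊆ posCone (realChar D) K :=
  isPreconnected_connectedComponentIn.subset_of_closure_inter_subset
    (isOpen_posCone _ _ hK) h fun _ hx => closure_posCone_inter_subset D hK
      ⟨hx.1, connectedComponentIn_subset _ _ hx.2⟩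

theorem smul_mem_chamber {ω θ : ℝ ⊗[ℤ] Module.Dual ℤ L} (hθ : θ ∈ chamber D ω) {t : ℝ}
    (ht : 0 < t) : t • θ ∈ chamber D ω := by
  have hω := mem_chamber_self D ⟨θ, subset_closure hθ⟩
  have hpre : _root_.IsPreconnected ((fun x : ℝ × _ => x.1 • x.2) '' (Set.Ioi 0 ×ˢ chamber D ω)) :=
    (isPreconnected_Ioi.prod isPreconnected_connectedComponentIn).image _
      (continuous_fst.smul continuous_snd).continuousOn
  refine hpre.subset_connectedComponentIn (x := ω) ⟨(1, ω), ⟨Set.mem_Ioi.2 one_pos, hω⟩, one_smul _ _⟩ ?_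
    ⟨(t, θ), ⟨ht, hθ⟩, rfl⟩
  rintro _ ⟨⟨s, η⟩, ⟨hs, hη⟩, rfl⟩ hw
  refine connectedComponentIn_subset _ _ hη ?_
  obtain ⟨I, hI, a, ha, h⟩ := (mem_walls_iff D).1 hw
  have hs : (0 : ℝ) < s := hs
  refine (mem_walls_iff D).2 ⟨I, hI, fun i => s⁻¹ * a i, fun i hi => by
    have := ha i hi; positivity, ?_⟩
  simp only [mul_smul, ← Finset.smul_sum, ← h]
  rw [smul_smul, inv_mul_cancel₀ hs.ne', one_smul]

theorem finrank_wall {e : L} (he : ∃ χ : Module.Dual ℤ L, χ e = 1) :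
    Module.finrank ℝ (wall e) + 1 = Module.finrank ℤ L := by
  obtain ⟨χ, hχ⟩ := he
  have hsurj : LinearMap.range (pairing e) = ⊤ := by
    rw [LinearMap.range_eq_top]
    intro c
    exact ⟨c ⊗ₜ χ, by simp [pairing_tmul, hχ]⟩
  have := LinearMap.finrank_range_add_finrank_ker (pairing e)
  rw [hsurj, finrank_top, Module.finrank_self, finrank_stability] at this
  rw [wall, ← this, add_comm]

/-- If a relatively open part of the wall `e^⊥` is covered by the cones of dimension at most
`r - 1`, then it is contained in the cone on the characters that lie on the wall: a generic
point of the wall is only on those cones that span the wall. -/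
theorem wall_inter_subset_nonnegCone [Fintype ι] [DecidableEq ι] {e : L}
    (he : ∃ χ : Module.Dual ℤ L, χ e = 1) {N : Set (ℝ ⊗[ℤ] Module.Dual ℤ L)} (hN : IsOpen N)
    (hNw : N ∩ wall e ⊆ walls D) :
    N ∩ wall e ⊆ nonnegCone (realChar D) (Finset.univ.filter fun i => D i e = 0) := by
  rintro θ ⟨hθN, hθ⟩
  let S : Finset ι → Submodule ℝ (wall e) := fun I =>
    (Submodule.span ℝ (realChar D '' (I : Set ι))).comap (wall e).subtype
  obtain ⟨v, hv⟩ : ∃ v : wall e, ∀ I, S I ≠ ⊤ → v ∉ S I := by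
    have := Subspace.biUnion_ne_univ_of_top_notMem (k := ℝ) (E := wall e)
      (s := (Finset.univ.image S).filter (· ≠ ⊤)) (by simp)
    rw [Set.ne_univ_iff_exists_notMem] at this
    obtain ⟨v, hv⟩ := this
    refine ⟨v, fun I hI hvI => hv ?_⟩
    simp only [Set.mem_iUnion]
    exact ⟨S I, by simpa using hI, hvI⟩
  have hcont : Continuous fun t : ℝ => θ + t • (v : ℝ ⊗[ℤ] Module.Dual ℤ L) := by fun_prop
  by_contra hθM
  have h1 : ∀ᶠ t in nhds (0 : ℝ), θ + t • (v : ℝ ⊗[ℤ] Module.Dual ℤ L) ∈ N :=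
    hcont.continuousAt.eventually_mem (hN.mem_nhds (by simpa using hθN))
  have h2 : ∀ᶠ t in nhds (0 : ℝ), θ + t • (v : ℝ ⊗[ℤ] Module.Dual ℤ L) ∉
      nonnegCone (realChar D) (Finset.univ.filter fun i => D i e = 0) :=
    hcont.continuousAt.eventually_mem ((isClosed_nonnegCone _ _).isOpen_compl.mem_nhds
      (by simpa using hθM))
  have hfin : {t : ℝ | ∃ I, S I ≠ ⊤ ∧ θ + t • (v : ℝ ⊗[ℤ] Module.Dual ℤ L) ∈
      Submodule.span ℝ (realChar D '' (I : Set ι))}.Finite := by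
    have : {t : ℝ | ∃ I, S I ≠ ⊤ ∧ θ + t • (v : ℝ ⊗[ℤ] Module.Dual ℤ L) ∈
        Submodule.span ℝ (realChar D '' (I : Set ι))} = ⋃ I : {I // S I ≠ ⊤},
        {t : ℝ | θ + t • (v : ℝ ⊗[ℤ] Module.Dual ℤ L) ∈
          Submodule.span ℝ (realChar D '' (I.1 : Set ι))} := by
      ext t; simp
    rw [this]
    refine Set.finite_iUnion fun I => Set.Subsingleton.finite fun s hs t ht => ?_
    by_contra hst
    have h3 : (s - t) • (v : ℝ ⊗[ℤ] Module.Dual ℤ L) ∈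
        Submodule.span ℝ (realChar D '' (I.1 : Set ι)) := by
      have := Submodule.sub_mem _ (Set.mem_ofPred_eq ▸ hs) (Set.mem_ofPred_eq ▸ ht)
      rwa [add_sub_add_left_eq_sub, ← sub_smul] at this
    exact hv I.1 I.2 ((Submodule.smul_mem_iff _ (sub_ne_zero.2 hst)).1 h3)
  have h4 := h1.and h2
  refine (infinite_of_mem_nhds (0 : ℝ) h4) (hfin.subset ?_)
  rintro t ⟨htN, htM⟩
  have htw : θ + t • (v : ℝ ⊗[ℤ] Module.Dual ℤ L) ∈ wall e :=
    add_mem hθ ((wall e).smul_mem _ v.2)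
  obtain ⟨I, hI, hIt⟩ := (mem_walls_iff D).1 (hNw ⟨htN, htw⟩)
  refine ⟨I, fun htop => htM ?_, ?_⟩
  · have hle : wall e ≤ Submodule.span ℝ (realChar D '' (I : Set ι)) := by
      rwa [Submodule.comap_subtype_eq_top] at htop
    have heq : wall e = Submodule.span ℝ (realChar D '' (I : Set ι)) := by
      refine Submodule.eq_of_le_of_finrank_le hle ?_
      have h5 := finrank_wall he
      have h6 : Module.finrank ℝ (Submodule.span ℝ (realChar D '' (I : Set ι))) ≤ I.card := by
        classical
        rw [← Finset.coe_image]
        exact (finrank_span_finset_le_card _).trans Finset.card_image_le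
      omega
    refine nonnegCone_mono _ (fun i hi => ?_) hIt
    have : realChar D i ∈ wall e := by
      rw [heq]; exact Submodule.subset_span ⟨i, hi, rfl⟩
    simpa [wall, pairing_tmul] using this
  · obtain ⟨a, -, ha⟩ := hIt
    rw [ha]
    exact Submodule.sum_mem _ fun i hi => Submodule.smul_mem _ _ (Submodule.subset_span ⟨i, hi, rfl⟩)

/-- A point in the relative interior of the facet of a chamber on the wall `e^⊥` is a positive
combination of all characters that lie on the wall. -/
theorem mem_posCone_of_mem_intrinsicInterior [Fintype ι] [DecidableEq ι] {e : L}
    (he : ∃ χ : Module.Dual ℤ L, χ e = 1) {ω ω₀ : ℝ ⊗[ℤ] Module.Dual ℤ L}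
    (hpos : ∀ θ ∈ chamber D ω, 0 < pairing e θ)
    (hfacet : Submodule.span ℝ ((wall e : Set _) ∩ closure (chamber D ω)) = wall e)
    (hω₀ : ω₀ ∈ intrinsicInterior ℝ ((wall e : Set _) ∩ closure (chamber D ω))) :
    ω₀ ∈ posCone (realChar D) (Finset.univ.filter fun i => D i e = 0) := by
  set F := (wall e : Set (ℝ ⊗[ℤ] Module.Dual ℤ L)) ∩ closure (chamber D ω)
  have hmem : ω₀ ∈ F := intrinsicInterior_subset hω₀
  have hdouble : (2 : ℝ) • ω₀ ∈ F :=
    ⟨(wall e).smul_mem _ hmem.1, map_mem_closure (continuous_const_smul (2 : ℝ)) hmem.2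
      fun θ hθ => smul_mem_chamber D hθ two_pos⟩
  have hzero : (0 : ℝ ⊗[ℤ] Module.Dual ℤ L) ∈ affineSpan ℝ F := by
    have := AffineMap.lineMap_mem (-1 : ℝ) (mem_affineSpan ℝ hmem) (mem_affineSpan ℝ hdouble)
    rw [AffineMap.lineMap_apply] at this
    convert this using 1
    simp only [vsub_eq_sub, vadd_eq_add, two_smul]
    simp
  have hspan : (affineSpan ℝ F : Set (ℝ ⊗[ℤ] Module.Dual ℤ L)) = wall e := by
    rw [← hfacet, ← affineSpan_insert_zero, affineSpan_insert_eq_affineSpan ℝ hzero]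
  obtain ⟨y, hy, rfl⟩ := mem_intrinsicInterior.1 hω₀
  obtain ⟨U, hU, hUo, hyU⟩ := mem_interior.1 hy
  obtain ⟨N, hN, rfl⟩ := isOpen_induced_iff.1 hUo
  have hNF : N ∩ wall e ⊆ F := by
    rintro θ ⟨hθN, hθw⟩
    rw [← hspan] at hθw
    exact hU (a := ⟨θ, hθw⟩) hθN
  have hNw : N ∩ wall e ⊆ walls D := fun θ hθ =>
    mem_walls_of_mem_closure D (hNF hθ).2 fun h => (hpos θ h).ne' (hθ.2 : pairing e θ = 0)
  have hsub := wall_inter_subset_nonnegCone D he hN hNw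
  -- subtracting a small multiple of the sum of all characters on the wall stays in the cone
  set M := Finset.univ.filter fun i => D i e = 0
  have hs : ∑ i ∈ M, realChar D i ∈ wall e := Submodule.sum_mem _ fun i hi => by
    simp [wall, pairing_tmul, (Finset.mem_filter.1 hi).2]
  have hcont : Continuous fun t : ℝ => (y : ℝ ⊗[ℤ] Module.Dual ℤ L) - t • ∑ i ∈ M, realChar D i := by
    fun_prop
  have hev : ∀ᶠ t in nhdsWithin (0 : ℝ) (Set.Ioi 0),
      (y : ℝ ⊗[ℤ] Module.Dual ℤ L) - t • ∑ i ∈ M, realChar D i ∈ N :=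
    nhdsWithin_le_nhds (hcont.continuousAt.eventually_mem (hN.mem_nhds (by simpa using hyU)))
  obtain ⟨t, htN, ht⟩ := (hev.and self_mem_nhdsWithin).exists
  obtain ⟨a, ha, hat⟩ := hsub ⟨htN, sub_mem hmem.1 ((wall e).smul_mem _ hs)⟩
  refine ⟨fun i => a i + t, fun i hi => add_pos_of_nonneg_of_pos (ha i hi) ht, ?_⟩
  simp only [add_smul, Finset.sum_add_distrib, ← hat, ← Finset.smul_sum]
  abel

/-- A point in the closure of the chamber of `ω` is a non-negative combination of the characters in
every anticone of `ω`. -/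
theorem mem_nonnegCone_of_mem_closure {ω θ : ℝ ⊗[ℤ] Module.Dual ℤ L}
    (hθ : θ ∈ closure (chamber D ω)) {K : Finset ι}
    (hK : Submodule.span ℝ (realChar D '' (K : Set ι)) = ⊤) (hω : ω ∈ posCone (realChar D) K) :
    θ ∈ nonnegCone (realChar D) K := by
  rw [← closure_posCone]
  exact closure_mono (chamber_subset_posCone D ω hK ⟨ω, mem_chamber_self D ⟨θ, hθ⟩, hω⟩) hθ

/-- If `ω₀` is in the closure of the chamber of `ω` and is a positive combination of characters
that generate the wall `e^⊥`, then adding any character on the positive side gives an anticone of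
`ω`. -/
theorem mem_posCone_insert [DecidableEq ι] {e : L} {ω ω₀ : ℝ ⊗[ℤ] Module.Dual ℤ L}
    (hpos : ∀ θ ∈ chamber D ω, 0 < pairing e θ) (hcl : ω₀ ∈ closure (chamber D ω))
    {I : Finset ι} (hI : ω₀ ∈ posCone (realChar D) I)
    (hgen : Submodule.span ℤ (D '' (I : Set ι)) = LinearMap.ker (Module.Dual.eval ℤ L e))
    {j : ι} (hj : 0 < D j e) : ω ∈ posCone (realChar D) (insert j I) := by
  have hIe : ∀ i ∈ I, D i e = 0 := fun i hi => by
    have : D i ∈ LinearMap.ker (Module.Dual.eval ℤ L e) := by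
      rw [← hgen]; exact Submodule.subset_span ⟨i, hi, rfl⟩
    simpa using this
  have hjI : j ∉ I := fun h => hj.ne' (hIe j h)
  have hreal : ∀ χ ∈ Submodule.span ℤ (D '' (I : Set ι)),
      (1 : ℝ) ⊗ₜ[ℤ] χ ∈ Submodule.span ℝ (realChar D '' (I : Set ι)) := by
    intro χ hχ
    induction hχ using Submodule.span_induction with
    | mem x hx =>
      obtain ⟨i, hi, rfl⟩ := hx
      exact Submodule.subset_span ⟨i, hi, rfl⟩
    | zero => simp
    | add x y _ _ hx hy => rw [tmul_add]; exact add_mem hx hy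
    | smul n x _ hx =>
      rw [tmul_smul, ← Int.cast_smul_eq_zsmul ℝ]
      exact Submodule.smul_mem _ _ hx
  have hspan : Submodule.span ℝ (realChar D '' ((insert j I : Finset ι) : Set ι)) = ⊤ := by
    rw [eq_top_iff]
    rintro x -
    induction x using TensorProduct.induction_on with
    | zero => exact zero_mem _
    | add x y hx hy => exact add_mem hx hy
    | tmul c χ =>
      have h1 : D j e • χ - χ e • D j ∈ Submodule.span ℤ (D '' (I : Set ι)) := by
        rw [hgen]; simp [mul_comm]
      have h2 := Submodule.span_mono (Set.image_mono (f := realChar D)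
        (Finset.coe_subset.2 (Finset.subset_insert j I))) (hreal _ h1)
      have h3 : realChar D j ∈ Submodule.span ℝ (realChar D '' ((insert j I : Finset ι) : Set ι)) :=
        Submodule.subset_span ⟨j, by simp, rfl⟩
      rw [tmul_sub, tmul_smul, tmul_smul, ← Int.cast_smul_eq_zsmul ℝ,
        ← Int.cast_smul_eq_zsmul ℝ] at h2
      have h4 := add_mem h2 (Submodule.smul_mem _ ((χ e : ℤ) : ℝ) h3)
      rw [sub_add_cancel, Submodule.smul_mem_iff _ (by exact_mod_cast hj.ne')] at h4
      have := Submodule.smul_mem _ c h4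
      rwa [TensorProduct.smul_tmul', smul_eq_mul, mul_one] at this
  -- the half-space of points `∑ aᵢ Dᵢ + c Dⱼ` with `aᵢ > 0` and `c` arbitrary is open
  obtain ⟨θ, hθ, a, c, ha, rfl⟩ : ∃ θ ∈ chamber D ω, ∃ (a : ι → ℝ) (c : ℝ), (∀ i ∈ I, 0 < a i) ∧
      θ = c • realChar D j + ∑ i ∈ I, a i • realChar D i := by
    let f : (↥(insert j I) → ℝ) →ₗ[ℝ] ℝ ⊗[ℤ] Module.Dual ℤ L :=
      Fintype.linearCombination ℝ (fun i : ↥(insert j I) => realChar D i)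
    have hf : Function.Surjective f := by
      rw [← LinearMap.range_eq_top, Fintype.range_linearCombination, ← hspan]
      congr 1
      ext; simp
    have hfa : ∀ a : ι → ℝ, f (fun i => a i) =
        a j • realChar D j + ∑ i ∈ I, a i • realChar D i := fun a => by
      simp only [f, Fintype.linearCombination_apply]
      rw [Finset.sum_coe_sort (insert j I) (fun i => a i • realChar D i), Finset.sum_insert hjI]
    have hopen := LinearMap.isOpenMap_of_finiteDimensional f hf
      (Set.univ.pi fun i => if i.1 = j then Set.univ else Set.Ioi 0)
      (isOpen_set_pi Set.finite_univ fun i _ => by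
        split_ifs; exacts [isOpen_univ, isOpen_Ioi])
    have hω₀ : ω₀ ∈ f '' (Set.univ.pi fun i => if i.1 = j then Set.univ else Set.Ioi 0) := by
      obtain ⟨a, ha, rfl⟩ := hI
      refine ⟨fun i => if i.1 = j then 0 else a i, fun i _ => ?_, ?_⟩
      · dsimp only
        split_ifs with h
        · trivial
        · exact ha i ((Finset.mem_insert.1 i.2).resolve_left h)
      · refine (hfa fun i => if i = j then 0 else a i).trans ?_
        rw [if_pos rfl, zero_smul, zero_add]
        exact Finset.sum_congr rfl fun i hi => by
          rw [if_neg (ne_of_mem_of_not_mem hi hjI)]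
    obtain ⟨θ, ⟨b, hb, rfl⟩, hθ⟩ := mem_closure_iff.1 hcl _ hopen hω₀
    refine ⟨_, hθ, fun i => if h : i ∈ insert j I then b ⟨i, h⟩ else 0, b ⟨j, by simp⟩,
      fun i hi => ?_, ?_⟩
    · have := hb ⟨i, Finset.mem_insert_of_mem hi⟩ trivial
      have hne : i ≠ j := fun h => hjI (h ▸ hi)
      simpa [hne, hi] using this
    · have h5 := hfa fun i => if h : i ∈ insert j I then b ⟨i, h⟩ else 0
      rw [dif_pos (Finset.mem_insert_self j I)] at h5
      rw [← h5]
      congr 1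
      funext i
      rw [dif_pos i.2]
  have hc : 0 < c := by
    have := hpos _ hθ
    rw [map_add, map_sum, map_smul, pairing_tmul, Finset.sum_eq_zero, add_zero, one_mul,
      smul_eq_mul] at this
    · exact pos_of_mul_pos_left this (by exact_mod_cast hj.le)
    · intro i hi
      rw [map_smul, pairing_tmul, hIe i hi]; simp
  refine chamber_subset_posCone D ω hspan ⟨_, hθ, fun i => if i = j then c else a i,
    fun i hi => ?_, ?_⟩ (mem_chamber_self D ⟨_, hcl⟩)
  · dsimp only
    split_ifs with h
    · exact hc
    · exact ha i ((Finset.mem_insert.1 hi).resolve_left h)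
  · dsimp only
    rw [Finset.sum_insert hjI, if_pos rfl]
    congr 1
    exact Finset.sum_congr rfl fun i hi => by rw [if_neg (ne_of_mem_of_not_mem hi hjI)]

end Chambers

/-! ### Rational points of cones -/

section Rational

/-- Finitely many positive real numbers remain positive under a suitable `ℚ`-linear map
`ℝ → ℚ`. -/
theorem exists_rat_linearMap_pos {κ : Type*} (s : Finset κ) (a : κ → ℝ) (ha : ∀ k ∈ s, 0 < a k) :
    ∃ f : ℝ →ₗ[ℚ] ℚ, ∀ k ∈ s, 0 < f (a k) := by
  let b := Module.Basis.ofVectorSpace ℚ ℝ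
  let ev : κ → (Module.Basis.ofVectorSpaceIndex ℚ ℝ → ℝ) → ℝ := fun k g =>
    (b.repr (a k)).sum fun x c => (c : ℝ) * g x
  have hev : ∀ k, Continuous (ev k) := fun k => by
    simp only [ev, Finsupp.sum]; fun_prop
  have hopen : IsOpen {g | ∀ k ∈ s, 0 < ev k g} := by
    simp only [Set.ofPred_forall]
    exact isOpen_biInter_finset fun k _ => isOpen_lt continuous_const (hev k)
  have hb : ∀ k, ev k (fun x => b x) = a k := fun k => by
    conv_rhs => rw [← b.linearCombination_repr (a k)]
    simp only [ev, Finsupp.linearCombination_apply, Rat.smul_def]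
  have hdense : DenseRange (fun (g : Module.Basis.ofVectorSpaceIndex ℚ ℝ → ℚ) x => (g x : ℝ)) :=
    DenseRange.piMap fun _ => Rat.denseRange_cast
  obtain ⟨g, hg⟩ := hdense.exists_mem_open hopen ⟨fun x => b x, fun k hk => by
    rw [hb]; exact ha k hk⟩
  refine ⟨b.constr ℚ g, fun k hk => ?_⟩
  have := hg k hk
  simp only [ev, Finsupp.sum] at this
  rw [Module.Basis.constr_apply, Finsupp.sum]
  simp only [smul_eq_mul]
  exact_mod_cast this

/-- An integral character in a cone has a multiple that is a combination of the generators with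
natural coefficients, and the support can be prescribed. -/
theorem exists_nat_combination {L : Type} [AddCommGroup L] {ι : Type} (D : ι → Module.Dual ℤ L)
    (ω₀ : Module.Dual ℤ L) {K : Finset ι}
    (h : (1 : ℝ) ⊗ₜ[ℤ] ω₀ ∈ posCone (realChar D) K) :
    ∃ (n : ℕ) (v : ι → ℕ), 0 < n ∧ (∀ i ∈ K, 0 < v i) ∧ (∀ i ∉ K, v i = 0) ∧
      ∑ i ∈ K, v i • D i = n • ω₀ := by
  classical
  obtain ⟨a, ha, h⟩ := h
  obtain ⟨f, hf⟩ := exists_rat_linearMap_pos (insert none (K.image some))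
    (fun k : Option ι => k.elim 1 a) (by
      intro k hk
      rcases k with - | i
      · exact one_pos
      · exact ha i (by simpa using hk))
  have hf1 : 0 < f 1 := hf none (by simp)
  have hfa : ∀ i ∈ K, 0 < f (a i) := fun i hi => hf (some i) (by simpa using hi)
  have hrel : ∀ x : L, ∑ i ∈ K, f (a i) * (D i x : ℚ) = f 1 * (ω₀ x : ℚ) := by
    intro x
    have h1 := congrArg (pairing x) h
    rw [pairing_tmul, map_sum] at h1
    simp only [map_smul, pairing_tmul, one_mul, smul_eq_mul] at h1
    have h2 := congrArg f h1
    rw [map_sum] at h2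
    have hint : ∀ (r : ℝ) (m : ℤ), f (r * m) = f r * m := fun r m => by
      rw [mul_comm, ← zsmul_eq_mul, map_zsmul, zsmul_eq_mul, mul_comm]
    simp only [hint] at h2
    rw [← h2, ← one_mul (ω₀ x : ℝ), hint]
  -- clear denominators
  let N : ℕ := (f 1).den * ∏ i ∈ K, (f (a i)).den
  have hN : 0 < N := Nat.mul_pos (f 1).den_pos (Finset.prod_pos fun i _ => (f (a i)).den_pos)
  have hclear : ∀ q : ℚ, 0 < q → q.den ∣ N → ∃ m : ℕ, 0 < m ∧ (m : ℚ) = N * q := by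
    rintro q hq ⟨c, hc⟩
    refine ⟨q.num.toNat * c, Nat.mul_pos (by have := Rat.num_pos.2 hq; omega)
      (Nat.pos_of_ne_zero fun h => by simp [h] at hc; omega), ?_⟩
    have h0 : ((q.num.toNat : ℕ) : ℚ) = q.num := by
      exact_mod_cast Int.toNat_of_nonneg (Rat.num_pos.2 hq).le
    rw [hc]
    push_cast
    rw [h0]
    have := Rat.mul_den_eq_num q
    rw [← this]; ring
  obtain ⟨n, hn, hn'⟩ := hclear _ hf1 (Dvd.intro _ rfl)
  have hden : ∀ i ∈ K, ∃ m : ℕ, 0 < m ∧ (m : ℚ) = N * f (a i) := fun i hi =>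
    hclear _ (hfa i hi) ((Finset.dvd_prod_of_mem (fun i => (f (a i)).den) hi).mul_left _)
  choose! v hv hv' using hden
  refine ⟨n, fun i => if i ∈ K then v i else 0, hn, fun i hi => by simpa [hi] using hv i hi,
    fun i hi => by simp [hi], ?_⟩
  ext x
  have : ((∑ i ∈ K, v i • D i x : ℤ) : ℚ) = ((n • ω₀ x : ℤ) : ℚ) := by
    simp only [nsmul_eq_mul, Int.cast_sum, Int.cast_mul, Int.cast_natCast]
    rw [hn', mul_assoc, ← hrel x, Finset.mul_sum]
    exact Finset.sum_congr rfl fun i hi => by rw [hv' i hi, mul_assoc]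
  have h3 := Int.cast_injective this
  rw [LinearMap.sum_apply, LinearMap.smul_apply, ← h3]
  exact Finset.sum_congr rfl fun i hi => by
    dsimp only
    rw [if_pos hi, LinearMap.smul_apply]

end Rational

/-! ### Quotient stacks by split groups -/

section Split

variable {G H K : SchCᵒᵖ ⥤ GrpCat.{0}}

/-- The value of a homomorphism of presheaves of groups at a `T`-point. -/
def homVal (c : G ⟶ H) {T : SchC} (g : G.obj (op T)) : H.obj (op T) := (c.app (op T)).hom g

theorem homVal_mul (c : G ⟶ H) {T : SchC} (g g' : G.obj (op T)) :
    homVal c (g * g') = homVal c g * homVal c g' := map_mul _ _ _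

theorem homVal_one (c : G ⟶ H) {T : SchC} : homVal c (1 : G.obj (op T)) = 1 := map_one _

theorem homVal_map (c : G ⟶ H) {T' T : SchC} (u : T' ⟶ T) (g : G.obj (op T)) :
    homVal c (G.map u.op g) = H.map u.op (homVal c g) :=
  congr($(c.naturality u.op) g)

variable (G H K) in
/-- A decomposition of the presheaf of groups `K` as a product `G × H`. -/
structure Splitting where
  inl : G ⟶ K
  inr : H ⟶ K
  fst : K ⟶ G
  snd : K ⟶ H
  fst_inl : ∀ {T : SchC} (g : G.obj (op T)), homVal fst (homVal inl g) = g
  snd_inl : ∀ {T : SchC} (g : G.obj (op T)), homVal snd (homVal inl g) = 1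
  fst_inr : ∀ {T : SchC} (h : H.obj (op T)), homVal fst (homVal inr h) = 1
  snd_inr : ∀ {T : SchC} (h : H.obj (op T)), homVal snd (homVal inr h) = h
  eq_mul : ∀ {T : SchC} (k : K.obj (op T)), homVal inl (homVal fst k) * homVal inr (homVal snd k) = k
  comm : ∀ {T : SchC} (g : G.obj (op T)) (h : H.obj (op T)),
    homVal inl g * homVal inr h = homVal inr h * homVal inl g

theorem app_map {F F' : SchCᵒᵖ ⥤ Type} (f : F ⟶ F') {T' T : SchC} (u : T' ⟶ T)
    (x : F.obj (op T)) : f.app (op T') (F.map u.op x) = F'.map u.op (f.app (op T) x) :=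
  congr($(f.naturality u.op) x)

/-- A morphism of `[U/G]` is invertible if it is so on the bases and bijective on the points of the
torsors. -/
theorem QuotStack.isIso_of_bijective {U : GSpace G} {ξ η : QuotStack U} (m : ξ ⟶ η)
    (hb : IsIso m.base) (h : ∀ T, Function.Bijective (m.tot.app T)) : IsIso m := by
  have ht : IsIso m.tot := by
    rw [NatTrans.isIso_iff_isIso_app]
    intro T
    rw [CategoryTheory.isIso_iff_bijective]
    exact h T
  have inv_apply : ∀ {T : SchC} (p : ξ.P.X.obj (op T)),
      (inv m.tot).app (op T) (m.tot.app (op T) p) = p := fun {T} p =>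
    congr(($(IsIso.hom_inv_id m.tot).app (op T)) p)
  refine ⟨{
    base := inv m.base
    tot := inv m.tot
    tot_act := fun {T} k p => by
      obtain ⟨q, rfl⟩ := (h (op T)).2 p
      rw [← m.tot_act, inv_apply, inv_apply]
    tot_π := by
      rw [IsIso.inv_comp_eq, ← Category.assoc, m.tot_π, Category.assoc, ← CategoryTheory.Functor.map_comp,
        IsIso.hom_inv_id, CategoryTheory.Functor.map_id, Category.comp_id]
    tot_f := by rw [IsIso.inv_comp_eq, m.tot_f] }, ?_, ?_⟩
  · exact QuotStack.Hom.ext (IsIso.hom_inv_id _) (IsIso.hom_inv_id _)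
  · exact QuotStack.Hom.ext (IsIso.inv_hom_id _) (IsIso.inv_hom_id _)

/-- The product of a presheaf of sets with the underlying presheaf of a presheaf of groups. -/
def prodPresheaf (F : SchCᵒᵖ ⥤ Type) (H : SchCᵒᵖ ⥤ GrpCat.{0}) : SchCᵒᵖ ⥤ Type where
  obj T := F.obj T × H.obj T
  map u := TypeCat.ofHom fun x => (F.map u x.1, H.map u x.2)
  map_id T := by
    apply ConcreteCategory.hom_ext
    intro x
    exact Prod.ext (by simp) (by simp)
  map_comp u v := by
    apply ConcreteCategory.hom_ext
    intro x
    exact Prod.ext (by simp) (by simp)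

variable (s : Splitting G H K)

/-- The torsor `P × H` under `K = G × H` that is induced by a `G`-torsor `P`. -/
def Splitting.ind (P : GSpace G) : GSpace K where
  X := prodPresheaf P.X H
  act {T} k x := ((P.act (homVal s.fst k) x.1, homVal s.snd k * x.2) : P.X.obj (op T) × H.obj (op T))
  one_act {T} x := by
    refine Prod.ext ?_ ?_ <;> simp [homVal_one, P.one_act]
  mul_act {T} g h x := by
    refine Prod.ext ?_ ?_
    · simp [homVal_mul, P.mul_act]
    · simp [homVal_mul, mul_assoc]
  map_act {T' T} u g x := by
    refine Prod.ext ?_ ?_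
    · change P.X.map u.op (P.act (homVal s.fst g) x.1) = _
      rw [P.map_act, homVal_map]
      rfl
    · change H.map u.op (homVal s.snd g * x.2) = _
      rw [map_mul, homVal_map s.snd]
      rfl

theorem isSheaf_prodPresheaf {F : SchCᵒᵖ ⥤ Type} (hF : Presieve.IsSheaf etaleC F)
    (hH : Presieve.IsSheaf etaleC (H ⋙ forget GrpCat)) :
    Presieve.IsSheaf etaleC (prodPresheaf F H) := by
  intro T R hR x hx
  let x₁ : Presieve.FamilyOfElements F R.arrows := fun T' u hu => (x u hu).1
  let x₂ : Presieve.FamilyOfElements (H ⋙ forget GrpCat) R.arrows := fun T' u hu => (x u hu).2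
  have h₁ : x₁.Compatible := fun _ _ _ g₁ g₂ _ _ h₁ h₂ hc =>
    congrArg Prod.fst (hx g₁ g₂ h₁ h₂ hc)
  have h₂ : x₂.Compatible := fun _ _ _ g₁ g₂ _ _ h₁ h₂ hc =>
    congrArg Prod.snd (hx g₁ g₂ h₁ h₂ hc)
  obtain ⟨t₁, ht₁, hu₁⟩ := hF R hR x₁ h₁
  obtain ⟨t₂, ht₂, hu₂⟩ := hH R hR x₂ h₂
  refine ⟨(t₁, t₂), fun T' u hu => Prod.ext (ht₁ u hu) (ht₂ u hu), fun t ht => Prod.ext ?_ ?_⟩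
  · exact hu₁ _ fun T' u hu => congrArg Prod.fst (ht u hu)
  · exact hu₂ _ fun T' u hu => congrArg Prod.snd (ht u hu)

/-- An equivariant map `ε : V → U` along the inclusion of the factor `G` of `K = G × H`, where `H`
is a sheaf and the induced map `V × H → U`, `(v, h) ↦ h • ε v`, is a monomorphism. -/
structure Splitting.Slice (V : GSpace G) (U : GSpace K) where
  ε : V.X ⟶ U.X
  ε_act : ∀ {T : SchC} (g : G.obj (op T)) (v : V.X.obj (op T)),
    ε.app (op T) (V.act g v) = U.act (homVal s.inl g) (ε.app (op T) v)
  isSheaf : Presieve.IsSheaf etaleC (H ⋙ forget GrpCat)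
  mono : ∀ {T : SchC} (h h' : H.obj (op T)) (v v' : V.X.obj (op T)),
    U.act (homVal s.inr h) (ε.app (op T) v) = U.act (homVal s.inr h') (ε.app (op T) v') →
      h = h' ∧ v = v'

namespace Splitting.Slice

variable {s} {V : GSpace G} {U : GSpace K} (σ : s.Slice V U)

/-- The map `V × H → U`. -/
def sweep {T : SchC} (v : V.X.obj (op T)) (h : H.obj (op T)) : U.X.obj (op T) :=
  U.act (homVal s.inr h) (σ.ε.app (op T) v)

theorem sweep_act {T : SchC} (k : K.obj (op T)) (v : V.X.obj (op T)) (h : H.obj (op T)) :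
    σ.sweep (V.act (homVal s.fst k) v) (homVal s.snd k * h) = U.act k (σ.sweep v h) := by
  rw [sweep, sweep, σ.ε_act, ← U.mul_act, ← U.mul_act]
  congr 1
  rw [← s.comm]
  conv_rhs => rw [← s.eq_mul k, mul_assoc, ← homVal_mul]

theorem sweep_map {T' T : SchC} (u : T' ⟶ T) (v : V.X.obj (op T)) (h : H.obj (op T)) :
    U.X.map u.op (σ.sweep v h) = σ.sweep (V.X.map u.op v) (H.map u.op h) := by
  rw [sweep, sweep, U.map_act, app_map, homVal_map]

theorem sweep_injective {T : SchC} {v v' : V.X.obj (op T)} {h h' : H.obj (op T)}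
    (e : σ.sweep v h = σ.sweep v' h') : h = h' ∧ v = v' := σ.mono h h' v v' e

/-- The object of `[U/K]` induced by an object `(P, f)` of `[V/G]`: the torsor `P × H` with the map
`(p, h) ↦ h • ε (f p)`. -/
def indObj (ξ : QuotStack V) : QuotStack U where
  base := ξ.base
  P := s.ind ξ.P
  isSheaf := isSheaf_prodPresheaf ξ.isSheaf σ.isSheaf
  π :=
    { app := fun T => TypeCat.ofHom fun x => ξ.π.app T x.1
      naturality := fun T T' u => by
        apply ConcreteCategory.hom_ext
        intro x
        exact app_map ξ.π u.unop x.1 }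
  π_act k p := ξ.π_act _ _
  simply_transitive {T} p q hpq := by
    obtain ⟨g, hg, hu⟩ := ξ.simply_transitive (T := T) p.1 q.1 hpq
    refine ⟨homVal s.inl g * homVal s.inr (q.2 * p.2⁻¹), ?_, fun k hk => ?_⟩
    · refine Prod.ext ?_ ?_
      · change ξ.P.act _ p.1 = q.1
        rw [homVal_mul, s.fst_inl, s.fst_inr, mul_one, hg]
      · change homVal s.snd _ * p.2 = q.2
        rw [homVal_mul, s.snd_inl, s.snd_inr, one_mul, inv_mul_cancel_right]
    · have h₁ : ξ.P.act (homVal s.fst k) p.1 = q.1 := congrArg Prod.fst hk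
      have h₂ : homVal s.snd k * p.2 = q.2 := congrArg Prod.snd hk
      rw [← s.eq_mul k, hu _ h₁, ← h₂, mul_inv_cancel_right]
  locally_trivial := by
    obtain ⟨R, hR, h⟩ := ξ.locally_trivial
    refine ⟨R, hR, fun T u hu => ?_⟩
    obtain ⟨p, hp⟩ := h T u hu
    exact ⟨(p, 1), hp⟩
  f :=
    { app := fun T => TypeCat.ofHom fun x => σ.sweep (ξ.f.app T x.1) x.2
      naturality := fun T T' u => by
        apply ConcreteCategory.hom_ext
        intro x
        change σ.sweep (ξ.f.app T' (ξ.P.X.map u x.1)) (H.map u x.2) =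
          U.X.map u (σ.sweep (ξ.f.app T x.1) x.2)
        exact (congrArg (fun v => σ.sweep v (H.map u x.2)) (app_map ξ.f u.unop x.1)).trans
          (σ.sweep_map u.unop _ _).symm }
  f_act {T} k p := by
    change σ.sweep (ξ.f.app (op T) (ξ.P.act (homVal s.fst k) p.1)) (homVal s.snd k * p.2) =
      U.act k (σ.sweep (ξ.f.app (op T) p.1) p.2)
    rw [ξ.f_act, sweep_act]

/-- The morphism of stacks `[V/G] → [U/K]` induced by `ε`. -/
def stackHom : StackHom V U where
  functor :=
    { obj := σ.indObj
      map := fun {ξ η} m =>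
        { base := m.base
          tot :=
            { app := fun T => TypeCat.ofHom fun x => (m.tot.app T x.1, x.2)
              naturality := fun T T' u => by
                apply ConcreteCategory.hom_ext
                intro x
                exact Prod.ext (app_map m.tot u.unop x.1) rfl }
          tot_act := fun k p => Prod.ext (m.tot_act _ _) rfl
          tot_π := by
            ext T x
            exact congr(($(m.tot_π).app T) x.1)
          tot_f := by
            ext T x
            exact congrArg (fun v => σ.sweep v x.2) congr(($(m.tot_f).app T) x.1) }
      map_id := fun ξ => by apply QuotStack.Hom.ext <;> rfl
      map_comp := fun a b => by apply QuotStack.Hom.ext <;> rfl }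
  overIso := NatIso.ofComponents (fun ξ => Iso.refl _) (fun m =>
    (Category.comp_id (QuotStack.Hom.base m)).trans (Category.id_comp (QuotStack.Hom.base m)).symm)

theorem faithful : σ.stackHom.functor.Faithful where
  map_injective {ξ η} m m' h := by
    apply QuotStack.Hom.ext
    · exact congrArg (fun t : σ.stackHom.functor.obj ξ ⟶ σ.stackHom.functor.obj η => t.base) h
    · ext T x
      have h₁ := congrArg
        (fun t : σ.stackHom.functor.obj ξ ⟶ σ.stackHom.functor.obj η => t.tot) h
      exact congrArg Prod.fst congr(($(h₁).app T) (x, 1))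

theorem full : σ.stackHom.functor.Full where
  map_surjective {ξ η} t := by
    have hf : ∀ {T : SchC} (p : ξ.P.X.obj (op T)) (h : H.obj (op T)),
        (t.tot.app (op T) (p, h)).2 = h ∧
          η.f.app (op T) (t.tot.app (op T) (p, h)).1 = ξ.f.app (op T) p := fun {T} p h =>
      σ.sweep_injective congr(($(t.tot_f).app (op T)) (p, h))
    have hfst : ∀ {T : SchC} (p : ξ.P.X.obj (op T)) (h : H.obj (op T)),
        (t.tot.app (op T) (p, h)).1 = (t.tot.app (op T) (p, 1)).1 := fun {T} p h => by
      have h₁ := t.tot_act (homVal s.inr h) (p, 1)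
      have h₂ : (σ.indObj ξ).P.act (homVal s.inr h) (p, 1) = (p, h) := by
        refine Prod.ext ?_ ?_
        · change ξ.P.act (homVal s.fst (homVal s.inr h)) p = p
          rw [s.fst_inr, ξ.P.one_act]
        · change homVal s.snd (homVal s.inr h) * 1 = h
          rw [s.snd_inr, mul_one]
      rw [← h₂]
      refine (congrArg Prod.fst h₁).trans ?_
      change η.P.act (homVal s.fst (homVal s.inr h)) _ = _
      rw [s.fst_inr, η.P.one_act]
    refine ⟨{
      base := t.base
      tot :=
        { app := fun T => TypeCat.ofHom fun p => (t.tot.app T (p, 1)).1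
          naturality := fun T T' u => by
            apply ConcreteCategory.hom_ext
            intro p
            have := app_map t.tot u.unop ((p, 1) : ξ.P.X.obj T × H.obj T)
            refine ((hfst _ _).symm.trans (congrArg Prod.fst this) : _) }
      tot_act := fun {T} g p => by
        have h₁ := congrArg Prod.fst (t.tot_act (homVal s.inl g) (p, 1))
        have h₂ : (σ.stackHom.functor.obj ξ).P.act (homVal s.inl g) (p, 1) =
            (ξ.P.act g p, 1) := by
          refine Prod.ext ?_ ?_
          · change ξ.P.act (homVal s.fst (homVal s.inl g)) p = _
            rw [s.fst_inl]
          · change homVal s.snd (homVal s.inl g) * 1 = 1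
            rw [s.snd_inl, mul_one]
        rw [h₂] at h₁
        refine h₁.trans ?_
        change η.P.act (homVal s.fst (homVal s.inl g)) _ = _
        rw [s.fst_inl]
        rfl
      tot_π := by
        ext T p
        exact congr(($(t.tot_π).app T) (p, 1))
      tot_f := by
        ext T p
        exact (hf (T := T.unop) p 1).2 }, ?_⟩
    apply QuotStack.Hom.ext
    · rfl
    · ext T x
      exact Prod.ext (hfst (T := T.unop) x.1 x.2).symm (hf (T := T.unop) x.1 x.2).1.symm

/-- The part of a `K`-torsor over `ε V`, in a torsor whose map to `U` factors through `V × H`: it is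
a `G`-torsor that induces the given one. -/
def resObj (ξ : QuotStack U)
    (hξ : ∀ (T : SchC) (p : ξ.P.X.obj (op T)), ∃ v h, σ.sweep v h = ξ.toU p) : QuotStack V :=
  have hmem : ∀ {T : SchC} (g : G.obj (op T)) (p : ξ.P.X.obj (op T)),
      (∃ v, σ.ε.app (op T) v = ξ.f.app (op T) p) →
        ∃ v, σ.ε.app (op T) v = ξ.f.app (op T) (ξ.P.act (homVal s.inl g) p) := by
    rintro T g p ⟨v, hv⟩
    exact ⟨V.act g v, by rw [σ.ε_act, hv, ξ.f_act]⟩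
  have hmap : ∀ {T T' : SchCᵒᵖ} (u : T ⟶ T') (p : ξ.P.X.obj T),
      (∃ v, σ.ε.app T v = ξ.f.app T p) → ∃ v, σ.ε.app T' v = ξ.f.app T' (ξ.P.X.map u p) := by
    rintro T T' u p ⟨v, hv⟩
    refine ⟨V.X.map u v, ?_⟩
    exact (app_map σ.ε u.unop v).trans ((congrArg _ hv).trans (app_map ξ.f u.unop p).symm)
  have hinj : ∀ {T : SchCᵒᵖ} (v v' : V.X.obj T), σ.ε.app T v = σ.ε.app T v' → v = v' := by
    intro T v v' h
    exact (σ.mono (T := T.unop) 1 1 v v' (congrArg _ h)).2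
  let X : SchCᵒᵖ ⥤ Type :=
    { obj := fun T => {p : ξ.P.X.obj T // ∃ v, σ.ε.app T v = ξ.f.app T p}
      map := fun u => TypeCat.ofHom fun p => ⟨ξ.P.X.map u p.1, hmap u p.1 p.2⟩
      map_id := fun T => by
        apply ConcreteCategory.hom_ext
        intro p
        exact Subtype.ext (by simp)
      map_comp := fun u v => by
        apply ConcreteCategory.hom_ext
        intro p
        exact Subtype.ext (by simp) }
  { base := ξ.base
    P :=
      { X := X
        act := fun g p => ⟨ξ.P.act (homVal s.inl g) p.1, hmem g p.1 p.2⟩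
        one_act := fun p => Subtype.ext (by
          change ξ.P.act _ p.1 = p.1
          rw [homVal_one, ξ.P.one_act])
        mul_act := fun g g' p => Subtype.ext (by
          change ξ.P.act _ p.1 = _
          rw [homVal_mul, ξ.P.mul_act])
        map_act := fun u g p => Subtype.ext (by
          change ξ.P.X.map u.op (ξ.P.act _ p.1) = ξ.P.act _ (ξ.P.X.map u.op p.1)
          rw [ξ.P.map_act, homVal_map]) }
    isSheaf := by
      intro T R hR x hx
      obtain ⟨t, ht, hu⟩ := ξ.isSheaf R hR (fun T' u hu => (x u hu).1)
        (fun _ _ _ g₁ g₂ _ _ h₁ h₂ hc => congrArg Subtype.val (hx g₁ g₂ h₁ h₂ hc))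
      obtain ⟨v, c, hv⟩ := hξ T t
      -- the component in `H` of the glued section is trivial because it is so locally
      have hc : c = 1 := (σ.isSheaf R hR).isSeparatedFor.ext fun T' u hu => by
        obtain ⟨w, hw⟩ := (x u hu).2
        have h₁ : σ.sweep (V.X.map u.op v) (H.map u.op c) = σ.sweep w 1 := by
          rw [← sweep_map, hv]
          refine (app_map ξ.f u t).symm.trans ?_
          rw [ht u hu, ← hw, sweep, homVal_one, U.one_act]
        change H.map u.op c = H.map u.op 1
        rw [(σ.sweep_injective h₁).1, map_one]
      refine ⟨⟨t, v, ?_⟩, fun T' u hu => Subtype.ext (ht u hu), fun t' ht' => Subtype.ext ?_⟩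
      · rw [hc, sweep, homVal_one, U.one_act] at hv
        exact hv
      · exact hu _ fun T' u hu => congrArg Subtype.val (ht' u hu)
    π :=
      { app := fun T => TypeCat.ofHom fun p => ξ.π.app T p.1
        naturality := fun T T' u => by
          apply ConcreteCategory.hom_ext
          intro p
          exact app_map ξ.π u.unop p.1 }
    π_act := fun g p => ξ.π_act _ _
    simply_transitive := fun {T} p q hpq => by
      obtain ⟨k, hk, hu⟩ := ξ.simply_transitive p.1 q.1 hpq
      obtain ⟨v, hv⟩ := p.2
      obtain ⟨w, hw⟩ := q.2
      have h₁ : σ.sweep (V.act (homVal s.fst k) v) (homVal s.snd k * 1) = σ.sweep w 1 := by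
        rw [sweep_act, sweep, sweep, homVal_one, U.one_act, U.one_act, hw, ← hk, ξ.f_act, hv]
      have h₂ : homVal s.snd k = 1 := by simpa using (σ.sweep_injective h₁).1
      have h₃ : homVal s.inl (homVal s.fst k) = k := by
        conv_rhs => rw [← s.eq_mul k, h₂, homVal_one, mul_one]
      refine ⟨homVal s.fst k, Subtype.ext ?_, fun g hg => ?_⟩
      · change ξ.P.act _ p.1 = q.1
        rw [h₃, hk]
      · rw [← hu _ (congrArg Subtype.val hg), s.fst_inl]
    locally_trivial := by
      obtain ⟨R, hR, h⟩ := ξ.locally_trivial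
      refine ⟨R, hR, fun T u hu => ?_⟩
      obtain ⟨p, hp⟩ := h T u hu
      obtain ⟨v, c, hv⟩ := hξ T p
      refine ⟨⟨ξ.P.act (homVal s.inr c)⁻¹ p, v, ?_⟩, (ξ.π_act _ p).trans hp⟩
      change U.act (homVal s.inr c) (σ.ε.app (op T) v) = ξ.f.app (op T) p at hv
      rw [ξ.f_act, ← hv, ← U.mul_act, inv_mul_cancel, U.one_act]
    f :=
      { app := fun T => TypeCat.ofHom fun p => p.2.choose
        naturality := fun T T' u => by
          apply ConcreteCategory.hom_ext
          intro p
          refine hinj _ _ ?_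
          refine (hmap u p.1 p.2).choose_spec.trans ?_
          refine (app_map ξ.f u.unop p.1).trans ?_
          refine (congrArg _ p.2.choose_spec.symm).trans ?_
          exact (app_map σ.ε u.unop p.2.choose).symm }
    f_act := fun {T} g p => by
      refine hinj _ _ ?_
      refine (hmem g p.1 p.2).choose_spec.trans ?_
      rw [ξ.f_act, σ.ε_act]
      exact congrArg _ p.2.choose_spec.symm }

/-- An object of `[U/K]` is in the essential image of `[V/G]` if and only if its map to `U` factors
through `V × H`. -/
theorem essImage_iff (ξ : QuotStack U) : σ.stackHom.functor.essImage ξ ↔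
    ∀ (T : SchC) (p : ξ.P.X.obj (op T)), ∃ v h, σ.sweep v h = ξ.toU p := by
  constructor
  · rintro ⟨η, ⟨i⟩⟩ T p
    let q : η.P.X.obj (op T) × H.obj (op T) := (QuotStack.Hom.tot i.inv).app (op T) p
    refine ⟨η.f.app (op T) q.1, q.2, ?_⟩
    exact congr(($((QuotStack.Hom.tot_f i.inv)).app (op T)) p)
  · intro hξ
    let η := σ.resObj ξ hξ
    let t : (σ.indObj η).P.X ⟶ ξ.P.X :=
      { app := fun T => TypeCat.ofHom fun x => ξ.P.act (homVal s.inr x.2) x.1.1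
        naturality := fun T T' u => by
          apply ConcreteCategory.hom_ext
          intro x
          change ξ.P.act (homVal s.inr (H.map u x.2)) (ξ.P.X.map u x.1.1) =
            ξ.P.X.map u (ξ.P.act (homVal s.inr x.2) x.1.1)
          exact ((ξ.P.map_act u.unop _ _).trans
            (congrArg (fun k => ξ.P.act k _) (homVal_map s.inr u.unop x.2).symm)).symm }
    have hbij : ∀ T : SchCᵒᵖ, Function.Bijective (t.app T) := by
      intro T
      have hf : ∀ x : η.P.X.obj T × H.obj T,
          ξ.f.app T (t.app T x) = σ.sweep (T := T.unop) x.1.2.choose x.2 := fun x => by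
        refine (ξ.f_act (T := T.unop) (homVal s.inr x.2) x.1.1).trans ?_
        exact congrArg _ x.1.2.choose_spec.symm
      constructor
      · rintro ⟨p, c⟩ ⟨p', c'⟩ hpp
        have h₁ := (hf (p, c)).symm.trans ((congrArg _ hpp).trans (hf (p', c')))
        obtain ⟨rfl, -⟩ := σ.sweep_injective h₁
        have h₂ := congrArg (ξ.P.act (T := T.unop) (homVal s.inr c)⁻¹) hpp
        change ξ.P.act (T := T.unop) _ (ξ.P.act (T := T.unop) _ p.1) =
          ξ.P.act (T := T.unop) _ (ξ.P.act (T := T.unop) _ p'.1) at h₂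
        rw [← ξ.P.mul_act, ← ξ.P.mul_act, inv_mul_cancel, ξ.P.one_act, ξ.P.one_act] at h₂
        rw [Subtype.ext h₂]
      · intro p
        obtain ⟨v, c, hv⟩ := hξ T.unop p
        refine ⟨(⟨ξ.P.act (T := T.unop) (homVal s.inr c)⁻¹ p, v, ?_⟩, c), ?_⟩
        · change U.act (homVal s.inr c) (σ.ε.app T v) = ξ.f.app T p at hv
          refine Eq.trans ?_ (ξ.f_act (T := T.unop) _ p).symm
          refine Eq.trans ?_ (congrArg (U.act (T := T.unop) (homVal s.inr c)⁻¹) hv)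
          rw [← U.mul_act, inv_mul_cancel, U.one_act]
        · change ξ.P.act (T := T.unop) _ (ξ.P.act (T := T.unop) _ p) = p
          rw [← ξ.P.mul_act, mul_inv_cancel, ξ.P.one_act]
    have t_act : ∀ {T : SchC} (k : K.obj (op T)) (p : (σ.indObj η).P.X.obj (op T)),
        t.app (op T) ((σ.indObj η).P.act k p) = ξ.P.act k (t.app (op T) p) := by
      intro T k p
      change ξ.P.act (homVal s.inr (homVal s.snd k * p.2))
        (ξ.P.act (homVal s.inl (homVal s.fst k)) p.1.1) =
          ξ.P.act k (ξ.P.act (homVal s.inr p.2) p.1.1)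
      rw [← ξ.P.mul_act, ← ξ.P.mul_act, ← s.comm, homVal_mul, ← mul_assoc, s.eq_mul]
    have t_π : t ≫ ξ.π = (σ.indObj η).π := by
      ext T x
      exact ξ.π_act (T := T.unop) _ _
    have t_f : t ≫ ξ.f = (σ.indObj η).f := by
      ext T x
      refine (ξ.f_act (T := T.unop) (homVal s.inr x.2) x.1.1).trans ?_
      exact congrArg _ x.1.2.choose_spec.symm
    let m : σ.stackHom.functor.obj η ⟶ ξ :=
      { base := 𝟙 ξ.base
        tot := t
        tot_act := t_act
        tot_π := by
          refine t_π.trans ?_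
          ext T x
          exact (Category.comp_id _).symm
        tot_f := t_f }
    have : IsIso m := QuotStack.isIso_of_bijective m (inferInstanceAs (IsIso (𝟙 ξ.base))) hbij
    exact ⟨η, ⟨asIso m⟩⟩

theorem isClosedImmersionOnto {Y : ∀ T : SchC, Set (U.X.obj (op T))} (hY : IsStableClosed U Y)
    (h : ∀ (T : SchC) (z : U.X.obj (op T)), z ∈ Y T ↔ ∃ v c, σ.sweep v c = z) :
    σ.stackHom.IsClosedImmersionOnto Y where
  stableClosed := hY
  full := σ.full
  faithful := σ.faithful
  essImage ξ := by
    rw [σ.essImage_iff]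
    exact forall₂_congr fun T p => (h T _).symm

end Splitting.Slice

end Split

/-! ### Functions, affine targets and closed subschemes -/

section Functions

/-- The morphism to an affine scheme given by a homomorphism to the ring of global functions. -/
def toSpec {X : Scheme.{0}} {R : Type} [CommRing R] (φ : R →+* Γ(X, ⊤)) :
    X ⟶ Spec (CommRingCat.of R) := X.toSpecΓ ≫ Spec.map (CommRingCat.ofHom φ)

theorem toSpec_bijective (X : Scheme.{0}) (R : Type) [CommRing R] :
    Function.Bijective (toSpec : (R →+* Γ(X, ⊤)) → (X ⟶ Spec (CommRingCat.of R))) := by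
  have h : ∀ φ : R →+* Γ(X, ⊤), toSpec φ =
      ΓSpec.adjunction.homEquiv X (op (CommRingCat.of R)) (CommRingCat.ofHom φ).op := fun φ =>
    (ΓSpec.adjunction.homEquiv_unit (f := (CommRingCat.ofHom φ).op)).symm
  constructor
  · intro φ ψ hφ
    rw [h, h] at hφ
    have := (ΓSpec.adjunction.homEquiv X (op (CommRingCat.of R))).injective hφ
    exact congrArg CommRingCat.Hom.hom (Quiver.Hom.op_inj this)
  · intro f
    obtain ⟨ψ, rfl⟩ := (ΓSpec.adjunction.homEquiv X (op (CommRingCat.of R))).surjective f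
    exact ⟨ψ.unop.hom, h _⟩

theorem comp_toSpec {X Y : Scheme.{0}} (u : Y ⟶ X) {R : Type} [CommRing R]
    (φ : R →+* Γ(X, ⊤)) : u ≫ toSpec φ = toSpec (u.appTop.hom.comp φ) := by
  rw [toSpec, Scheme.toSpecΓ_naturality_assoc, toSpec, CommRingCat.ofHom_comp, Spec.map_comp]
  rfl

theorem toSpec_comp {X : Scheme.{0}} {R S : Type} [CommRing R] [CommRing S]
    (φ : S →+* Γ(X, ⊤)) (ψ : R →+* S) :
    toSpec φ ≫ Spec.map (CommRingCat.ofHom ψ) = toSpec (φ.comp ψ) := by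
  rw [toSpec, toSpec, CommRingCat.ofHom_comp, Spec.map_comp, Category.assoc]

theorem isUnit_of_forall_mem_basicOpen {X : Scheme.{0}} (f : Γ(X, ⊤))
    (h : ∀ t : X, t ∈ X.basicOpen f) : IsUnit f :=
  X.toRingedSpace.isUnit_of_isUnit_germ _ f fun x hx => (Scheme.mem_basicOpen X f x hx).1 (h x)

theorem isUnit_prod_pow {ι R : Type*} [Fintype ι] [CommRing R] {y : ι → R} {v : ι → ℕ}
    (h : ∀ i, v i ≠ 0 → IsUnit (y i)) : IsUnit (∏ i, y i ^ v i) :=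
  IsUnit.prod_univ_iff.2 fun i => by
    by_cases hi : v i = 0
    · rw [hi, pow_zero]
      exact isUnit_one
    · exact (h i hi).pow _

theorem isUnit_of_isUnit_prod_pow {ι R : Type*} [Fintype ι] [CommRing R] {z : ι → R} {u : ι → ℕ}
    (h : IsUnit (∏ i, z i ^ u i)) {i : ι} (hi : u i ≠ 0) : IsUnit (z i) :=
  (isUnit_pow_iff hi).1 (IsUnit.prod_univ_iff.1 h i)

theorem mem_basicOpen_prod_pow {ι : Type} [Fintype ι] {T : SchC} {z : ι → Fn T} {v : ι → ℕ}
    {t : T.left} :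
    t ∈ T.left.basicOpen (∏ i, z i ^ v i) ↔ ∀ i, v i ≠ 0 → t ∈ T.left.basicOpen (z i) := by
  simp only [Scheme.mem_basicOpen_top, map_prod, map_pow]
  exact ⟨fun h _ hi => isUnit_of_isUnit_prod_pow h hi, isUnit_prod_pow⟩

/-- The vanishing locus of a set of functions: a morphism factors through it if and only if the
functions pull back to zero. -/
theorem exists_vanishing_locus {T : SchC} (E : Set (Fn T)) :
    ∃ (Z : Scheme.{0}) (i : Z ⟶ T.left), IsClosedImmersion i ∧ ∀ (T' : SchC) (u : T' ⟶ T),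
      (∀ f ∈ E, pull u f = 0) ↔ ∃ h : T'.left ⟶ Z, h ≫ i = u.left := by
  let mk : Γ(T.left, ⊤) →+* (Γ(T.left, ⊤) ⧸ Ideal.span E) := Ideal.Quotient.mk (Ideal.span E)
  let c := Spec.map (CommRingCat.ofHom mk)
  have hc : IsClosedImmersion c := IsClosedImmersion.spec_of_surjective _ Ideal.Quotient.mk_surjective
  refine ⟨Limits.pullback (toSpec (RingHom.id Γ(T.left, ⊤))) c, Limits.pullback.fst _ _,
    inferInstance, fun T' u => ⟨fun hu => ?_, ?_⟩⟩
  · have hker : ∀ f ∈ Ideal.span E, pull u f = 0 := fun f hf => by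
      have : Ideal.span E ≤ RingHom.ker (pull u) := Ideal.span_le.2 hu
      exact this hf
    refine ⟨Limits.pullback.lift u.left (toSpec (Ideal.Quotient.lift _ (pull u) hker)) ?_,
      Limits.pullback.lift_fst _ _ _⟩
    rw [comp_toSpec, toSpec_comp]
    rfl
  · rintro ⟨h, hh⟩ f hf
    have hw : u.left ≫ toSpec (RingHom.id Γ(T.left, ⊤)) = (h ≫ Limits.pullback.snd _ _) ≫ c := by
      rw [← hh, Category.assoc, Category.assoc, Limits.pullback.condition]
    obtain ⟨φ, hφ⟩ := (toSpec_bijective _ _).2 (h ≫ Limits.pullback.snd _ _)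
    rw [comp_toSpec, ← hφ, toSpec_comp] at hw
    have h1 := (toSpec_bijective _ _).1 hw
    have h2 : pull u f = φ (mk f) := congr($h1 f)
    rw [h2, Ideal.Quotient.eq_zero_iff_mem.2 (Ideal.subset_span hf), map_zero]

instance : Scheme.etaleTopology.{0}.Subcanonical :=
  .of_le Scheme.etaleTopology_le_proetaleTopology

/-- Morphisms to a fixed scheme satisfy étale descent. -/
theorem isSheaf_hom (Y : Scheme.{0}) :
    Presieve.IsSheaf etaleC ((Over.forget (Spec (CommRingCat.of ℂ))).op ⋙ yoneda.obj Y) :=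
  Functor.op_comp_isSheaf_of_isSheaf_type (K := Scheme.etaleTopology) _ _
    (GrothendieckTopology.Subcanonical.isSheaf_of_isRepresentable _)

/-- A diagonalizable group is an étale sheaf, since it is represented by the spectrum of a group
algebra. -/
theorem isSheaf_torus (B : Type) [AddCommGroup B] :
    Presieve.IsSheaf etaleC (torus B ⋙ forget GrpCat) := by
  let lift : ∀ T : SchC, (Multiplicative B →* (Fn T)ˣ) → (AddMonoidAlgebra ℤ B →+* Fn T) :=
    fun T k => (AddMonoidAlgebra.lift ℤ (Fn T) B ((Units.coeHom _).comp k)).toRingHom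
  have hlift : ∀ (T : SchC) (k : Multiplicative B →* (Fn T)ˣ) (b : B),
      lift T k (AddMonoidAlgebra.single b 1) = k (Multiplicative.ofAdd b) := fun T k b => by
    simp [lift]
  have hext : ∀ (T : SchC) (φ ψ : AddMonoidAlgebra ℤ B →+* Fn T),
      (∀ b, φ (AddMonoidAlgebra.single b 1) = ψ (AddMonoidAlgebra.single b 1)) → φ = ψ := by
    intro T φ ψ h
    refine AddMonoidAlgebra.ringHom_ext (fun n => ?_) h
    have h1 : (AddMonoidAlgebra.single 0 n : AddMonoidAlgebra ℤ B) = (n : AddMonoidAlgebra ℤ B) := by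
      rw [AddMonoidAlgebra.intCast_def]; rfl
    rw [h1, map_intCast, map_intCast]
  let η : torus B ⋙ forget GrpCat ⟶ (Over.forget (Spec (CommRingCat.of ℂ))).op ⋙
      yoneda.obj (Spec (CommRingCat.of (AddMonoidAlgebra ℤ B))) :=
    { app := fun T => TypeCat.ofHom fun k => toSpec (lift T.unop k)
      naturality := fun T T' u => by
        apply ConcreteCategory.hom_ext
        intro k
        refine Eq.trans ?_ (comp_toSpec u.unop.left (lift T.unop k)).symm
        refine congrArg toSpec (hext _ _ _ fun b => ?_)
        refine (hlift T'.unop _ b).trans ?_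
        exact congrArg (pull u.unop) (hlift T.unop k b).symm }
  have hbij : ∀ T, Function.Bijective (η.app T) := fun T => by
    refine (toSpec_bijective _ _).comp ⟨fun k k' h => ?_, fun φ => ?_⟩
    · refine MonoidHom.ext fun b => Units.ext ?_
      have := congr($h (AddMonoidAlgebra.single b.toAdd 1))
      exact (hlift T.unop k b.toAdd).symm.trans (this.trans (hlift T.unop k' b.toAdd))
    · refine ⟨MonoidHom.toHomUnits (φ.toMonoidHom.comp (AddMonoidAlgebra.of ℤ B)),
        hext T.unop _ _ fun b => ?_⟩
      exact hlift T.unop _ b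
  have : IsIso η := by
    rw [NatTrans.isIso_iff_isIso_app]
    intro T
    rw [CategoryTheory.isIso_iff_bijective]
    exact hbij T
  exact Presieve.isSheaf_iso _ (asIso η).symm (isSheaf_hom _)

end Functions

/-! ### Extending multiplicative families to homomorphisms -/

/-- A family of elements `y i` of an abelian group extends to a homomorphism from the group
generated by elements `b i` if it respects all relations between sums of the `b i`. -/
theorem exists_hom_of_relations {S B M : Type*} [Fintype S] [AddCommGroup B] [CommGroup M]
    (b : S → B) (hb : Submodule.span ℤ (Set.range b) = ⊤) (y : S → M)
    (h : ∀ u v : S → ℕ, ∑ i, u i • b i = ∑ i, v i • b i → ∏ i, y i ^ u i = ∏ i, y i ^ v i) :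
    ∃ φ : Multiplicative B →* M, ∀ i, φ (Multiplicative.ofAdd (b i)) = y i := by
  classical
  let f : Multiplicative (S → ℤ) →* Multiplicative B :=
    (Fintype.linearCombination ℤ b).toAddMonoidHom.toMultiplicative
  let g : Multiplicative (S → ℤ) →* M :=
    { toFun := fun n => ∏ i, y i ^ (n.toAdd i)
      map_one' := by simp
      map_mul' := fun m n => by simp [zpow_add, Finset.prod_mul_distrib] }
  have hf : Function.Surjective f := by
    have : Function.Surjective (Fintype.linearCombination ℤ b) := by
      rw [← LinearMap.range_eq_top, Fintype.range_linearCombination, hb]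
    exact this
  have hker : f.ker ≤ g.ker := by
    intro n hn
    have hn : ∑ i, n.toAdd i • b i = 0 := by
      have h1 : Fintype.linearCombination ℤ b n.toAdd = 0 := hn
      rwa [Fintype.linearCombination_apply] at h1
    rw [MonoidHom.mem_ker]
    -- separate the positive and negative parts of the exponents
    have hsplit : ∀ i, n.toAdd i = ((n.toAdd i).toNat : ℤ) - ((-n.toAdd i).toNat : ℤ) :=
      fun i => by omega
    have h2 := h (fun i => (n.toAdd i).toNat) (fun i => (-n.toAdd i).toNat) (by
      rw [← sub_eq_zero, ← Finset.sum_sub_distrib, ← hn]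
      refine Finset.sum_congr rfl fun i _ => ?_
      conv_rhs => rw [hsplit i, sub_smul, natCast_zsmul, natCast_zsmul])
    change ∏ i, y i ^ (n.toAdd i) = 1
    have h3 : ∀ i, y i ^ (n.toAdd i) = y i ^ (n.toAdd i).toNat / y i ^ (-n.toAdd i).toNat := by
      intro i
      conv_lhs => rw [hsplit i, zpow_sub, zpow_natCast, zpow_natCast, ← div_eq_mul_inv]
    simp only [h3, Finset.prod_div_distrib, h2, div_self']
  refine ⟨f.liftOfSurjective hf ⟨g, hker⟩, fun i => ?_⟩
  have h1 : Multiplicative.ofAdd (b i) = f (Multiplicative.ofAdd (Pi.single i 1)) := by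
    change _ = Multiplicative.ofAdd (Fintype.linearCombination ℤ b (Pi.single i 1))
    rw [Fintype.linearCombination_apply_single, one_smul]
  rw [h1, MonoidHom.liftOfRightInverse_comp_apply]
  change ∏ j, y j ^ ((Pi.single i 1 : S → ℤ) j) = y i
  rw [Finset.prod_eq_single i (fun j _ hj => by simp [hj]) (by simp)]
  simp

/-! ### Splitting a diagonalizable group along a one-parameter subgroup -/

section TorusSplitting

/-- The homomorphism of diagonalizable groups given by a homomorphism of character groups. -/
def torusMap {A B : Type} [AddCommGroup A] [AddCommGroup B] (f : A →+ B) : torus B ⟶ torus A where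
  app T := GrpCat.ofHom
    (X := Multiplicative B →* (Fn T.unop)ˣ) (Y := Multiplicative A →* (Fn T.unop)ˣ)
    { toFun := fun k => k.comp f.toMultiplicative
      map_one' := rfl
      map_mul' := fun _ _ => rfl }
  naturality _ _ _ := rfl

variable {A : Type} [AddCommGroup A] (ε : A →ₗ[ℤ] ℤ)

/-- The one-parameter subgroup of `Hom(A, 𝔾ₘ)` given by a linear form on `A`. -/
def cochar : Gm ⟶ torus A where
  app T := GrpCat.ofHom
    (X := (Fn T.unop)ˣ) (Y := Multiplicative A →* (Fn T.unop)ˣ)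
    { toFun := fun g =>
        { toFun := fun χ => g ^ ε χ.toAdd
          map_one' := by simp
          map_mul' := fun a b => by simp [zpow_add] }
      map_one' := by ext; simp
      map_mul' := fun a b => by ext; simp [mul_zpow] }
  naturality T T' u := by
    apply GrpCat.hom_ext
    apply MonoidHom.ext
    intro (g : (Fn T.unop)ˣ)
    refine MonoidHom.ext (M := Multiplicative A) (N := (Fn T'.unop)ˣ) fun χ => ?_
    exact (map_zpow (Units.map (pull u.unop).toMonoidHom) g _).symm

/-- The projection of `A` onto the kernel of a linear form along an element of value `1`. -/
def kerProj {χ₁ : A} (h : ε χ₁ = 1) : A →+ LinearMap.ker ε where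
  toFun χ := ⟨χ - ε χ • χ₁, by simp [h]⟩
  map_zero' := by simp
  map_add' a b := Subtype.ext (by
    simp only [map_add, add_smul, Submodule.coe_add]
    abel)

theorem kerProj_coe {χ₁ : A} (h : ε χ₁ = 1) (χ : LinearMap.ker ε) : kerProj ε h χ = χ := by
  refine Subtype.ext ?_
  simp [kerProj]

/-- A linear form with value `1` at `χ₁` splits the group `Hom(A, 𝔾ₘ)` as the product of a
one-parameter subgroup and the group whose characters are the kernel of the form. -/
def torusSplitting {χ₁ : A} (h : ε χ₁ = 1) : Splitting Gm (torus (LinearMap.ker ε)) (torus A) where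
  inl := cochar ε
  inr := torusMap (kerProj ε h)
  fst := torusChar χ₁
  snd := torusMap (LinearMap.ker ε).subtype.toAddMonoidHom
  fst_inl {T} (g : (Fn T)ˣ) := by
    change g ^ ε χ₁ = g
    rw [h, zpow_one]
  snd_inl {T} (g : (Fn T)ˣ) := by
    refine MonoidHom.ext (M := Multiplicative (LinearMap.ker ε)) (N := (Fn T)ˣ) fun χ => ?_
    change g ^ ε χ.toAdd.1 = 1
    rw [LinearMap.mem_ker.1 χ.toAdd.2, zpow_zero]
  fst_inr {T} (k : Multiplicative (LinearMap.ker ε) →* (Fn T)ˣ) := by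
    change k (Multiplicative.ofAdd (kerProj ε h χ₁)) = 1
    have : kerProj ε h χ₁ = 0 := Subtype.ext (by simp [kerProj, h])
    rw [this, ofAdd_zero, map_one]
  snd_inr {T} (k : Multiplicative (LinearMap.ker ε) →* (Fn T)ˣ) := by
    refine MonoidHom.ext (M := Multiplicative (LinearMap.ker ε)) (N := (Fn T)ˣ) fun χ => ?_
    change k (Multiplicative.ofAdd (kerProj ε h χ.toAdd.1)) = k χ
    rw [kerProj_coe]
    rfl
  eq_mul {T} (k : Multiplicative A →* (Fn T)ˣ) := by
    refine MonoidHom.ext (M := Multiplicative A) (N := (Fn T)ˣ) fun χ => ?_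
    change k (Multiplicative.ofAdd χ₁) ^ ε χ.toAdd *
      k (Multiplicative.ofAdd (χ.toAdd - ε χ.toAdd • χ₁)) = k χ
    rw [ofAdd_sub, ofAdd_zsmul, ← map_zpow, ← map_mul, mul_div_cancel]
    rfl
  comm {T} g k := by
    refine MonoidHom.ext (M := Multiplicative A) (N := (Fn T)ˣ) fun χ => ?_
    exact mul_comm (G := (Fn T)ˣ) _ _

end TorusSplitting

/-! ### Slices of linear actions -/

section LinSlice

theorem pull_const {T' T : SchC} (u : T' ⟶ T) (c : ℂ) : pull u (const T c) = const T' c := by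
  have h : T.hom.appTop ≫ u.left.appTop = T'.hom.appTop := by
    rw [← Scheme.Hom.comp_appTop, Over.w]
  have h' : ((Scheme.ΓSpecIso (CommRingCat.of ℂ)).inv ≫ T.hom.appTop) ≫ u.left.appTop =
      (Scheme.ΓSpecIso (CommRingCat.of ℂ)).inv ≫ T'.hom.appTop := by
    rw [Category.assoc, h]
  exact congr(CommRingCat.Hom.hom $h' c)

theorem isUnit_const (T : SchC) {c : ℂ} (hc : c ≠ 0) : IsUnit (const T c) :=
  (IsUnit.mk0 c hc).map (const T)

/-- Data for a slice of the action of `Hom(A, 𝔾ₘ)` on `ℂ^ι` through the point `z₀`: coordinates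
`emb k` of weights `a k` for a one-parameter subgroup `ε` that fixes `z₀`, such that the
characters of the non-zero coordinates of `z₀` generate the characters that are trivial on `ε`.
The condition `full_support` says that a point of `U_ω` whose coordinates vanish outside the slice
and the support of `z₀` cannot lie on the boundary of the orbit closure of `z₀`: a monomial in all
coordinates of `z₀` is equivalent to one that does not vanish at the point. -/
structure LinSlice {ι κ A : Type} [AddCommGroup A] (d : GITData A ι) (ε : A →ₗ[ℤ] ℤ)
    (a : κ → ℕ) where
  emb : κ → ι
  emb_injective : Function.Injective emb
  z₀ : ι → ℂ
  weight : ∀ k, ε (d.D (emb k)) = a k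
  weight_zero : ∀ i, z₀ i ≠ 0 → ε (d.D i) = 0
  z₀_emb : ∀ k, z₀ (emb k) = 0
  span_eq : Submodule.span ℤ (d.D '' {i | z₀ i ≠ 0}) = LinearMap.ker ε
  anticone : ∀ k, ∃ I ∈ d.anticones, ∀ i ∈ I, i = emb k ∨ z₀ i ≠ 0
  meets : ∀ I ∈ d.anticones, ∃ k, emb k ∈ I
  full_support [Fintype ι] : ∀ I ∈ d.anticones, (∀ i ∈ I, i ∈ Set.range emb ∨ z₀ i ≠ 0) →
    ∃ u v : ι → ℕ, (∀ i, u i ≠ 0 ↔ z₀ i ≠ 0) ∧ (∀ i, v i ≠ 0 → z₀ i ≠ 0 ∧ i ∈ I) ∧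
      ∑ i, u i • d.D i = ∑ i, v i • d.D i

namespace LinSlice

variable {ι κ A : Type} [AddCommGroup A] {d : GITData A ι} {ε : A →ₗ[ℤ] ℤ} {a : κ → ℕ}
  (S : LinSlice d ε a)

/-- The tuple with coordinates `w k` at `emb k` and `z₀ i` elsewhere. -/
def ext {T : SchC} (w : κ → Fn T) : ι → Fn T :=
  Function.extend S.emb w fun i => const T (S.z₀ i)

theorem ext_emb {T : SchC} (w : κ → Fn T) (k : κ) : S.ext w (S.emb k) = w k :=
  S.emb_injective.extend_apply _ _ _

theorem ext_of_notMem {T : SchC} (w : κ → Fn T) {i : ι} (h : i ∉ Set.range S.emb) :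
    S.ext w i = const T (S.z₀ i) :=
  Function.extend_apply' _ _ _ h

theorem notMem_range {i : ι} (h : S.z₀ i ≠ 0) : i ∉ Set.range S.emb := by
  rintro ⟨k, rfl⟩
  exact h (S.z₀_emb k)

/-- The map `w ↦ (w, z₀)` from `ℂ^κ \ {0}`. -/
def map : (weighted a).X ⟶ d.space.X where
  app T := TypeCat.ofHom fun w => ⟨S.ext w.1, fun t => by
    obtain ⟨I, ⟨k, hk⟩, hI⟩ := w.2 t
    obtain ⟨J, hJ, h⟩ := S.anticone k
    refine ⟨J, hJ, fun i hi => ?_⟩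
    rcases h i hi with rfl | hi
    · rw [ext_emb]
      exact hI k hk
    · rw [S.ext_of_notMem _ (S.notMem_range hi),
        Scheme.basicOpen_of_isUnit _ (isUnit_const T.unop hi)]
      trivial⟩
  naturality T T' u := by
    apply ConcreteCategory.hom_ext
    intro w
    refine Subtype.ext (funext fun i => ?_)
    change S.ext (fun k => pull u.unop (w.1 k)) i = pull u.unop (S.ext w.1 i)
    by_cases hi : i ∈ Set.range S.emb
    · obtain ⟨k, rfl⟩ := hi
      rw [ext_emb, ext_emb]
    · rw [S.ext_of_notMem _ hi, S.ext_of_notMem _ hi, pull_const]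

/-- The non-zero coordinates of the base point, as characters in the kernel of `ε`. -/
def kerChar (i : {i // S.z₀ i ≠ 0}) : LinearMap.ker ε := ⟨d.D i, S.weight_zero i i.2⟩

theorem span_kerChar : Submodule.span ℤ (Set.range S.kerChar) = ⊤ := by
  apply Submodule.map_injective_of_injective (LinearMap.ker ε).subtype_injective
  rw [Submodule.map_span, Submodule.map_top, Submodule.range_subtype]
  refine Eq.trans ?_ S.span_eq
  congr 1
  ext x
  constructor
  · rintro ⟨_, ⟨i, rfl⟩, rfl⟩
    exact ⟨i, i.2, rfl⟩
  · rintro ⟨i, hi, rfl⟩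
    exact ⟨_, ⟨⟨i, hi⟩, rfl⟩, rfl⟩

variable {χ₁ : A} (h₁ : ε χ₁ = 1)

theorem sweep_coord {T : SchC} (w : (weighted a).X.obj (op T))
    (k : Multiplicative (LinearMap.ker ε) →* (Fn T)ˣ) (i : ι) :
    (d.space.act (homVal (torusSplitting ε h₁).inr (T := T) k) (S.map.app (op T) w)).1 i =
      k (Multiplicative.ofAdd (kerProj ε h₁ (d.D i))) * S.ext w.1 i := rfl

theorem hom_ext_of_kerChar {M : Type*} [CommGroup M] {k k' : Multiplicative (LinearMap.ker ε) →* M}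
    (h : ∀ i, k (Multiplicative.ofAdd (S.kerChar i)) = k' (Multiplicative.ofAdd (S.kerChar i))) :
    k = k' := by
  have h2 : k.toAdditiveRight.toIntLinearMap = k'.toAdditiveRight.toIntLinearMap := by
    refine LinearMap.ext_on_range S.span_kerChar fun i => ?_
    exact congrArg Additive.ofMul (h i)
  refine MonoidHom.ext fun x => ?_
  exact congrArg Additive.toMul congr($h2 x.toAdd)

/-- The equivariant map `w ↦ (w, z₀)` is a slice for the action: `(w, h) ↦ h • (w, z₀)` is a
monomorphism. -/
def slice : (torusSplitting ε h₁).Slice (weighted a) d.space where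
  ε := S.map
  ε_act {T} (g : (Fn T)ˣ) w := by
    refine Subtype.ext (funext fun i => ?_)
    change S.ext (fun k => ((g ^ a k : (Fn T)ˣ) : Fn T) * w.1 k) i =
      ((g ^ ε (d.D i) : (Fn T)ˣ) : Fn T) * S.ext w.1 i
    by_cases hi : i ∈ Set.range S.emb
    · obtain ⟨k, rfl⟩ := hi
      rw [ext_emb, ext_emb, S.weight, zpow_natCast]
    · rw [S.ext_of_notMem _ hi, S.ext_of_notMem _ hi]
      by_cases h : S.z₀ i = 0
      · rw [h, map_zero, mul_zero]
      · rw [S.weight_zero i h, zpow_zero, Units.val_one, one_mul]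
  isSheaf := isSheaf_torus _
  mono {T} (k k' : Multiplicative (LinearMap.ker ε) →* (Fn T)ˣ) w w' h := by
    have h (i) : (k (Multiplicative.ofAdd (kerProj ε h₁ (d.D i))) : Fn T) * S.ext w.1 i =
        k' (Multiplicative.ofAdd (kerProj ε h₁ (d.D i))) * S.ext w'.1 i :=
      congr(($h).1 i)
    have hk : k = k' := S.hom_ext_of_kerChar fun i => Units.ext (by
      have := h i
      rw [S.ext_of_notMem _ (S.notMem_range i.2), S.ext_of_notMem _ (S.notMem_range i.2)] at this
      have h2 := (isUnit_const T i.2).mul_right_cancel this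
      have h3 : kerProj ε h₁ (d.D i) = S.kerChar i := kerProj_coe ε h₁ (S.kerChar i)
      rwa [h3] at h2)
    refine ⟨hk, Subtype.ext (funext fun j => ?_)⟩
    have := h (S.emb j)
    rw [← hk, ext_emb, ext_emb] at this
    exact (Units.isUnit _).mul_left_cancel this

/-- The equations of the orbit of the slice: the coordinates outside the slice and the support of
`z₀` vanish, and those in the support satisfy the binomial equations of `z₀`. -/
structure IsOnOrbit [Fintype ι] {T : SchC} (z : ι → Fn T) : Prop where
  eq_zero : ∀ i, i ∉ Set.range S.emb → S.z₀ i = 0 → z i = 0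
  binomial : ∀ u v : ι → ℕ, (∀ i, S.z₀ i = 0 → u i = 0 ∧ v i = 0) →
    ∑ i, u i • d.D i = ∑ i, v i • d.D i →
    (∏ i, z i ^ u i) * const T (∏ i, S.z₀ i ^ v i) = (∏ i, z i ^ v i) * const T (∏ i, S.z₀ i ^ u i)

theorem isOnOrbit_sweep [Fintype ι] {T : SchC} (w : (weighted a).X.obj (op T))
    (k : (torus (LinearMap.ker ε)).obj (op T)) : S.IsOnOrbit ((S.slice h₁).sweep w k).1 := by
  let k' : Multiplicative (LinearMap.ker ε) →* (Fn T)ˣ := k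
  have hc : ∀ i, ((S.slice h₁).sweep w k).1 i =
    k' (Multiplicative.ofAdd (kerProj ε h₁ (d.D i))) * S.ext w.1 i := S.sweep_coord h₁ w k
  refine ⟨fun i hi h => ?_, fun u v huv h => ?_⟩
  · rw [hc, S.ext_of_notMem _ hi, h, map_zero, mul_zero]
  · have hprod : ∀ u : ι → ℕ, (∀ i, S.z₀ i = 0 → u i = 0) →
        ∏ i, ((S.slice h₁).sweep w k).1 i ^ u i =
          k' (Multiplicative.ofAdd (kerProj ε h₁ (∑ i, u i • d.D i))) *
            const T (∏ i, S.z₀ i ^ u i) := by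
      intro u hu
      rw [map_prod, map_sum, ofAdd_sum, map_prod, Units.coe_prod, ← Finset.prod_mul_distrib]
      refine Finset.prod_congr rfl fun i _ => ?_
      rw [hc, mul_pow, map_nsmul, ofAdd_nsmul, map_pow, Units.val_pow_eq_pow_val, map_pow]
      by_cases hi : S.z₀ i = 0
      · rw [hu i hi, pow_zero, pow_zero, pow_zero]
      · rw [S.ext_of_notMem _ (S.notMem_range hi)]
    rw [hprod u fun i hi => (huv i hi).1, hprod v fun i hi => (huv i hi).2, h]
    ring

/-- At a point of `U_ω` that satisfies the equations of the orbit, no coordinate in the support of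
`z₀` vanishes. -/
theorem isUnit_of_isOnOrbit [Fintype ι] {T : SchC} (z : d.space.X.obj (op T))
    (hz : S.IsOnOrbit z.1) {i : ι} (hi : S.z₀ i ≠ 0) : IsUnit (z.1 i) := by
  refine isUnit_of_forall_mem_basicOpen _ fun t => ?_
  obtain ⟨I, hI, hIt⟩ := z.2 t
  have hsub : ∀ i ∈ I, i ∈ Set.range S.emb ∨ S.z₀ i ≠ 0 := by
    intro i hi
    by_contra! h
    have := hIt i hi
    rw [hz.eq_zero i h.1 h.2, Scheme.basicOpen_zero] at this
    exact this
  obtain ⟨u, v, hu, hv, huv⟩ := S.full_support I hI hsub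
  have hc : ∀ w : ι → ℕ, (∀ i, w i ≠ 0 → S.z₀ i ≠ 0) →
      T.left.basicOpen (const T (∏ i, S.z₀ i ^ w i)) = ⊤ := fun w hw =>
    Scheme.basicOpen_of_isUnit _ (by
      rw [map_prod]
      simp only [map_pow]
      exact isUnit_prod_pow fun i hi => isUnit_const T (hw i hi))
  have h := congrArg (fun f : Fn T => t ∈ T.left.basicOpen f) (hz.binomial u v (fun i hi =>
    ⟨by_contra fun h => (hu i).1 h hi, by_contra fun h => (hv i h).1 hi⟩) huv)
  simp only [Scheme.basicOpen_mul, hc u fun i => (hu i).1, hc v fun i h => (hv i h).1,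
    inf_top_eq, mem_basicOpen_prod_pow, eq_iff_iff] at h
  exact h.2 (fun i hi => hIt i (hv i hi).2) i ((hu i).2 hi)

/-- A point of `U_ω` that satisfies the equations of the orbit is in the orbit of the slice. -/
theorem exists_sweep_eq [Fintype ι] {T : SchC} (z : d.space.X.obj (op T))
    (hz : S.IsOnOrbit z.1) : ∃ w k, (S.slice h₁).sweep w k = z := by
  classical
  have hunit : ∀ i, S.z₀ i ≠ 0 → IsUnit (z.1 i) := fun i hi => S.isUnit_of_isOnOrbit z hz hi
  let y : {i // S.z₀ i ≠ 0} → (Fn T)ˣ := fun i => (hunit i i.2).unit / (isUnit_const T i.2).unit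
  have hy : ∀ i : {i // S.z₀ i ≠ 0}, (y i : Fn T) * const T (S.z₀ i) = z.1 i := fun i => by
    have : y i * (isUnit_const T i.2).unit = (hunit i i.2).unit := div_mul_cancel _ _
    exact congrArg Units.val this
  obtain ⟨k, hk⟩ := exists_hom_of_relations S.kerChar S.span_kerChar y (fun u v huv => by
    let ex : ({i // S.z₀ i ≠ 0} → ℕ) → ι → ℕ := fun u i => if h : S.z₀ i ≠ 0 then u ⟨i, h⟩ else 0
    have hex : ∀ u i, S.z₀ i = 0 → ex u i = 0 := fun u i hi => dif_neg (not_not.2 hi)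
    have hex' : ∀ u (i : {i // S.z₀ i ≠ 0}), ex u i = u i := fun u i => dif_pos i.2
    have hprod : ∀ {M : Type} [CommMonoid M] (x : ι → M) u,
        ∏ i, x i ^ ex u i = ∏ i : {i // S.z₀ i ≠ 0}, x i ^ u i := fun x u => by
      rw [← Finset.prod_filter_of_ne (p := fun i => S.z₀ i ≠ 0) (fun i _ h hi => h (by
        rw [hex u i hi, pow_zero]))]
      refine (Finset.prod_subtype (F := inferInstance) (p := fun i => S.z₀ i ≠ 0) _ (by simp) _).trans ?_
      simp only [hex']
    have hsum : ∀ u, ∑ i, ex u i • d.D i = ((∑ i, u i • S.kerChar i : LinearMap.ker ε) : A) := by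
      intro u
      rw [← Finset.sum_filter_of_ne (p := fun i => S.z₀ i ≠ 0) (fun i _ h hi => h (by
        rw [hex u i hi, zero_smul])), AddSubmonoidClass.coe_finsetSum]
      refine (Finset.sum_subtype (F := inferInstance) (p := fun i => S.z₀ i ≠ 0) _ (by simp) _).trans ?_
      simp only [hex', kerChar]
      rfl
    have := hz.binomial (ex u) (ex v) (fun i hi => ⟨hex u i hi, hex v i hi⟩) (by
      rw [hsum, hsum, huv])
    rw [hprod, hprod, hprod, hprod] at this
    simp only [← hy, mul_pow, Finset.prod_mul_distrib] at this
    simp only [← map_pow, ← map_prod] at this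
    rw [mul_assoc, mul_assoc, mul_comm (const T (∏ i : {i // S.z₀ i ≠ 0}, S.z₀ i ^ v i))] at this
    refine Units.ext ?_
    rw [Units.coe_prod, Units.coe_prod]
    simp only [Units.val_pow_eq_pow_val]
    refine IsUnit.mul_right_cancel (IsUnit.mul ?_ ?_) this <;>
    exact isUnit_const T (Finset.prod_ne_zero_iff.2 fun i _ => pow_ne_zero _ i.2))
  let c : κ → (Fn T)ˣ := fun j => k (Multiplicative.ofAdd (kerProj ε h₁ (d.D (S.emb j))))
  refine ⟨⟨fun j => (c j)⁻¹ * z.1 (S.emb j), fun t => ?_⟩, k, Subtype.ext (funext fun i => ?_)⟩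
  · obtain ⟨I, hI, hIt⟩ := z.2 t
    obtain ⟨j, hj⟩ := S.meets I hI
    refine ⟨{j}, Finset.singleton_nonempty j, fun i hi => ?_⟩
    rw [Finset.mem_singleton.1 hi, Scheme.basicOpen_mul, Scheme.basicOpen_of_isUnit _ (Units.isUnit _)]
    exact ⟨trivial, hIt _ hj⟩
  · refine (S.sweep_coord h₁ _ k i).trans ?_
    by_cases hi : i ∈ Set.range S.emb
    · obtain ⟨j, rfl⟩ := hi
      rw [ext_emb]
      exact Units.mul_inv_cancel_left (c j) _
    · rw [S.ext_of_notMem _ hi]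
      by_cases h : S.z₀ i = 0
      · rw [h, map_zero, mul_zero, hz.eq_zero i hi h]
      · have h3 : kerProj ε h₁ (d.D i) = S.kerChar ⟨i, h⟩ := kerProj_coe ε h₁ (S.kerChar ⟨i, h⟩)
        rw [h3, hk]
        exact hy ⟨i, h⟩

theorem exists_sweep_eq_iff [Fintype ι] {T : SchC} (z : d.space.X.obj (op T)) :
    (∃ w k, (S.slice h₁).sweep w k = z) ↔ S.IsOnOrbit z.1 := by
  constructor
  · rintro ⟨w, k, rfl⟩
    exact S.isOnOrbit_sweep h₁ w k
  · exact S.exists_sweep_eq h₁ z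

/-- The orbit of the slice is a stable closed subspace. -/
theorem isStableClosed [Fintype ι] {χ₁ : A} (h₁ : ε χ₁ = 1) :
    IsStableClosed d.space fun _ => {z | S.IsOnOrbit z.1} where
  stable T g z hz := by
    obtain ⟨w, k, rfl⟩ := S.exists_sweep_eq h₁ z hz
    have := (S.slice h₁).sweep_act g w k
    exact (congrArg (fun z : d.space.X.obj (op T) => S.IsOnOrbit z.1) this).mp
      (S.isOnOrbit_sweep h₁ _ _)
  closed T z := by
    obtain ⟨Z, i, hi, h⟩ := exists_vanishing_locus (T := T)
      ({f | ∃ i, i ∉ Set.range S.emb ∧ S.z₀ i = 0 ∧ f = z.1 i} ∪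
        {f | ∃ u v : ι → ℕ, (∀ i, S.z₀ i = 0 → u i = 0 ∧ v i = 0) ∧
          ∑ i, u i • d.D i = ∑ i, v i • d.D i ∧
          f = (∏ i, z.1 i ^ u i) * const T (∏ i, S.z₀ i ^ v i) -
            (∏ i, z.1 i ^ v i) * const T (∏ i, S.z₀ i ^ u i)})
    refine ⟨Z, i, hi, fun T' p => Iff.trans ?_ (h T' p)⟩
    have hz : ∀ i, (d.space.X.map p.op z).1 i = pull p (z.1 i) := fun i => rfl
    constructor
    · rintro hT f (⟨i, hi, h, rfl⟩ | ⟨u, v, huv, h, rfl⟩)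
      · exact hT.eq_zero i hi h
      · have := hT.binomial u v huv h
        simp only [hz] at this
        simp only [map_sub, map_mul, map_prod, map_pow, pull_const] at this ⊢
        rw [this, sub_self]
    · intro hE
      refine ⟨fun i hi h => hE _ (Or.inl ⟨i, hi, h, rfl⟩), fun u v huv h => ?_⟩
      have := hE _ (Or.inr ⟨u, v, huv, h, rfl⟩)
      simp only [hz]
      simp only [map_sub, map_mul, map_prod, map_pow, pull_const] at this ⊢
      exact sub_eq_zero.1 this

theorem isClosedImmersionOnto [Fintype ι] :
    (S.slice h₁).stackHom.IsClosedImmersionOnto fun _ => {z | S.IsOnOrbit z.1} :=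
  (S.slice h₁).isClosedImmersionOnto (S.isStableClosed h₁) fun _ z =>
    (S.exists_sweep_eq_iff h₁ z).symm

end LinSlice

end LinSlice

/-! ### Morphisms to `Proj` -/

section MapProj

variable {σ : Type*} {A : Type} [CommRing A] [SetLike σ A] [AddSubgroupClass σ A]
  (𝒜 : ℕ → σ) [GradedRing 𝒜] {X : Scheme.{0}} (f : A →+* Γ(X, ⊤))
  (hf : TopologicalSpace.IsOpenCover (fun s : Σ' (n : ℕ) (r : A), 0 < n ∧ r ∈ 𝒜 n =>
    X.basicOpen (f s.2.1)))

/-- The morphism from `D(x)` to the spectrum of the localization of the global functions at `x`. -/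
def toSpecAway (x : Γ(X, ⊤)) :
    (X.basicOpen x).toScheme ⟶ Spec (CommRingCat.of (Localization.Away x)) :=
  (X.isoOfEq (X.toSpecΓ_preimage_basicOpen x)).inv ≫ X.toSpecΓ ∣_ _ ≫
    (basicOpenIsoSpecAway x).hom

theorem toSpecAway_comp (x : Γ(X, ⊤)) :
    toSpecAway x ≫ Spec.map (CommRingCat.ofHom (algebraMap Γ(X, ⊤) (Localization.Away x))) =
      (X.basicOpen x).ι ≫ X.toSpecΓ := by
  rw [toSpecAway, Category.assoc, Category.assoc]
  refine (congrArg (fun q => _ ≫ _ ≫ q)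
    (basicOpenIsoSpecAway_hom_SpecMap (R := Γ(X, ⊤)) x)).trans ?_
  refine (congrArg (fun q => (X.isoOfEq (X.toSpecΓ_preimage_basicOpen x)).inv ≫ q)
    (morphismRestrict_ι X.toSpecΓ _)).trans ?_
  exact Scheme.isoOfEq_inv_ι_assoc _ _ _

/-- A morphism to `X` along which `f t` becomes invertible maps to the chart `D₊(t)`, by the
ring homomorphism `b / t ^ k ↦ f b / f t ^ k`. -/
theorem comp_mapProj {Y : Scheme.{0}}
   (u : Y ⟶ X) {t : A} {d : ℕ} (h0d : 0 < d) (hd : t ∈ 𝒜 d) (ht : IsUnit (u.appTop (f t))) :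
   ∃ ψ : HomogeneousLocalization.Away 𝒜 t →+* Γ(Y, ⊤),
     (∀ k b hb, ψ (HomogeneousLocalization.Away.mk 𝒜 hd k b hb) * u.appTop (f t) ^ k = u.appTop (f b)) ∧
     u ≫ mapProj 𝒜 f hf = toSpec ψ ≫ Proj.awayι 𝒜 t hd h0d := by
  have hr : Set.range u ⊆ Set.range (X.basicOpen (f t)).ι := by
    rw [Scheme.Opens.range_ι]
    rintro _ ⟨y, rfl⟩
    have h := Scheme.preimage_basicOpen_top u (f t)
    rw [Scheme.basicOpen_of_isUnit _ ht] at h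
    have : y ∈ u ⁻¹ᵁ X.basicOpen (f t) := h ▸ trivial
    exact this
  obtain ⟨v, hv⟩ : ∃ v : Y ⟶ (X.basicOpen (f t)).toScheme, v ≫ (X.basicOpen (f t)).ι = u :=
    ⟨IsOpenImmersion.lift _ u hr, IsOpenImmersion.lift_fac _ _ _⟩
  have hmap : (X.basicOpen (f t)).ι ≫ mapProj 𝒜 f hf =
      Proj.toBasicOpenOfGlobalSections 𝒜 f rfl h0d hd ≫ (Proj.basicOpen 𝒜 t).ι :=
    Scheme.Cover.ι_glueMorphisms (X.openCoverOfIsOpenCover _ hf) _ _ ⟨d, t, h0d, hd⟩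
  let ρ : Localization.Away t →+* Localization.Away (f t) :=
    IsLocalization.map (M := .powers t) (T := .powers (f t)) _ f (by
      rw [← Submonoid.map_le_iff_le_comap, Submonoid.map_powers])
  have hdef : Proj.toBasicOpenOfGlobalSections 𝒜 f rfl h0d hd ≫ (Proj.basicOpen 𝒜 t).ι =
      toSpecAway (f t) ≫ Spec.map (CommRingCat.ofHom (ρ.comp (algebraMap _ (Localization.Away t)))) ≫
        Proj.awayι 𝒜 t hd h0d := by
    simp only [toSpecAway, Category.assoc]
    rfl
  obtain ⟨φ, hφ⟩ := (toSpec_bijective _ _).2 (v ≫ toSpecAway (f t))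
  have hφ' : φ.comp (algebraMap Γ(X, ⊤) (Localization.Away (f t))) = u.appTop.hom := by
    apply (toSpec_bijective _ _).1
    rw [← toSpec_comp, hφ, Category.assoc]
    rw [toSpecAway_comp, reassoc_of% hv]
    exact Scheme.toSpecΓ_naturality u
  refine ⟨φ.comp (ρ.comp (algebraMap _ _)), fun k b hb => ?_, ?_⟩
  · have h2 : ∀ b : A, u.appTop (f b) = φ (ρ (algebraMap A _ b)) := fun b => by
      rw [IsLocalization.map_eq]
      exact congr($hφ' (f b)).symm
    rw [h2, h2, ← map_pow, ← map_pow, ← map_pow]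
    simp only [RingHom.comp_apply]
    rw [← map_mul, ← map_mul]
    congr 2
    rw [HomogeneousLocalization.algebraMap_apply, HomogeneousLocalization.Away.val_mk,
      Localization.mk_eq_mk']
    exact IsLocalization.mk'_spec _ b (⟨t ^ k, k, rfl⟩ : Submonoid.powers t)
  · rw [← hv, Category.assoc, hmap, hdef, ← toSpec_comp, hφ, Category.assoc, Category.assoc]

theorem isUnit_appTop_basicOpen_ι (x : Γ(X, ⊤)) : IsUnit ((X.basicOpen x).ι.appTop x) := by
  refine isUnit_of_forall_mem_basicOpen _ fun t => ?_
  rw [← Scheme.preimage_basicOpen_top]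
  exact t.2

/-- Two solutions of the equations `x F ^ k = B` and `y F' ^ k = B'` agree if `F'` and `B'` are the
twists of `F` and `B` by the same unit, to powers given by their degrees. -/
theorem ratio_eq {R : Type*} [CommRing R] {c F F' B B' x y : R} {k d : ℕ} (hc : IsUnit c)
    (hF : IsUnit F) (hx : x * F ^ k = B) (hy : y * F' ^ k = B') (hB : B' = c ^ (k • d) * B)
    (hF' : F' = c ^ d * F) : x = y := by
  refine ((hc.pow (k • d)).mul (hF.pow k)).mul_right_cancel ?_
  rw [hB, hF', ← hx, smul_eq_mul, mul_comm k d, pow_mul, mul_pow] at hy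
  rw [smul_eq_mul, mul_comm k d, pow_mul, hy]
  ring

variable {f hf} in
/-- The morphism to `Proj` depends only on the ratios of functions of the same degree. -/
theorem comp_mapProj_eq {Y : Scheme.{0}} (u : Y ⟶ X) {f' : A →+* Γ(Y, ⊤)}
    {hf' : TopologicalSpace.IsOpenCover (fun s : Σ' (n : ℕ) (r : A), 0 < n ∧ r ∈ 𝒜 n =>
      Y.basicOpen (f' s.2.1))} (c : Γ(Y, ⊤)ˣ)
    (h : ∀ n, ∀ a ∈ 𝒜 n, f' a = c ^ n * u.appTop (f a)) :
    u ≫ mapProj 𝒜 f hf = mapProj 𝒜 f' hf' := by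
  refine (Y.openCoverOfIsOpenCover _ hf').hom_ext _ _ fun x => ?_
  obtain ⟨d, t, h0d, hd⟩ := x
  let i : (Y.basicOpen (f' t)).toScheme ⟶ Y := (Y.basicOpen (f' t)).ι
  change i ≫ u ≫ _ = i ≫ _
  have hit : IsUnit (i.appTop (f' t)) := isUnit_appTop_basicOpen_ι _
  have hu : ∀ n, ∀ a ∈ 𝒜 n, i.appTop (f' a) = i.appTop c ^ n * (i ≫ u).appTop (f a) := by
    intro n a ha
    rw [h n a ha, map_mul, map_pow, Scheme.Hom.comp_appTop]
    rfl
  have hit' : IsUnit ((i ≫ u).appTop (f t)) := by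
    rw [hu d t hd] at hit
    exact isUnit_of_mul_isUnit_right hit
  obtain ⟨ψ, hψ, h1⟩ := comp_mapProj 𝒜 f hf (i ≫ u) h0d hd hit'
  obtain ⟨ψ', hψ', h2⟩ := comp_mapProj 𝒜 f' hf' i h0d hd hit
  have hψψ' : ψ = ψ' := by
    refine RingHom.ext fun x => ?_
    obtain ⟨k, b, hb, rfl⟩ := HomogeneousLocalization.Away.mk_surjective 𝒜 hd x
    exact ratio_eq (c.isUnit.map i.appTop.hom) hit' (hψ k b hb) (hψ' k b hb) (hu _ b hb)
      (hu d t hd)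
  rw [← Category.assoc, h1, h2, hψψ']

/-- The preimage of the chart `D₊(t)` is the open set where `f t` does not vanish. -/
theorem mem_mapProj_basicOpen {t : A} {d : ℕ} (h0d : 0 < d) (hd : t ∈ 𝒜 d) (p : X) :
    mapProj 𝒜 f hf p ∈ Proj.basicOpen 𝒜 t ↔ p ∈ X.basicOpen (f t) := by
  obtain ⟨⟨d', s, h0d', hd'⟩, hs⟩ := hf.exists_mem p
  let i : (X.basicOpen (f s)).toScheme ⟶ X := (X.basicOpen (f s)).ι
  obtain ⟨q, rfl⟩ : ∃ q, i q = p := ⟨⟨p, hs⟩, rfl⟩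
  have hit : IsUnit (i.appTop (f s)) := isUnit_appTop_basicOpen_ι _
  obtain ⟨ψ, hψ, h1⟩ := comp_mapProj 𝒜 f hf i h0d' hd' hit
  have h2 : mapProj 𝒜 f hf (i q) = Proj.awayι 𝒜 s hd' h0d' (toSpec ψ q) := by
    rw [← Scheme.Hom.comp_apply, h1, Scheme.Hom.comp_apply]
  have h3 : i q ∈ X.basicOpen (f t) ↔ q ∈ Scheme.basicOpen _ (i.appTop (f t)) := by
    rw [← Scheme.preimage_basicOpen_top]
    rfl
  have h4 : toSpec ψ q ∈ Proj.awayι 𝒜 s hd' h0d' ⁻¹ᵁ Proj.basicOpen 𝒜 t ↔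
      q ∈ Scheme.basicOpen _ (ψ (HomogeneousLocalization.Away.isLocalizationElem hd' hd)) := by
    rw [Proj.awayι_preimage_basicOpen 𝒜 hd' h0d' hd h0d]
    exact iff_of_eq (congrArg (q ∈ ·) (Scheme.toSpecΓ_preimage_basicOpen _ _))
  rw [h2, h3]
  refine h4.trans ?_
  have h5 : ψ (HomogeneousLocalization.Away.isLocalizationElem hd' hd) * i.appTop (f s) ^ d =
      i.appTop (f t) ^ d' := by
    rw [hψ d (t ^ d') _, map_pow, map_pow]
  rw [← Scheme.basicOpen_pow _ (i.appTop (f t)) h0d', ← h5, Scheme.basicOpen_mul,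
    Scheme.basicOpen_of_isUnit _ (hit.pow d), inf_top_eq]

variable {f hf} in
theorem isUnit_of_mapProj_eq {f' : A →+* Γ(X, ⊤)}
    {hf' : TopologicalSpace.IsOpenCover (fun s : Σ' (n : ℕ) (r : A), 0 < n ∧ r ∈ 𝒜 n =>
      X.basicOpen (f' s.2.1))} (h : mapProj 𝒜 f hf = mapProj 𝒜 f' hf')
    {t : A} {d : ℕ} (h0d : 0 < d) (hd : t ∈ 𝒜 d) (ht : IsUnit (f t)) : IsUnit (f' t) := by
  refine isUnit_of_forall_mem_basicOpen _ fun p => ?_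
  rw [← mem_mapProj_basicOpen 𝒜 f' hf' h0d hd, ← h, mem_mapProj_basicOpen 𝒜 f hf h0d hd,
    Scheme.basicOpen_of_isUnit _ ht]
  trivial

variable {f hf} in
/-- Homomorphisms that define the same morphism to `Proj` have the same ratios of functions of the
same degree. -/
theorem mul_pow_eq_of_mapProj_eq {f' : A →+* Γ(X, ⊤)}
    {hf' : TopologicalSpace.IsOpenCover (fun s : Σ' (n : ℕ) (r : A), 0 < n ∧ r ∈ 𝒜 n =>
      X.basicOpen (f' s.2.1))} (h : mapProj 𝒜 f hf = mapProj 𝒜 f' hf')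
    {t b : A} {d k : ℕ} (h0d : 0 < d) (hd : t ∈ 𝒜 d) (ht : IsUnit (f t)) (hb : b ∈ 𝒜 (k • d)) :
    f b * f' t ^ k = f' b * f t ^ k := by
  have ht' : IsUnit (f' t) := isUnit_of_mapProj_eq 𝒜 h h0d hd ht
  obtain ⟨ψ, hψ, h1⟩ := comp_mapProj 𝒜 f hf (𝟙 X) h0d hd (by simpa using ht)
  obtain ⟨ψ', hψ', h2⟩ := comp_mapProj 𝒜 f' hf' (𝟙 X) h0d hd (by simpa using ht')
  rw [h, h2, cancel_mono] at h1
  obtain rfl := (toSpec_bijective _ _).1 h1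
  have h3 := hψ k b hb
  have h4 := hψ' k b hb
  simp only [Scheme.Hom.id_appTop, CommRingCat.id_apply] at h3 h4
  rw [← h3, ← h4]
  ring

end MapProj

/-! ### Semi-invariants and the quotient map -/

section SemiInvariants

variable {L : Type} [AddCommGroup L] {ι : Type} [Fintype ι] (D : ι → Module.Dual ℤ L)
  (χ : Module.Dual ℤ L)

/-- The semi-invariant monomial `z ^ v` of weight `n χ`. -/
def monomial {n : ℕ} {v : ι → ℕ} (h : ∑ i, v i • D i = n • χ) : SemiInvRing D χ :=
  AddMonoidAlgebra.single ⟨(n, v), h⟩ 1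

theorem monomial_mem {n : ℕ} {v : ι → ℕ} (h : ∑ i, v i • D i = n • χ) :
    monomial D χ h ∈ semiInvGrading D χ n := by
  intro m hm
  have := Finsupp.support_single_subset hm
  rw [Finset.mem_singleton.1 this]
  rfl

theorem eval_single {T : SchC} (z : ι → Fn T) (x : semiInv D χ) (c : ℂ) :
    evalSemiInv D χ z (AddMonoidAlgebra.single x c) = const T c * ∏ i, z i ^ x.1.2 i :=
  AddMonoidAlgebra.liftNCRingHom_single _ _ _ _ _

theorem eval_monomial {T : SchC} (z : ι → Fn T) {n : ℕ} {v : ι → ℕ}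
    (h : ∑ i, v i • D i = n • χ) : evalSemiInv D χ z (monomial D χ h) = ∏ i, z i ^ v i := by
  rw [monomial, eval_single, map_one, one_mul]

/-- An identity between the values of semi-invariants of the same degree holds if it holds for
monomials. -/
theorem eval_eq_of_monomials {T' T : SchC} (u : T' ⟶ T) {z : ι → Fn T} {z' : ι → Fn T'}
    (c : Fn T') (h : ∀ (n : ℕ) (v : ι → ℕ), ∑ i, v i • D i = n • χ →
      ∏ i, z' i ^ v i = c ^ n * pull u (∏ i, z i ^ v i))
    (n : ℕ) {a : SemiInvRing D χ} (ha : a ∈ semiInvGrading D χ n) :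
    evalSemiInv D χ z' a = c ^ n * pull u (evalSemiInv D χ z a) := by
  rw [← AddMonoidAlgebra.sum_coeff_single a, Finsupp.sum, map_sum, map_sum, map_sum,
    Finset.mul_sum]
  refine Finset.sum_congr rfl fun x hx => ?_
  have hn : x.1.1 = n := ha x hx
  rw [eval_single, eval_single, map_mul, pull_const, h x.1.1 x.1.2 x.2, hn]
  ring

variable {D χ}

/-- The quotient map is compatible with pullback and depends only on the semi-invariant monomials,
up to a common twist by a unit. -/
theorem comp_gitMap {T' T : SchC} (u : T' ⟶ T) {z : ι → Fn T} {z' : ι → Fn T'}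
    (hz : IsSemistable D χ z) (hz' : IsSemistable D χ z') (c : (Fn T')ˣ)
    (h : ∀ (n : ℕ) (v : ι → ℕ), ∑ i, v i • D i = n • χ →
      ∏ i, z' i ^ v i = c ^ n * pull u (∏ i, z i ^ v i)) :
    u.left ≫ gitMap D χ z hz = gitMap D χ z' hz' :=
  comp_mapProj_eq (semiInvGrading D χ) u.left c fun n _ ha =>
    eval_eq_of_monomials D χ u c h n ha

theorem gitMap_congr {T : SchC} {z z' : ι → Fn T}
    (hz : IsSemistable D χ z) (hz' : IsSemistable D χ z') (c : (Fn T)ˣ)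
    (h : ∀ (n : ℕ) (v : ι → ℕ), ∑ i, v i • D i = n • χ →
      ∏ i, z' i ^ v i = c ^ n * ∏ i, z i ^ v i) :
    gitMap D χ z hz = gitMap D χ z' hz' := by
  rw [← comp_gitMap (𝟙 T) hz hz' c fun n v hv => by rw [pull_id, h n v hv]]
  exact (Category.id_comp _).symm

theorem isSemistable_of_monomials {T : SchC} {z : ι → Fn T}
    (h : ∀ t : T.left, ∃ (n : ℕ) (v : ι → ℕ), 0 < n ∧ ∑ i, v i • D i = n • χ ∧
      t ∈ T.left.basicOpen (∏ i, z i ^ v i)) : IsSemistable D χ z := by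
  refine TopologicalSpace.IsOpenCover.mk (eq_top_iff.2 fun t _ => ?_)
  obtain ⟨n, v, hn, hv, ht⟩ := h t
  rw [TopologicalSpace.Opens.mem_iSup]
  refine ⟨⟨n, monomial D χ hv, hn, monomial_mem D χ hv⟩, ?_⟩
  rwa [eval_monomial]

/-- A lattice point in the cone of non-negative combinations of characters has a multiple that is
a combination with natural coefficients. -/
theorem exists_nat_combination_of_mem_nonnegCone (ω₀ : Module.Dual ℤ L) {K : Finset ι}
    (h : (1 : ℝ) ⊗ₜ[ℤ] ω₀ ∈ nonnegCone (realChar D) K) :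
    ∃ (n : ℕ) (v : ι → ℕ), 0 < n ∧ (∀ i, v i ≠ 0 → i ∈ K) ∧ ∑ i, v i • D i = n • ω₀ := by
  obtain ⟨J, hJK, -, hJ⟩ := exists_linearIndepOn_of_mem_nonnegCone _ K h
  obtain ⟨n, v, hn, -, hv, hsum⟩ := exists_nat_combination D ω₀ hJ
  refine ⟨n, v, hn, fun i hi => hJK (by_contra fun h => hi (hv i h)), ?_⟩
  rw [← hsum]
  exact (Finset.sum_subset (Finset.subset_univ J) fun i _ hi => by rw [hv i hi, zero_smul]).symm

end SemiInvariants

/-! ### The blow-down map -/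

section BlowDown

variable {L : Type} [AddCommGroup L] {ι : Type} [Fintype ι] {D : ι → Module.Dual ℤ L}
  {χ : Module.Dual ℤ L} {ω : ℝ ⊗[ℤ] Module.Dual ℤ L}

/-- The quotient map is invariant: the torus scales a semi-invariant of weight `n χ` by the `n`-th
power of the value of `χ`. -/
theorem gitMap_act {T : SchC} (k : (torus (Module.Dual ℤ L)).obj (op T))
    (z : (GITData.mk D ω).space.X.obj (op T)) (hz : IsSemistable D χ z.1)
    (hz' : IsSemistable D χ ((GITData.mk D ω).space.act k z).1) :
    gitMap D χ z.1 hz = gitMap D χ ((GITData.mk D ω).space.act k z).1 hz' := by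
  let k' : Multiplicative (Module.Dual ℤ L) →* (Fn T)ˣ := k
  refine gitMap_congr hz hz' (k' (Multiplicative.ofAdd χ)) fun n v hv => ?_
  have h1 : ∀ i, ((GITData.mk D ω).space.act k z).1 i =
    k' (Multiplicative.ofAdd (D i)) * z.1 i := fun i => rfl
  simp only [h1, mul_pow, Finset.prod_mul_distrib]
  congr 1
  have h2 := congrArg (fun y => ((k' (Multiplicative.ofAdd y) : (Fn T)ˣ) : Fn T)) hv
  simpa only [ofAdd_sum, ofAdd_nsmul, map_prod, map_pow, Units.coe_prod,
    Units.val_pow_eq_pow_val] using h2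

/-- Two points of the torsor over the same point of the base have the same image in the
quotient. -/
theorem comp_gitMap_toU
    (hss : ∀ (T : SchC) (z : (GITData.mk D ω).space.X.obj (op T)), IsSemistable D χ z.1)
    (ξ : QuotStack (GITData.mk D ω).space) {T' T : SchC} (u : T' ⟶ T)
    (p : ξ.P.X.obj (op T)) (q : ξ.P.X.obj (op T')) (h : ξ.toBase q = u ≫ ξ.toBase p) :
    u.left ≫ gitMap D χ (ξ.toU p).1 (hss T _) = gitMap D χ (ξ.toU q).1 (hss T' _) := by
  have h1 : ξ.π.app (op T') (ξ.P.X.map u.op p) = ξ.π.app (op T') q :=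
    (app_map ξ.π u p).trans h.symm
  obtain ⟨k, hk, -⟩ := ξ.simply_transitive _ _ h1
  have h2 : ξ.toU (ξ.P.X.map u.op p) = (GITData.mk D ω).space.X.map u.op (ξ.toU p) :=
    app_map ξ.f u p
  have h3 : ξ.toU q = (GITData.mk D ω).space.act k (ξ.toU (ξ.P.X.map u.op p)) := by
    rw [← hk]
    exact ξ.f_act k _
  have h4 := gitMap_act (χ := χ) k (ξ.toU (ξ.P.X.map u.op p)) (hss T' _) (hss T' _)
  simp only [← h3] at h4
  rw [← h4]
  refine comp_gitMap u (hss T _) (hss T' _) 1 fun n v _ => ?_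
  rw [h2, Units.val_one, one_pow, one_mul, map_prod]
  refine Finset.prod_congr rfl fun i _ => ?_
  rw [map_pow]
  rfl

/-- The quotient map descends from the torsor to the base: locally it is given by the sections of
the torsor, and morphisms to a scheme satisfy étale descent. -/
theorem existsUnique_isBlowDownValue
    (hss : ∀ (T : SchC) (z : (GITData.mk D ω).space.X.obj (op T)), IsSemistable D χ z.1)
    (ξ : QuotStack (GITData.mk D ω).space) :
    ∃! s : ξ.base.left ⟶ gitQuotient D χ, IsBlowDownValue χ ξ s := by
  obtain ⟨R, hR, hloc⟩ := ξ.locally_trivial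
  choose p hp using hloc
  let F := (Over.forget (Spec (CommRingCat.of ℂ))).op ⋙ yoneda.obj (gitQuotient D χ)
  have hF : Presieve.IsSheaf etaleC F := isSheaf_hom _
  let x : Presieve.FamilyOfElements F R.arrows := fun T h hh =>
    gitMap D χ (ξ.toU (p T h hh)).1 (hss T _)
  have hx : x.Compatible := by
    intro T₁ T₂ Z g₁ g₂ f₁ f₂ h₁ h₂ hg
    let q := ξ.P.X.map g₁.op (p T₁ f₁ h₁)
    have hq : ξ.toBase q = g₁ ≫ f₁ := by
      refine (app_map ξ.π g₁ _).trans ?_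
      rw [hp]
      rfl
    refine (comp_gitMap_toU hss ξ g₁ (p T₁ f₁ h₁) q ?_).trans
      (comp_gitMap_toU hss ξ g₂ (p T₂ f₂ h₂) q ?_).symm
    · exact hq.trans (congrArg (g₁ ≫ ·) (hp T₁ f₁ h₁).symm)
    · exact (hq.trans hg).trans (congrArg (g₂ ≫ ·) (hp T₂ f₂ h₂).symm)
  obtain ⟨s, hs, hs'⟩ := hF R hR x hx
  refine ⟨s, fun T q => ⟨hss T _, ?_⟩, fun s' hs₁ => hs' s' fun T h hh => ?_⟩
  · refine (hF.isSeparated _ (etaleC.pullback_stable (ξ.toBase q) hR)).ext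
      (t₁ := ((ξ.toBase q).left ≫ s : T.left ⟶ gitQuotient D χ)) (t₂ := gitMap D χ _ (hss T _))
      fun T' u hu => ?_
    have h1 : (u ≫ ξ.toBase q).left ≫ s = x (u ≫ ξ.toBase q) hu := hs _ hu
    change u.left ≫ (ξ.toBase q).left ≫ s = u.left ≫ gitMap D χ _ (hss T _)
    rw [comp_gitMap_toU hss ξ u q (p T' _ hu) (hp T' _ hu)]
    exact (Category.assoc u.left (ξ.toBase q).left (s : ξ.base.left ⟶ gitQuotient D χ)).symm.trans h1
  · obtain ⟨_, h1⟩ := hs₁ T (p T h hh)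
    have h2 : ξ.toBase (p T h hh) = h := hp T h hh
    rw [h2] at h1
    exact h1

end BlowDown

/-- Over `ℂ`, every torsor has a section. -/
theorem QuotStack.exists_section {G : SchCᵒᵖ ⥤ GrpCat.{0}} {U : GSpace G} (ξ : QuotStack U)
    (h : IsIso ξ.base.hom) : ∃ p : ξ.P.X.obj (op ξ.base), ξ.toBase p = 𝟙 ξ.base := by
  obtain ⟨R, hR, hloc⟩ := ξ.locally_trivial
  have hR' : Sieve.overEquiv _ R ∈ Scheme.etaleTopology ξ.base.left :=
    (GrothendieckTopology.mem_over_iff _ _).1 hR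
  obtain ⟨Y, g, hg, y, hy⟩ : ∃ (Y : Scheme.{0}) (g : Y ⟶ ξ.base.left)
      (_ : Sieve.overEquiv _ R g) (y : Spec (CommRingCat.of ℂ) ⟶ Y), y ≫ g = inv ξ.base.hom :=
    (Scheme.geometricFiber ℂ).jointly_surjective _ hR' (inv ξ.base.hom)
  rw [Sieve.overEquiv_iff] at hg
  have h1 : (ξ.base.hom ≫ y) ≫ g = 𝟙 _ := by
    rw [Category.assoc, hy, IsIso.hom_inv_id]
  let v : ξ.base ⟶ Over.mk (g ≫ ξ.base.hom) := Over.homMk (ξ.base.hom ≫ y) (by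
    change (ξ.base.hom ≫ y) ≫ g ≫ ξ.base.hom = _
    rw [← Category.assoc, h1, Category.id_comp])
  have h2 : v ≫ Over.homMk g = 𝟙 ξ.base := Over.OverMorphism.ext h1
  exact hloc _ _ (h2 ▸ R.downward_closed hg v)

/-! ### GIT data of rank one -/

section RankOne

variable {A : Type} [AddCommGroup A] (θ : A ≃ₗ[ℤ] ℤ)

/-- The real linear form that extends an identification of the character group with `ℤ`. -/
def realForm : ℝ ⊗[ℤ] A →ₗ[ℝ] ℝ := Module.Dual.baseChange ℝ (θ : A →ₗ[ℤ] ℤ)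

theorem realForm_tmul (c : ℝ) (x : A) : realForm θ (c ⊗ₜ x) = c * (θ x : ℝ) := by
  simp [realForm, mul_comm]

theorem realForm_injective : Function.Injective (realForm θ) := by
  have h : ∀ x, x = realForm θ x • ((1 : ℝ) ⊗ₜ[ℤ] θ.symm 1) := fun x => by
    induction x with
    | zero => simp
    | add x y hx hy => rw [map_add, add_smul, ← hx, ← hy]
    | tmul c y =>
      have hy : y = θ y • θ.symm 1 := by rw [← map_smul, smul_eq_mul, mul_one, θ.symm_apply_apply]
      conv_lhs => rw [hy, tmul_smul, smul_tmul']
      rw [realForm_tmul, smul_tmul', smul_eq_mul, mul_one, zsmul_eq_mul, mul_comm]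
  intro x y hxy
  rw [h x, h y, hxy]

variable {θ} {κ : Type} (d : GITData A κ)

theorem mem_anticones_iff_of_rank_one (hω : 0 < realForm θ d.ω) (I : Finset κ) :
    I ∈ d.anticones ↔ ∃ i ∈ I, 0 < θ (d.D i) := by
  classical
  constructor
  · rintro ⟨a, ha, h⟩
    by_contra! hI
    have h1 : realForm θ d.ω ≤ 0 := by
      rw [h, map_sum]
      refine Finset.sum_nonpos fun i hi => ?_
      rw [map_smul, realForm_tmul, one_mul, smul_eq_mul]
      exact mul_nonpos_of_nonneg_of_nonpos (ha i hi).le (by exact_mod_cast hI i hi)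
    exact absurd hω h1.not_gt
  · rintro ⟨i₀, hi₀, hpos⟩
    have hpos' : (0 : ℝ) < (θ (d.D i₀) : ℝ) := by exact_mod_cast hpos
    -- small coefficients away from `i₀` leave a positive rest, which `i₀` takes up
    let s : ℝ := ∑ i ∈ I.erase i₀, (θ (d.D i) : ℝ)
    let δ : ℝ := realForm θ d.ω / (|s| + 1)
    have hs : 0 < |s| + 1 := by positivity
    have hδ : 0 < δ := div_pos hω hs
    have hrest : 0 < realForm θ d.ω - δ * s := by
      have h1 : δ * (|s| + 1) = realForm θ d.ω := div_mul_cancel₀ _ hs.ne'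
      have h2 : δ * s ≤ δ * |s| := mul_le_mul_of_nonneg_left (le_abs_self s) hδ.le
      linarith
    refine ⟨fun i => if i = i₀ then (realForm θ d.ω - δ * s) / θ (d.D i₀) else δ, fun i _ => ?_,
      realForm_injective θ ?_⟩
    · dsimp only
      split_ifs
      exacts [div_pos hrest hpos', hδ]
    · rw [map_sum, ← Finset.add_sum_erase _ _ hi₀]
      have h3 : ∑ i ∈ I.erase i₀, realForm θ ((if i = i₀ then
          (realForm θ d.ω - δ * s) / θ (d.D i₀) else δ) • ((1 : ℝ) ⊗ₜ[ℤ] d.D i)) = δ * s := by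
        rw [Finset.mul_sum]
        refine Finset.sum_congr rfl fun i hi => ?_
        rw [if_neg (Finset.ne_of_mem_erase hi), map_smul, realForm_tmul, one_mul, smul_eq_mul]
      rw [h3]
      dsimp only
      rw [if_pos rfl, map_smul, realForm_tmul, one_mul, smul_eq_mul,
        div_mul_cancel₀ _ hpos'.ne']
      ring

theorem isStable_of_rank_one [Fintype κ] (hω : 0 < realForm θ d.ω)
    (h : ∃ i, 0 < θ (d.D i)) : d.IsStable where
  univ_mem := (mem_anticones_iff_of_rank_one d hω _).2 ⟨h.choose, Finset.mem_univ _, h.choose_spec⟩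
  span_eq I hI := by
    obtain ⟨i, hi, hpos⟩ := (mem_anticones_iff_of_rank_one d hω _).1 hI
    have hpos' : (θ (d.D i) : ℝ) ≠ 0 := by exact_mod_cast hpos.ne'
    refine eq_top_iff.2 fun x _ => ?_
    have hx : x = (realForm θ x / θ (d.D i)) • ((1 : ℝ) ⊗ₜ[ℤ] d.D i) := realForm_injective θ (by
      rw [map_smul, realForm_tmul, one_mul, smul_eq_mul, div_mul_cancel₀ _ hpos'])
    rw [hx]
    exact Submodule.smul_mem _ _ (Submodule.subset_span ⟨i, hi, rfl⟩)

end RankOne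

/-- A fully faithful and essentially surjective morphism of stacks has an inverse. -/
theorem StackHom.exists_isIsomorphism_symm {G H : SchCᵒᵖ ⥤ GrpCat.{0}} {U : GSpace G}
    {V : GSpace H} (j : StackHom U V) (h : j.functor.IsEquivalence) :
    ∃ j' : StackHom V U, j'.IsIsomorphism :=
  ⟨{ functor := j.functor.inv
     overIso := Functor.isoWhiskerLeft j.functor.inv j.overIso.symm ≪≫
        (Functor.associator _ _ _).symm ≪≫
        Functor.isoWhiskerRight j.functor.asEquivalence.counitIso _ ≪≫ Functor.leftUnitor _ },
    inferInstanceAs j.functor.inv.IsEquivalence⟩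

/-! ### The projected data -/

section Projected

variable {L : Type} [AddCommGroup L] {ι : Type} {D : ι → Module.Dual ℤ L} {e : L}

theorem exists_dualEx_equiv (he : ∃ χ : Module.Dual ℤ L, χ e = 1)
    (hgen : Submodule.span ℤ (D '' {i | D i e = 0}) = LinearMap.ker (Module.Dual.eval ℤ L e)) :
    ∃ θ : DualEx D e ≃ₗ[ℤ] ℤ, ∀ χ, θ (projEx D e χ) = χ e := by
  obtain ⟨χ₁, hχ₁⟩ := he
  have hsurj : Function.Surjective (Module.Dual.eval ℤ L e) := fun n => ⟨n • χ₁, by simp [hχ₁]⟩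
  exact ⟨Submodule.quotEquivOfEq _ _ hgen ≪≫ₗ
    (Module.Dual.eval ℤ L e).quotKerEquivOfSurjective hsurj, fun χ => rfl⟩

theorem realForm_projEx {θ : DualEx D e ≃ₗ[ℤ] ℤ} (hθ : ∀ χ, θ (projEx D e χ) = χ e)
    (x : ℝ ⊗[ℤ] Module.Dual ℤ L) :
    realForm θ ((projEx D e).baseChange ℝ x) = pairing e x := by
  induction x with
  | zero => simp
  | add x y hx hy => rw [map_add, map_add, map_add, hx, hy]
  | tmul c χ => rw [LinearMap.baseChange_tmul, realForm_tmul, pairing_tmul, hθ]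

variable {ωp : ℝ ⊗[ℤ] Module.Dual ℤ L}

/-- The slice of the projected data on `M₊`: the whole space. -/
def sliceEx {θ : DualEx D e ≃ₗ[ℤ] ℤ} (hθ : ∀ χ, θ (projEx D e χ) = χ e)
    (hpos : 0 < pairing e ωp) :
    LinSlice (dataEx D e ωp) (θ : DualEx D e →ₗ[ℤ] ℤ) (weights D e) where
  emb := id
  emb_injective := Function.injective_id
  z₀ := 0
  weight k := (hθ _).trans (Int.toNat_of_nonneg k.2.le).symm
  weight_zero i hi := absurd rfl hi
  z₀_emb _ := rfl
  span_eq := by simp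
  anticone k := ⟨{k}, (mem_anticones_iff_of_rank_one (θ := θ) _
    (by rw [dataEx, realForm_projEx hθ]; exact hpos) _).2
    ⟨k, Finset.mem_singleton_self k, by rw [dataEx, hθ]; exact k.2⟩,
    fun i hi => Or.inl (Finset.mem_singleton.1 hi)⟩
  meets I hI := by
    obtain ⟨i, hi, -⟩ := (mem_anticones_iff_of_rank_one (θ := θ) _
      (by rw [dataEx, realForm_projEx hθ]; exact hpos) _).1 hI
    exact ⟨i, hi⟩
  full_support _ _ _ := ⟨0, 0, by simp, by simp, rfl⟩

theorem exists_dataEx_isIsomorphism [Fintype ι] {θ : DualEx D e ≃ₗ[ℤ] ℤ}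
    (hθ : ∀ χ, θ (projEx D e χ) = χ e) (hpos : 0 < pairing e ωp) :
    ∃ j : StackHom (dataEx D e ωp).space (weighted (weights D e)), j.IsIsomorphism := by
  have h₁ : (θ : DualEx D e →ₗ[ℤ] ℤ) (θ.symm 1) = 1 := θ.apply_symm_apply 1
  let S := sliceEx hθ hpos
  refine ((S.slice h₁).stackHom).exists_isIsomorphism_symm
    { full := (S.isClosedImmersionOnto h₁).full
      faithful := (S.isClosedImmersionOnto h₁).faithful
      essSurj := ⟨fun ξ => ((S.slice h₁).essImage_iff ξ).2 fun T p =>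
        S.exists_sweep_eq h₁ _ ⟨fun i hi => absurd ⟨i, rfl⟩ hi, fun u v huv _ => ?_⟩⟩ }
  rw [funext fun i => (huv i rfl).1, funext fun i => (huv i rfl).2]

/-- The slice of the projected data with all characters: the coordinates in `M₊`. -/
def sliceExAll {θ : DualEx D e ≃ₗ[ℤ] ℤ} (hθ : ∀ χ, θ (projEx D e χ) = χ e)
    (hpos : 0 < pairing e ωp) :
    LinSlice (dataExAll D e ωp) (θ : DualEx D e →ₗ[ℤ] ℤ) (weights D e) where
  emb := Subtype.val
  emb_injective := Subtype.val_injective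
  z₀ := 0
  weight k := (hθ _).trans (Int.toNat_of_nonneg k.2.le).symm
  weight_zero i hi := absurd rfl hi
  z₀_emb _ := rfl
  span_eq := by simp
  anticone k := ⟨{k.1}, (mem_anticones_iff_of_rank_one (θ := θ) _
    (by rw [dataExAll, realForm_projEx hθ]; exact hpos) _).2
    ⟨k, Finset.mem_singleton_self k.1, by rw [dataExAll, hθ]; exact k.2⟩,
    fun i hi => Or.inl (Finset.mem_singleton.1 hi)⟩
  meets I hI := by
    obtain ⟨i, hi, h⟩ := (mem_anticones_iff_of_rank_one (θ := θ) _
      (by rw [dataExAll, realForm_projEx hθ]; exact hpos) _).1 hI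
    rw [dataExAll, hθ] at h
    exact ⟨⟨i, h⟩, hi⟩
  full_support _ _ _ := ⟨0, 0, by simp, by simp, rfl⟩

theorem exists_dataExAll_isClosedImmersionOnto [Fintype ι] {θ : DualEx D e ≃ₗ[ℤ] ℤ}
    (hθ : ∀ χ, θ (projEx D e χ) = χ e) (hpos : 0 < pairing e ωp) :
    ∃ j : StackHom (weighted (weights D e)) (dataExAll D e ωp).space,
      j.IsClosedImmersionOnto (fun _ => {z | ∀ i, ¬ 0 < D i e → z.1 i = 0}) := by
  have h₁ : (θ : DualEx D e →ₗ[ℤ] ℤ) (θ.symm 1) = 1 := θ.apply_symm_apply 1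
  let S := sliceExAll hθ hpos
  refine ⟨(S.slice h₁).stackHom, ?_⟩
  have hS : (fun T => {z : (dataExAll D e ωp).space.X.obj (op T) | S.IsOnOrbit z.1}) =
      fun T => {z | ∀ i, ¬ 0 < D i e → z.1 i = 0} := by
    funext T
    refine Set.ext fun z => ⟨fun hz i hi => hz.eq_zero i ?_ rfl, fun hz => ⟨fun i hi _ => ?_,
      fun u v huv _ => ?_⟩⟩
    · rintro ⟨k, rfl⟩
      exact hi k.2
    · exact hz i fun h => hi ⟨⟨i, h⟩, rfl⟩
    · rw [funext fun i => (huv i rfl).1, funext fun i => (huv i rfl).2]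
  rw [← hS]
  exact S.isClosedImmersionOnto h₁

end Projected

/-! ### Fibres of the quotient map -/

section Fibre

variable {L : Type} [AddCommGroup L] {ι : Type} [Fintype ι] {D : ι → Module.Dual ℤ L}
  {χ : Module.Dual ℤ L}

/-- If `z` and `z'` have the same image in the quotient and a semi-invariant monomial `z ^ u` is
invertible at `z'`, then it is invertible at `z`, and `z` satisfies the binomial equations of `z'`
between a monomial and an equivalent monomial in the coordinates that occur in `u`. -/
theorem binomial_of_gitMap_eq {T : SchC} {z z' : ι → Fn T} (hz : IsSemistable D χ z)
    (hz' : IsSemistable D χ z') (h : gitMap D χ z hz = gitMap D χ z' hz') {n : ℕ} {u : ι → ℕ}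
    (hn : 0 < n) (hu : ∑ i, u i • D i = n • χ) (hunit : ∀ i, u i ≠ 0 → IsUnit (z' i)) :
    (∀ i, u i ≠ 0 → IsUnit (z i)) ∧
    ∀ a b : ι → ℕ, (∀ i, b i ≠ 0 → u i ≠ 0) → ∑ i, a i • D i = ∑ i, b i • D i →
      (∏ i, z i ^ a i) * ∏ i, z' i ^ b i = (∏ i, z i ^ b i) * ∏ i, z' i ^ a i := by
  have hu' : IsUnit (evalSemiInv D χ z' (monomial D χ hu)) := by
    rw [eval_monomial]
    exact isUnit_prod_pow hunit
  have hunit' : ∀ i, u i ≠ 0 → IsUnit (z i) := fun i hi => by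
    have := isUnit_of_mapProj_eq (semiInvGrading D χ) h.symm hn (monomial_mem D χ hu) hu'
    rw [eval_monomial] at this
    exact isUnit_of_isUnit_prod_pow this hi
  refine ⟨hunit', fun a b hb hab => ?_⟩
  -- the monomial `z ^ (k u - b + a)` has the weight of `z ^ (k u)`
  let k := ∑ i, b i
  have hk : ∀ i, b i ≤ k * u i := fun i => by
    by_cases hi : b i = 0
    · rw [hi]
      exact Nat.zero_le _
    · exact (Finset.single_le_sum (fun _ _ => Nat.zero_le _) (Finset.mem_univ i)).trans
        (Nat.le_mul_of_pos_right _ (Nat.pos_of_ne_zero (hb i hi)))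
  let c : ι → ℕ := fun i => k * u i - b i
  have hc : ∀ i, c i ≠ 0 → u i ≠ 0 := fun i hi h0 => hi (by simp [c, h0])
  have hcb : ∀ i, c i + b i = k * u i := fun i => Nat.sub_add_cancel (hk i)
  have hsum : ∑ i, (c i + a i) • D i = (k • n) • χ := by
    simp only [add_smul, Finset.sum_add_distrib]
    rw [hab, ← Finset.sum_add_distrib]
    simp only [← add_smul, hcb]
    rw [smul_eq_mul, mul_smul, ← hu, Finset.smul_sum]
    simp only [mul_smul]
  have h1 := mul_pow_eq_of_mapProj_eq (semiInvGrading D χ) h.symm hn (monomial_mem D χ hu) hu'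
    (monomial_mem D χ hsum)
  simp only [eval_monomial] at h1
  have hpow : ∀ y : ι → Fn T, (∏ i, y i ^ u i) ^ k = (∏ i, y i ^ c i) * ∏ i, y i ^ b i := fun y => by
    rw [← Finset.prod_pow, ← Finset.prod_mul_distrib]
    refine Finset.prod_congr rfl fun i _ => ?_
    rw [← pow_mul, ← pow_add, hcb, mul_comm]
  rw [hpow, hpow] at h1
  simp only [pow_add, Finset.prod_mul_distrib] at h1
  refine ((isUnit_prod_pow fun i hi => hunit' i (hc i hi)).mul
    (isUnit_prod_pow fun i hi => hunit i (hc i hi))).mul_left_cancel ?_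
  linear_combination -h1

end Fibre

/-! ### The curve contracted by the blow-down map -/

section Contracted

variable {L : Type} [AddCommGroup L] {ι : Type} {D : ι → Module.Dual ℤ L} {e : L}
  {ωp : ℝ ⊗[ℤ] Module.Dual ℤ L} {ω₀ : Module.Dual ℤ L}

theorem exists_pos_of_mem_anticones (hpos : 0 < pairing e ωp) {K : Finset ι}
    (hK : K ∈ (GITData.mk D ωp).anticones) : ∃ i ∈ K, 0 < D i e := by
  obtain ⟨a, ha, h⟩ := hK
  by_contra! hI
  refine absurd hpos (not_lt.2 ?_)
  change ωp = _ at h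
  rw [h, map_sum]
  refine Finset.sum_nonpos fun i hi => ?_
  rw [map_smul, pairing_tmul, one_mul, smul_eq_mul]
  exact mul_nonpos_of_nonneg_of_nonpos (ha i hi).le (by exact_mod_cast hI i hi)

/-- Semistability for `ω₀`: an anticone of `ωp` carries a semi-invariant monomial for `ω₀`, which
lies in the closure of the chamber of `ωp`. -/
theorem exists_nat_combination_of_mem_anticones [Module.Free ℤ L] [Module.Finite ℤ L] [Fintype ι]
    (hst : (GITData.mk D ωp).IsStable) (hcl : (1 : ℝ) ⊗ₜ[ℤ] ω₀ ∈ closure (chamber D ωp))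
    {K : Finset ι} (hK : K ∈ (GITData.mk D ωp).anticones) :
    ∃ (n : ℕ) (v : ι → ℕ), 0 < n ∧ (∀ i, v i ≠ 0 → i ∈ K) ∧ ∑ i, v i • D i = n • ω₀ :=
  exists_nat_combination_of_mem_nonnegCone ω₀
    (mem_nonnegCone_of_mem_closure D hcl (hst.span_eq K hK) hK)

theorem isSemistable_of_mem_space [Module.Free ℤ L] [Module.Finite ℤ L] [Fintype ι]
    (hst : (GITData.mk D ωp).IsStable) (hcl : (1 : ℝ) ⊗ₜ[ℤ] ω₀ ∈ closure (chamber D ωp))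
    {T : SchC} (z : (GITData.mk D ωp).space.X.obj (op T)) : IsSemistable D ω₀ z.1 := by
  refine isSemistable_of_monomials fun t => ?_
  obtain ⟨K, hK, ht⟩ := z.2 t
  obtain ⟨n, v, hn, hv, hsum⟩ := exists_nat_combination_of_mem_anticones hst hcl hK
  exact ⟨n, v, hn, hsum, mem_basicOpen_prod_pow.2 fun i hi => ht i (hv i hi)⟩

/-- A lattice point in the cone of positive combinations of the characters `D i`, `i ∈ I`, has a
multiple that is a combination with natural coefficients and support `I`. -/
theorem exists_nat_combination_support [Fintype ι] {I : Finset ι}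
    (h : I ∈ (GITData.mk D ((1 : ℝ) ⊗ₜ[ℤ] ω₀)).anticones) :
    ∃ (n : ℕ) (u : ι → ℕ), 0 < n ∧ (∀ i, u i ≠ 0 ↔ i ∈ I) ∧ ∑ i, u i • D i = n • ω₀ := by
  obtain ⟨n, u, hn, hu, hu', hsum⟩ := exists_nat_combination D ω₀ h
  refine ⟨n, u, hn, fun i => ⟨fun hi => by_contra fun h => hi (hu' i h), fun hi => (hu i hi).ne'⟩,
    hsum ▸ ?_⟩
  exact (Finset.sum_subset (Finset.subset_univ I) fun i _ hi => by rw [hu' i hi, zero_smul]).symm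

variable (D e) in
/-- A base point on the wall for the copy of `ℙ(a)` over the image of `z₀`: the non-zero
coordinates of `z₀` form an anticone for `ω₀` and their characters generate the characters on the
wall. -/
structure IsWallPoint (ω₀ : Module.Dual ℤ L) (z₀ : ι → ℂ) : Prop where
  apply_eq_zero : ∀ i, z₀ i ≠ 0 → D i e = 0
  anticone : ∃ I : Finset ι, (∀ i, i ∈ I ↔ z₀ i ≠ 0) ∧
    I ∈ (GITData.mk D ((1 : ℝ) ⊗ₜ[ℤ] ω₀)).anticones
  span_eq : Submodule.span ℤ (D '' {i | z₀ i ≠ 0}) = LinearMap.ker (Module.Dual.eval ℤ L e)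

theorem IsWallPoint.exists_nat_combination [Fintype ι] {z₀ : ι → ℂ}
    (hz₀ : IsWallPoint D e ω₀ z₀) : ∃ (n : ℕ) (u : ι → ℕ), 0 < n ∧
      (∀ i, u i ≠ 0 ↔ z₀ i ≠ 0) ∧ ∑ i, u i • D i = n • ω₀ := by
  obtain ⟨I, hI, hIa⟩ := hz₀.anticone
  obtain ⟨n, u, hn, hu, hsum⟩ := exists_nat_combination_support hIa
  exact ⟨n, u, hn, fun i => (hu i).trans (hI i), hsum⟩

theorem IsWallPoint.isSemistable_const [Fintype ι] {z₀ : ι → ℂ} (hz₀ : IsWallPoint D e ω₀ z₀)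
    (T : SchC) : IsSemistable D ω₀ fun i => const T (z₀ i) := by
  obtain ⟨n, u, hn, hu, hsum⟩ := hz₀.exists_nat_combination
  refine isSemistable_of_monomials fun t => ⟨n, u, hn, hsum, mem_basicOpen_prod_pow.2 fun i hi => ?_⟩
  rw [Scheme.basicOpen_of_isUnit _ (isUnit_const T ((hu i).1 hi))]
  trivial

/-- The image of the point `z₀` in the quotient, pulled back to a scheme over `ℂ`. -/
theorem IsWallPoint.hom_comp_gitMap_const [Fintype ι] {z₀ : ι → ℂ}
    (hz₀ : IsWallPoint D e ω₀ z₀) (T : SchC) :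
    T.hom ≫ gitMap D ω₀ (fun i => const (Over.mk (𝟙 (Spec (CommRingCat.of ℂ)))) (z₀ i))
      (hz₀.isSemistable_const _) =
      gitMap D ω₀ (fun i => const T (z₀ i)) (hz₀.isSemistable_const T) := by
  let u : T ⟶ Over.mk (𝟙 (Spec (CommRingCat.of ℂ))) := Over.homMk T.hom
  refine comp_gitMap u _ _ 1 fun n v _ => ?_
  rw [Units.val_one, one_pow, one_mul, map_prod]
  exact Finset.prod_congr rfl fun i _ => by rw [map_pow, pull_const]

variable (D e ωp ω₀) in
/-- The position of the lattice point `ω₀`: on the wall `e^⊥`, in the closure of the chamber of the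
stable condition `ωp`, on which `e` is positive. -/
structure IsOnWall [Fintype ι] : Prop where
  stable : (GITData.mk D ωp).IsStable
  pos : ∀ θ ∈ chamber D ωp, 0 < pairing e θ
  mem_closure : (1 : ℝ) ⊗ₜ[ℤ] ω₀ ∈ closure (chamber D ωp)
  apply_eq_zero : ω₀ e = 0

theorem IsOnWall.pairing_pos [Fintype ι] (hw : IsOnWall D e ωp ω₀) : 0 < pairing e ωp :=
  hw.pos _ (mem_chamber_self D ⟨_, hw.mem_closure⟩)

theorem sum_apply_eq_zero [Fintype ι] (h₀ : ω₀ e = 0) {n : ℕ} {v : ι → ℕ}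
    (hv : ∑ i, v i • D i = n • ω₀) : ∑ i, (v i : ℤ) * D i e = 0 := by
  have := congrArg (fun φ : Module.Dual ℤ L => φ e) hv
  simpa [LinearMap.sum_apply, h₀] using this

variable [Module.Free ℤ L] [Module.Finite ℤ L] [hι : Fintype ι]

/-- The slice of `U₊` through `z₀`: the map `w ↦ (w, z₀)`. -/
def wallSlice (hw : IsOnWall D e ωp ω₀) {z₀ : ι → ℂ} (hz₀ : IsWallPoint D e ω₀ z₀) :
    LinSlice (GITData.mk D ωp) (Module.Dual.eval ℤ L e) (weights D e) where
  emb := Subtype.val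
  emb_injective := Subtype.val_injective
  z₀ := z₀
  weight k := (Int.toNat_of_nonneg k.2.le).symm
  weight_zero := hz₀.apply_eq_zero
  z₀_emb k := by_contra fun h => k.2.ne' (hz₀.apply_eq_zero k h)
  span_eq := hz₀.span_eq
  anticone k := by
    classical
    obtain ⟨I, hI, hIa⟩ := hz₀.anticone
    refine ⟨insert k.1 I, mem_posCone_insert D hw.pos hw.mem_closure hIa ?_ k.2, fun i hi => ?_⟩
    · rw [← hz₀.span_eq]
      congr 2
      exact Set.ext hI
    · rw [Finset.mem_insert, hI] at hi
      exact hi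
  meets K hK := by
    obtain ⟨i, hi, h⟩ := exists_pos_of_mem_anticones hw.pairing_pos hK
    exact ⟨⟨i, h⟩, hi⟩
  full_support {F} K hK hsub := by
    obtain rfl : F = hι := Subsingleton.elim _ _
    obtain ⟨n, u, hn, hu, hsum⟩ := hz₀.exists_nat_combination
    obtain ⟨n', v, hn', hv, hsum'⟩ :=
      exists_nat_combination_of_mem_anticones hw.stable hw.mem_closure hK
    -- all characters in `K` are non-negative on `e`, so those in `v` lie on the wall
    have hzero : ∀ i, v i ≠ 0 → D i e = 0 := fun i hi => by
      have hnn : ∀ i ∈ Finset.univ, 0 ≤ (v i : ℤ) * D i e := fun i _ => by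
        by_cases h : v i = 0
        · simp [h]
        · rcases hsub i (hv i h) with ⟨k, rfl⟩ | h'
          · exact mul_nonneg (Nat.cast_nonneg _) k.2.le
          · rw [hz₀.apply_eq_zero i h', mul_zero]
      have := (Finset.sum_eq_zero_iff_of_nonneg hnn).1
        (sum_apply_eq_zero hw.apply_eq_zero hsum') i (Finset.mem_univ i)
      exact (mul_eq_zero.1 this).resolve_left (by exact_mod_cast hi)
    refine ⟨n' • u, n • v, fun i => ?_, fun i hi => ?_, ?_⟩
    · rw [Pi.smul_apply, smul_eq_mul, mul_ne_zero_iff, hu]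
      exact and_iff_right hn'.ne'
    · have hi' : v i ≠ 0 := fun h => hi (by simp [h])
      refine ⟨(hsub i (hv i hi')).resolve_left ?_, hv i hi'⟩
      rintro ⟨k, rfl⟩
      exact k.2.ne' (hzero k hi')
    · have h1 : ∀ (m : ℕ) (w : ι → ℕ), ∑ i, (m • w) i • D i = m • ∑ i, w i • D i := fun m w => by
        rw [Finset.smul_sum]
        exact Finset.sum_congr rfl fun i _ => by rw [Pi.smul_apply, smul_eq_mul, mul_smul]
      refine (h1 n' u).trans ?_
      refine Eq.trans ?_ (h1 n v).symm
      rw [hsum, hsum', smul_comm]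

variable (hw : IsOnWall D e ωp ω₀) {z₀ : ι → ℂ} (hz₀ : IsWallPoint D e ω₀ z₀)

theorem wallSlice_ext {T : SchC} (w : MPlus D e → Fn T) :
    (wallSlice hw hz₀).ext w = extend D e z₀ w := by
  funext i
  by_cases hi : 0 < D i e
  · exact ((wallSlice hw hz₀).ext_emb w ⟨i, hi⟩).trans (by rw [extend, dif_pos hi])
  · refine ((wallSlice hw hz₀).ext_of_notMem w ?_).trans (by rw [extend, dif_neg hi]; rfl)
    rintro ⟨k, rfl⟩
    exact hi k.2

variable {χ₁ : Module.Dual ℤ L} (h₁ : Module.Dual.eval ℤ L e χ₁ = 1)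

theorem isInducedBy_stackHom : IsInducedBy ((wallSlice hw hz₀).slice h₁).stackHom z₀ := by
  refine ⟨fun ξ =>
    { app := fun T => TypeCat.ofHom fun p =>
        ((p, 1) : ξ.P.X.obj T × (torus (LinearMap.ker (Module.Dual.eval ℤ L e))).obj T)
      naturality := fun T T' u => by
        apply ConcreteCategory.hom_ext
        intro p
        refine Prod.ext rfl ?_
        exact (map_one ((torus (LinearMap.ker (Module.Dual.eval ℤ L e))).map u).hom).symm },
    fun ξ η m => rfl, fun ξ T p => ⟨?_, fun g => ?_, ?_⟩⟩
  · exact Category.comp_id _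
  · refine Prod.ext ?_ ?_
    · exact congrArg (fun g => ξ.P.act g p) ((torusSplitting _ h₁).fst_inl g).symm
    · have h2 : homVal (torusSplitting (Module.Dual.eval ℤ L e) h₁).snd (oneParam e g) = 1 :=
        (torusSplitting _ h₁).snd_inl g
      exact (mul_one _).symm.trans (congrArg (· * 1) h2).symm
  · rw [← wallSlice_ext hw hz₀]
    have h3 : (GITData.mk D ωp).space.act (homVal (torusSplitting (Module.Dual.eval ℤ L e) h₁).inr 1)
        ((wallSlice hw hz₀).map.app (op T) (ξ.toU p)) =
          (wallSlice hw hz₀).map.app (op T) (ξ.toU p) := by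
      rw [homVal_one, (GITData.mk D ωp).space.one_act]
    exact congrArg Subtype.val h3

/-- The quotient map is constant on the image of the slice: a semi-invariant monomial that involves
a coordinate in `M₊` also involves one of negative weight, so it vanishes both at `(w, z₀)` and at
`z₀`. -/
theorem gitMap_sweep {T : SchC} (w : (weighted (weights D e)).X.obj (op T))
    (k : (torus (LinearMap.ker (Module.Dual.eval ℤ L e))).obj (op T))
    (h : IsSemistable D ω₀ (((wallSlice hw hz₀).slice h₁).sweep w k).1) :
    gitMap D ω₀ (fun i => const T (z₀ i)) (hz₀.isSemistable_const T) =
      gitMap D ω₀ (((wallSlice hw hz₀).slice h₁).sweep w k).1 h := by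
  let z := (wallSlice hw hz₀).map.app (op T) w
  have hz : IsSemistable D ω₀ z.1 := isSemistable_of_mem_space hw.stable hw.mem_closure z
  refine Eq.trans ?_ (gitMap_act _ z hz h)
  refine gitMap_congr (hz₀.isSemistable_const T) hz 1 fun n v hv => ?_
  rw [Units.val_one, one_pow, one_mul]
  have hz' : z.1 = extend D e z₀ w.1 := wallSlice_ext hw hz₀ w.1
  rw [hz']
  by_cases hM : ∃ i, v i ≠ 0 ∧ 0 < D i e
  · obtain ⟨i, hi, hpos⟩ := hM
    obtain ⟨j, hj, hneg⟩ : ∃ j, v j ≠ 0 ∧ D j e < 0 := by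
      by_contra! hnn
      have h0 := (Finset.sum_eq_zero_iff_of_nonneg (fun j _ => by
        by_cases h : v j = 0
        · simp [h]
        · exact mul_nonneg (Nat.cast_nonneg _) (hnn j h))).1
        (sum_apply_eq_zero hw.apply_eq_zero hv) i (Finset.mem_univ i)
      exact (mul_pos (by exact_mod_cast Nat.pos_of_ne_zero hi) hpos).ne' h0
    have hz₀j : z₀ j = 0 := by_contra fun h => hneg.ne (hz₀.apply_eq_zero j h)
    rw [Finset.prod_eq_zero (Finset.mem_univ j), Finset.prod_eq_zero (Finset.mem_univ j)]
    · rw [hz₀j, map_zero, zero_pow hj]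
    · rw [extend, dif_neg hneg.not_gt, hz₀j, map_zero, zero_pow hj]
  · push Not at hM
    refine Finset.prod_congr rfl fun i _ => ?_
    by_cases hi : v i = 0
    · rw [hi, pow_zero, pow_zero]
    · rw [extend, dif_neg (hM i hi).not_gt]

theorem isBlowDownValue_stackHom (ξ : QuotStack (weighted (weights D e))) :
    IsBlowDownValue ω₀ (((wallSlice hw hz₀).slice h₁).stackHom.functor.obj ξ)
      ((((wallSlice hw hz₀).slice h₁).stackHom.functor.obj ξ).base.hom ≫
        gitMap D ω₀ (fun i => const (Over.mk (𝟙 (Spec (CommRingCat.of ℂ)))) (z₀ i))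
          (hz₀.isSemistable_const _)) := by
  intro T q
  refine ⟨isSemistable_of_mem_space hw.stable hw.mem_closure _, ?_⟩
  rw [← Category.assoc, Over.w]
  rw [hz₀.hom_comp_gitMap_const T]
  exact gitMap_sweep hw hz₀ h₁ (ξ.toU q.1) q.2 _

/-- Points of `U₊` over `ℂ` with the same image as `z₀` lie on the orbit of the slice. -/
theorem isOnOrbit_of_gitMap_eq {T : SchC} [IsIso T.hom]
    (z : (GITData.mk D ωp).space.X.obj (op T)) (hz : IsSemistable D ω₀ z.1)
    (h : gitMap D ω₀ z.1 hz =
      gitMap D ω₀ (fun i => const T (z₀ i)) (hz₀.isSemistable_const T)) :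
    (wallSlice hw hz₀).IsOnOrbit z.1 := by
  classical
  obtain ⟨n, u, hn, hu, hsum⟩ := hz₀.exists_nat_combination
  obtain ⟨hunit, hbin⟩ := binomial_of_gitMap_eq hz (hz₀.isSemistable_const T) h hn hsum
    fun i hi => isUnit_const T ((hu i).1 hi)
  have hfield : ∀ x : Fn T, x = 0 ∨ IsUnit x := by
    have hsurj : Function.Surjective (const T) := by
      let f : T.left ⟶ Spec (CommRingCat.of ℂ) := T.hom
      have : IsIso f := inferInstanceAs (IsIso T.hom)
      have : IsIso f.appTop := inferInstanceAs (IsIso (f.app ⊤))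
      exact (ConcreteCategory.bijective_of_isIso
        ((Scheme.ΓSpecIso (CommRingCat.of ℂ)).inv ≫ f.appTop)).2
    intro x
    obtain ⟨c, rfl⟩ := hsurj x
    by_cases hc : c = 0
    · exact Or.inl (by rw [hc, map_zero])
    · exact Or.inr (isUnit_const T hc)
  -- a monomial whose weight lies on the wall is equivalent to a Laurent monomial in `z₀`
  have hvanish : ∀ (c : ι → ℕ) (i : ι), ∑ j, c j • D j ∈ LinearMap.ker (Module.Dual.eval ℤ L e) →
      c i ≠ 0 → z₀ i = 0 → ∏ j, z.1 j ^ c j = 0 := by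
    intro c i hc hci hi
    rw [← hz₀.span_eq, Finsupp.mem_span_image_iff_linearCombination] at hc
    obtain ⟨m, hm, hmc⟩ := hc
    rw [Finsupp.linearCombination_apply, Finsupp.sum_fintype _ _ fun j => zero_smul ℤ (D j)] at hmc
    have hm0 : ∀ j, m j ≠ 0 → z₀ j ≠ 0 := fun j hj => hm (Finsupp.mem_support_iff.2 hj)
    have h1 := hbin (fun j => c j + (-m j).toNat) (fun j => (m j).toNat)
      (fun j hj => (hu j).2 (hm0 j (by omega))) (by
        simp only [add_smul, Finset.sum_add_distrib]
        rw [← hmc, ← Finset.sum_add_distrib]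
        refine Finset.sum_congr rfl fun j _ => ?_
        have h2 : m j = ((m j).toNat : ℤ) - ((-m j).toNat : ℤ) := by omega
        conv_lhs => rw [h2, sub_smul, natCast_zsmul, natCast_zsmul]
        conv_rhs => rw [← sub_add_cancel ((m j).toNat • D j) ((-m j).toNat • D j)]
        congr 3; omega)
    rw [Finset.prod_eq_zero (f := fun j => const T (z₀ j) ^ (c j + (-m j).toNat)) (Finset.mem_univ i)
      (by rw [hi, map_zero, zero_pow (by omega)]), mul_zero] at h1
    simp only [pow_add, Finset.prod_mul_distrib] at h1
    have h3 := (isUnit_prod_pow fun j (hj : (m j).toNat ≠ 0) =>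
      isUnit_const T (hm0 j (by omega))).mul_left_eq_zero.1 h1
    exact (isUnit_prod_pow fun j (hj : (-m j).toNat ≠ 0) =>
      hunit j ((hu j).2 (hm0 j (by omega)))).mul_left_eq_zero.1 h3
  refine ⟨fun i hi hi0 => ?_, fun a b hab hsum' => ?_⟩
  · have hi : ¬ 0 < D i e := fun h => hi ⟨⟨i, h⟩, rfl⟩
    have hi0 : z₀ i = 0 := hi0
    rcases (not_lt.1 hi).eq_or_lt with h0 | hneg
    · have := hvanish (Pi.single i 1) i (by
        simpa [Pi.single_apply, ite_smul] using h0) (by simp) hi0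
      rw [Finset.prod_eq_single i (fun j _ hj => by rw [Pi.single_eq_of_ne hj, pow_zero])
        (by simp), Pi.single_eq_same, pow_one] at this
      exact this
    · -- a coordinate of positive weight that does not vanish compensates the weight
      obtain ⟨t⟩ : Nonempty T.left := ⟨(inv T.hom) (IsLocalRing.closedPoint ℂ)⟩
      obtain ⟨K, hK, ht⟩ := z.2 t
      obtain ⟨k, hk, hkpos⟩ := exists_pos_of_mem_anticones hw.pairing_pos hK
      have hik : k ≠ i := by
        rintro rfl
        exact hi hkpos
      have hzk : IsUnit (z.1 k) := (hfield _).resolve_left fun h0 => by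
        have := ht k hk
        rw [h0, Scheme.basicOpen_zero] at this
        exact this
      have hA : (D k e).toNat ≠ 0 := by omega
      have hprod : ∀ {M : Type} [CommMonoid M] (f : ι → ℕ → M), (∀ j, f j 0 = 1) →
          ∏ j, f j ((Pi.single i (D k e).toNat + Pi.single k (-D i e).toNat : ι → ℕ) j) =
            f i (D k e).toNat * f k (-D i e).toNat := fun f hf => by
        rw [Finset.prod_eq_mul i k hik.symm (fun j _ hj => by
          rw [Pi.add_apply, Pi.single_eq_of_ne hj.1, Pi.single_eq_of_ne hj.2, add_zero, hf])
          (by simp) (by simp)]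
        simp [hik, hik.symm]
      have := hvanish (Pi.single i (D k e).toNat + Pi.single k (-D i e).toNat) i (by
        have h2 := hprod (M := Multiplicative (Module.Dual ℤ L))
          (fun j n => Multiplicative.ofAdd (n • D j)) (by simp)
        rw [← ofAdd_sum] at h2
        have h2 : _ = (D k e).toNat • D i + (-D i e).toNat • D k :=
          congrArg Multiplicative.toAdd h2
        simp only [toAdd_ofAdd] at h2
        rw [h2, LinearMap.mem_ker, Module.Dual.eval_apply, LinearMap.add_apply,
          LinearMap.smul_apply, LinearMap.smul_apply, nsmul_eq_mul, nsmul_eq_mul,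
          Int.toNat_of_nonneg hkpos.le, Int.toNat_of_nonneg (by omega)]
        ring) (by simp [hik.symm, hA]) hi0
      rw [hprod (fun j n => z.1 j ^ n) (fun j => pow_zero _)] at this
      have h3 := (hzk.pow _).mul_left_eq_zero.1 this
      refine (hfield _).resolve_right fun h4 => ?_
      have h5 : IsUnit (z.1 k ^ (-D i e).toNat * 0) := by
        rw [← h3]
        exact (hzk.pow _).mul (h4.pow _)
      have h7 : T.left.basicOpen (0 : Fn T) = ⊤ := by
        rw [mul_zero] at h5
        exact Scheme.basicOpen_of_isUnit _ h5
      rw [Scheme.basicOpen_zero] at h7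
      have : t ∈ (⊥ : T.left.Opens) := h7 ▸ trivial
      exact this
  · have hab1 : ∀ i, b i ≠ 0 → u i ≠ 0 := fun i hi => (hu i).2 fun h0 => hi (hab i h0).2
    have := hbin a b hab1 hsum'
    simp only [map_prod, map_pow]
    exact this

/-- The fibre of the blow-down map over the image of `z₀`. -/
theorem essImage_of_isBlowDownValue (ξ : QuotStack (GITData.mk D ωp).space) (hξ : IsIso ξ.base.hom)
    (h : IsBlowDownValue ω₀ ξ (ξ.base.hom ≫
      gitMap D ω₀ (fun i => const (Over.mk (𝟙 (Spec (CommRingCat.of ℂ)))) (z₀ i))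
        (hz₀.isSemistable_const _))) :
    ((wallSlice hw hz₀).slice h₁).stackHom.functor.essImage ξ := by
  obtain ⟨p, hp⟩ := ξ.exists_section hξ
  have hpo : (wallSlice hw hz₀).IsOnOrbit (ξ.toU p).1 := by
    obtain ⟨hss, hv⟩ := h ξ.base p
    rw [hp, hz₀.hom_comp_gitMap_const] at hv
    exact isOnOrbit_of_gitMap_eq hw hz₀ _ hss (hv.symm.trans (Category.id_comp _))
  obtain ⟨w, k, hwk⟩ := (wallSlice hw hz₀).exists_sweep_eq h₁ _ hpo
  rw [((wallSlice hw hz₀).slice h₁).essImage_iff]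
  intro T q
  have hq : ξ.π.app (op T) (ξ.P.X.map (ξ.toBase q).op p) = ξ.π.app (op T) q := by
    refine (app_map ξ.π (ξ.toBase q) p).trans ?_
    exact (congrArg (ξ.toBase q ≫ ·) hp).trans (Category.comp_id _)
  obtain ⟨g, hg, -⟩ := ξ.simply_transitive _ _ hq
  refine ⟨_, _, (((wallSlice hw hz₀).slice h₁).sweep_act g
    ((weighted (weights D e)).X.map (ξ.toBase q).op w)
    ((torus (LinearMap.ker (Module.Dual.eval ℤ L e))).map (ξ.toBase q).op k)).trans ?_⟩
  rw [← ((wallSlice hw hz₀).slice h₁).sweep_map, hwk]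
  have h2 : ξ.toU q = ξ.toU (ξ.P.act g (ξ.P.X.map (ξ.toBase q).op p)) := by rw [hg]
  rw [h2]
  refine Eq.trans ?_ (ξ.f_act g _).symm
  exact congrArg _ (app_map ξ.f (ξ.toBase q) p).symm

end Contracted

end ToricWall

end

theorem mainTheorem6 {L : Type} [AddCommGroup L] [Module.Free ℤ L] [Module.Finite ℤ L]
    {ι : Type} [Fintype ι] (D : ι → Module.Dual ℤ L) (e : L)
    (ωp ωm : ℝ ⊗[ℤ] Module.Dual ℤ L) (hwall : ToricWall.IsWallCrossing D e ωp ωm)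
    (ω₀ : Module.Dual ℤ L)
    (hω₀ : (1 : ℝ) ⊗ₜ[ℤ] ω₀ ∈ intrinsicInterior ℝ
      ((ToricWall.wall e : Set (ℝ ⊗[ℤ] Module.Dual ℤ L)) ∩ closure (ToricWall.chamber D ωp)))
    (hgen : Submodule.span ℤ (D '' {i | D i e = 0}) =
      LinearMap.ker (Module.Dual.eval ℤ L e)) :
    -- `L_ex^∨` is identified with `ℤ` through `χ ↦ χ · e`
    (∃ θ : ToricWall.DualEx D e ≃ₗ[ℤ] ℤ, ∀ χ, θ (ToricWall.projEx D e χ) = χ e) ∧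
    -- the anticones of the projected data
    (∀ I : Finset ι, I ∈ (ToricWall.dataExAll D e ωp).anticones ↔ ∃ i ∈ I, 0 < D i e) ∧
    -- the toric stack of the projected data on `M₊` is the weighted projective stack `ℙ(a)`
    (ToricWall.dataEx D e ωp).IsStable ∧
    (∃ j : ToricWall.StackHom (ToricWall.dataEx D e ωp).space
        (ToricWall.weighted (ToricWall.weights D e)), j.IsIsomorphism) ∧
    -- for the projected data with all characters, `ℙ(a)` is the closed substack on which the
    -- coordinates of non-positive weight vanish
    (∃ j : ToricWall.StackHom (ToricWall.weighted (ToricWall.weights D e))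
        (ToricWall.dataExAll D e ωp).space,
      j.IsClosedImmersionOnto (fun _ => {z | ∀ i, ¬ 0 < D i e → z.1 i = 0})) ∧
    -- the blow-down map `g₊ : X₊ → ℂ^ι //_{ω₀} K` is well defined
    (∀ ξ : ToricWall.QuotStack (ToricWall.GITData.mk D ωp).space,
      ∃! s : ξ.base.left ⟶ ToricWall.gitQuotient D ω₀, ToricWall.IsBlowDownValue ω₀ ξ s) ∧
    -- `M₀` is an anticone for `ω₀`
    (Finset.univ.filter (fun i => D i e = 0) ∈
      (ToricWall.GITData.mk D ((1 : ℝ) ⊗ₜ[ℤ] ω₀)).anticones) ∧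
    -- `g₊` contracts a copy of `ℙ(a)` over the image of each point `z₀` of `U₀` that is fixed by
    -- the subgroup `e`, and whose non-zero coordinates have characters generating `W ∩ L^∨`
    (∀ z₀ : ι → ℂ, (∀ i, z₀ i ≠ 0 → D i e = 0) →
      (∃ I : Finset ι, (∀ i, i ∈ I ↔ z₀ i ≠ 0) ∧
        I ∈ (ToricWall.GITData.mk D ((1 : ℝ) ⊗ₜ[ℤ] ω₀)).anticones) →
      Submodule.span ℤ (D '' {i | z₀ i ≠ 0}) = LinearMap.ker (Module.Dual.eval ℤ L e) →
      ∃ x₀ : Spec (CommRingCat.of ℂ) ⟶ ToricWall.gitQuotient D ω₀,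
        (∃ hz : ToricWall.IsSemistable D ω₀ (T := Over.mk (𝟙 (Spec (CommRingCat.of ℂ))))
            (fun i => ToricWall.const _ (z₀ i)), x₀ = ToricWall.gitMap D ω₀ _ hz) ∧
        ∃ j : ToricWall.StackHom (ToricWall.weighted (ToricWall.weights D e))
            (ToricWall.GITData.mk D ωp).space,
          ToricWall.IsInducedBy j z₀ ∧
          (∃ Y, j.IsClosedImmersionOnto Y) ∧
          (∀ ξ, ToricWall.IsBlowDownValue ω₀ (j.functor.obj ξ)
            ((j.functor.obj ξ).base.hom ≫ x₀)) ∧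
          (∀ ξ : ToricWall.QuotStack (ToricWall.GITData.mk D ωp).space, IsIso ξ.base.hom →
            ToricWall.IsBlowDownValue ω₀ ξ (ξ.base.hom ≫ x₀) → j.functor.essImage ξ)) := by
  classical
  have he := ToricWall.exists_apply_eq_one hwall.primitive
  have hmem := intrinsicInterior_subset hω₀
  have h₀ : ω₀ e = 0 := by
    have h := LinearMap.mem_ker.1 hmem.1
    rw [ToricWall.pairing_tmul, one_mul] at h
    exact_mod_cast h
  have hw : ToricWall.IsOnWall D e ωp ω₀ := ⟨hwall.stable_p, hwall.pos, hmem.2, h₀⟩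
  obtain ⟨θ, hθ⟩ := ToricWall.exists_dualEx_equiv he hgen
  have hpos : 0 < ToricWall.realForm θ ((ToricWall.projEx D e).baseChange ℝ ωp) := by
    rw [ToricWall.realForm_projEx hθ]
    exact hw.pairing_pos
  refine ⟨⟨θ, hθ⟩, fun I => ?_, ?_, ToricWall.exists_dataEx_isIsomorphism hθ hw.pairing_pos,
    ToricWall.exists_dataExAll_isClosedImmersionOnto hθ hw.pairing_pos,
    ToricWall.existsUnique_isBlowDownValue fun T z =>
      ToricWall.isSemistable_of_mem_space hw.stable hw.mem_closure z, ?_,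
    fun z₀ hz hI hspan => ?_⟩
  · rw [ToricWall.mem_anticones_iff_of_rank_one (θ := θ) _ hpos]
    simp only [ToricWall.dataExAll, hθ]
  · obtain ⟨i, -, hi⟩ := ToricWall.exists_pos_of_mem_anticones hw.pairing_pos hw.stable.univ_mem
    exact ToricWall.isStable_of_rank_one _ hpos ⟨⟨i, hi⟩, by rw [ToricWall.dataEx, hθ]; exact hi⟩
  · exact ToricWall.mem_posCone_of_mem_intrinsicInterior D he hwall.pos hwall.facet hω₀
  · have hz₀ : ToricWall.IsWallPoint D e ω₀ z₀ := ⟨hz, hI, hspan⟩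
    obtain ⟨χ₁, hχ₁⟩ := he
    have h₁ : Module.Dual.eval ℤ L e χ₁ = 1 := hχ₁
    exact ⟨_, ⟨hz₀.isSemistable_const _, rfl⟩, _, ToricWall.isInducedBy_stackHom hw hz₀ h₁,
      ⟨_, (ToricWall.wallSlice hw hz₀).isClosedImmersionOnto h₁⟩,
      ToricWall.isBlowDownValue_stackHom hw hz₀ h₁,
      ToricWall.essImage_of_isBlowDownValue hw hz₀ h₁⟩
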